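/- Let $n,m$ be non-negative integers, and let $\kappa,a$ be real numbers with $$\kappa\ge 0,\qquad a<-2\bigl(m+\kappa(n-1)\bigr)+1 .$$ Partitions are sequences $\lambda=(\lambda_1\ge\cdots\ge\lambda_n\ge 0)$ of integers, $|\lambda|=\lambda_1+\cdots+\lambda_n$, and $m_\lambda(x)=\sum_{\alpha}x^\alpha$, summed over the distinct rearrangements $\alpha$ of $\lambda$. Write $\mu<\lambda$ if $\mu\ne\lambda$, $|\mu|=|\lambda|$ and $\mu_1+\cdots+\mu_i\le\lambda_1+\cdots+\lambda_i$ for all $i$, and $\mu\subset\lambda$ if $\mu\neq\lambda$ and $\mu_i\le\lambda_i$ for all $i$. Let $$E_1=\sum_i x_i\frac{\partial}{\partial x_i},\qquad D_2=\sum_{i} x_i^2\frac{\partial^2}{\partial x_i^2}+2\kappa\sum_{i\ne j}\frac{x_i^2}{x_i-x_j}\frac{\partial}{\partial x_i},\qquad D^B=D_2+\sum_{i}(ax_i+2)\frac{\partial}{\partial x_i}.$$ The monic Jack polynomial $P_\lambda\in\mathbb C[x_1,\dots,x_n]$ is the polynomial of the form $P_\lambda=m_\lambda+\sum_{\mu<\lambda}u_{\lambda\mu}m_\mu$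 that is an eigenfunction of $E_1$ and $D_2$. The multivariable Bessel polynomial $Y_\lambda$ is the polynomial of the form $Y_\lambda=P_\lambda+\sum_{\mu\subset\lambda}v_{\lambda\mu}P_\mu$, with complex coefficients $v_{\lambda\mu}$, that is an eigenfunction of $D^B$. Then for every partition $\lambda=(\lambda_1,\dots,\lambda_n)$ with $|\lambda|\le m$ the polynomial $Y_\lambda$ exists, is unique, and belongs to $L^2(\mathbb R_+^n,d\mu^{(B)})$, where $\mathbb R_+=(0,\infty)$ and $$d\mu^{(B)}(x)=\prod_{i=1}^n x_i^{a-2}e^{-2/x_i}\prod_{i<j}|x_i-x_j|^{2\kappa}\,dx_1\cdots dx_n .$$ Moreover, these polynomials form an orthogonal system: for any two distinct partitions $\lambda\ne\mu$ with $|\lambda|,|\mu|\le m$, $$\langle Y_\lambda,Y_\mu\rangle_{a,\kappa}=\int_{\mathbb R_+^n}Y_\lambda(x)\,\overline{Y_\mu(x)}\,d\mu^{(B)}(x)=0 .$$ -/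

import Mathlib

noncomputable section

namespace MultiBessel

/-- Weight `|λ| = λ_1 + ⋯ + λ_n`. Partitions of length at most `n` are the antitone (that is,
weakly decreasing) functions `Fin n → ℕ`. -/
def weight {n : ℕ} (lam : Fin n → ℕ) : ℕ := ∑ i, lam i

/-- Strict dominance order `μ < λ`; only partitions of equal weight are comparable. -/
def DomLT {n : ℕ} (mu lam : Fin n → ℕ) : Prop :=
  mu ≠ lam ∧ weight mu = weight lam ∧
    ∀ i, ∑ j ∈ Finset.Iic i, mu j ≤ ∑ j ∈ Finset.Iic i, lam j

/-- The monomial symmetric polynomial `m_λ`: the sum of the monomials `x^α` over the distinct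
rearrangements `α` of `λ`. -/
def monomialSymm {n : ℕ} (lam : Fin n → ℕ) : MvPolynomial (Fin n) ℂ :=
  ∑ α ∈ Finset.univ.image (fun σ : Equiv.Perm (Fin n) => lam ∘ σ), ∏ i, MvPolynomial.X i ^ α i

/-- The field `ℂ(x_1, …, x_n)`, in which the differential operators below take their values. -/
abbrev RatFun (n : ℕ) : Type := FractionRing (MvPolynomial (Fin n) ℂ)

/-- A polynomial, regarded as a rational function. -/
abbrev toRat {n : ℕ} (f : MvPolynomial (Fin n) ℂ) : RatFun n :=
  algebraMap (MvPolynomial (Fin n) ℂ) (RatFun n) f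

/-- The Euler operator `E_1 = ∑_i x_i ∂/∂x_i`. -/
def eulerOp {n : ℕ} (f : MvPolynomial (Fin n) ℂ) : RatFun n :=
  toRat (∑ i, MvPolynomial.X i * MvPolynomial.pderiv i f)

/-- `D_2 = ∑_i x_i² ∂²/∂x_i² + 2κ ∑_{i ≠ j} x_i² / (x_i - x_j) ∂/∂x_i`. -/
def jackOp {n : ℕ} (κ : ℝ) (f : MvPolynomial (Fin n) ℂ) : RatFun n :=
  toRat (∑ i, MvPolynomial.X i ^ 2 * MvPolynomial.pderiv i (MvPolynomial.pderiv i f)) +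
    toRat (MvPolynomial.C (2 * (κ : ℂ))) *
      ∑ i, ∑ j ∈ Finset.univ.erase i,
        toRat (MvPolynomial.X i ^ 2) / toRat (MvPolynomial.X i - MvPolynomial.X j) *
          toRat (MvPolynomial.pderiv i f)

/-- `D^B = ∑_i x_i² ∂²/∂x_i² + ∑_i (a x_i + 2) ∂/∂x_i
+ 2κ ∑_{i ≠ j} x_i² / (x_i - x_j) ∂/∂x_i`. -/
def besselOp {n : ℕ} (κ a : ℝ) (f : MvPolynomial (Fin n) ℂ) : RatFun n :=
  toRat (∑ i, MvPolynomial.X i ^ 2 * MvPolynomial.pderiv i (MvPolynomial.pderiv i f)) +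
    toRat (∑ i, (MvPolynomial.C (a : ℂ) * MvPolynomial.X i + 2) * MvPolynomial.pderiv i f) +
    toRat (MvPolynomial.C (2 * (κ : ℂ))) *
      ∑ i, ∑ j ∈ Finset.univ.erase i,
        toRat (MvPolynomial.X i ^ 2) / toRat (MvPolynomial.X i - MvPolynomial.X j) *
          toRat (MvPolynomial.pderiv i f)

/-- `D f = c f` for some scalar `c`. (Below, `f` is always nonzero.) -/
def IsEigen {n : ℕ} (D : MvPolynomial (Fin n) ℂ → RatFun n) (f : MvPolynomial (Fin n) ℂ) : Prop :=
  ∃ c : ℂ, D f = toRat (MvPolynomial.C c * f)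

/-- `P` is the monic Jack polynomial `P_λ` in `n` variables with parameter `κ`:
`P = m_λ + ∑_{μ < λ} u_{λμ} m_μ` (dominance order), and `P` is an eigenfunction of
`E_1` and `D_2`. -/
def IsJack {n : ℕ} (κ : ℝ) (lam : Fin n → ℕ) (P : MvPolynomial (Fin n) ℂ) : Prop :=
  P - monomialSymm lam ∈
      Submodule.span ℂ {q | ∃ mu : Fin n → ℕ, Antitone mu ∧ DomLT mu lam ∧ q = monomialSymm mu} ∧
    IsEigen eulerOp P ∧ IsEigen (jackOp κ) P

/-- `Y` is the multivariable Bessel polynomial `Y_λ`: `Y = P_λ + ∑_{μ ⊂ λ} u_{λμ} P_μ`, the sum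
being over the partitions whose diagram is strictly contained in that of `λ`, and `Y` is an
eigenfunction of `D^B`. (`mu < lam` is the pointwise order of functions.) -/
def IsBessel {n : ℕ} (κ a : ℝ) (lam : Fin n → ℕ) (Y : MvPolynomial (Fin n) ℂ) : Prop :=
  (∃ P, IsJack κ lam P ∧
    Y - P ∈ Submodule.span ℂ {Q | ∃ mu : Fin n → ℕ, Antitone mu ∧ mu < lam ∧ IsJack κ mu Q}) ∧
  IsEigen (besselOp κ a) Y

/-- The weight function `∏_i x_i^{a-2} e^{-2/x_i} ∏_{i<j} |x_i - x_j|^{2κ}`. -/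
def besselWeight {n : ℕ} (κ a : ℝ) (x : Fin n → ℝ) : ℝ :=
  (∏ i, x i ^ (a - 2) * Real.exp (-2 / x i)) *
    ∏ i, ∏ j ∈ Finset.Ioi i, |x i - x j| ^ (2 * κ)

/-- The measure on `ℝⁿ` with density `besselWeight` on the open orthant `(0, ∞)ⁿ` (and zero
outside it). -/
def besselMeasure (n : ℕ) (κ a : ℝ) : MeasureTheory.Measure (Fin n → ℝ) :=
  (MeasureTheory.volume.restrict {x : Fin n → ℝ | ∀ i, 0 < x i}).withDensity
    (fun x => ENNReal.ofReal (besselWeight κ a x))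

/-- The function on `ℝⁿ` given by a polynomial with complex coefficients. -/
def evalReal {n : ℕ} (f : MvPolynomial (Fin n) ℂ) (x : Fin n → ℝ) : ℂ :=
  MvPolynomial.eval (fun i => (x i : ℂ)) f

/-- `⟨f, g⟩ = ∫ f(x) conj(g(x)) dμ(x)` over the orthant, `μ` being `besselMeasure`. -/
def innerB {n : ℕ} (κ a : ℝ) (f g : MvPolynomial (Fin n) ℂ) : ℂ :=
  ∫ x, evalReal f x * starRingEnd ℂ (evalReal g x) ∂(besselMeasure n κ a)

end MultiBessel

end

/-!
A symmetric polynomial is handled through the Cherednik operators `ξ_i`, which commute and act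
triangularly on polynomials whose exponents are dominated by a partition (`cherednik_belowSub`).
On symmetric polynomials `D_2` is `∑ (ξ_i² - ξ_i)` up to a constant (`jackOp_eq`), so it is
triangular for the dominance order, and its eigenvalues strictly increase along that order
(`DomLT.jackEig_lt`). Hence the Jack polynomials exist, are unique, form a basis of the symmetric
polynomials, and are eigenfunctions of every symmetric function of the `ξ_i` (`genOp_jack`).

Intertwining relations between `∏ (u + ξ_i)` and two operators that raise and lower the degree
show that multiplication by `p_1 = ∑ x_i` adds one box to the index of a Jack polynomial
(`coord_p1S`) and that `∑ ∂_i` removes one (`coord_e0S`). Since `D^B = D_2 + a E_1 + 2 ∑ ∂_i`,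
this operator is triangular on the Jack polynomials for inclusion of diagrams. The bound on `a`
makes its eigenvalues strictly decrease along inclusion (`besselEig_lt`), which gives existence
and uniqueness of `Y_λ`.

The same bound makes the product of two polynomials integrable when their degrees add up to at
most `2 m`, in particular `Y_λ` square-integrable. For such pairs `D^B` is symmetric
(`integral_green`): Green's identity expresses `(D^B f) g - f (D^B g)` times the weight as a
divergence. The weight extends smoothly by zero across the walls `x_i = 0`; the diagonals
`x_i = x_j` and infinity are treated by a regularized weight, followed by dominated convergence.

Symmetry of `D^B` separates `Y_λ` and `Y_μ` when their eigenvalues differ, but distinct partitions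
may have the same eigenvalue. The multiplication by `p_1` is also symmetric, and it is the sum
over `j` of its components `rowUp j`, which add a box in row `j`. The commutator of `∑ ∂_i` and
`rowUp j` is diagonal (`coord_e0S_rowUp`), because the commutator of `∑ ∂_i` and `p_1` is a
scalar. Therefore `rowUp j` maps an eigenfunction of `D^B` to an eigenfunction, with a known
eigenvalue, up to lower terms (`besselS_rowUp`). Every nonempty `λ` occurs in some product
`p_1 P_σ` (`exists_coord_p1S_ne_zero`), and comparing `⟨p_1 Y_σ, Y_μ⟩` with `⟨Y_σ, p_1 Y_μ⟩` expresses
`⟨Y_λ, Y_μ⟩` through products that vanish by induction on the weights (`IsBesselForm.orthogonal`).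
-/


noncomputable section

namespace MultiBessel

open MvPolynomial Equiv

/-! ### Dunkl operators -/

/-- Linear operators on the polynomial ring. -/
abbrev Op (n : ℕ) : Type := Module.End ℂ (MvPolynomial (Fin n) ℂ)

/-- Multiplication by `x_i`. -/
def mulX {n : ℕ} (i : Fin n) : Op n := LinearMap.mulLeft ℂ (X i)

/-- The action of the symmetric group by permutation of the variables. -/
def permOp {n : ℕ} : Perm (Fin n) →* Op n where
  toFun w := (rename (w : Fin n → Fin n)).toLinearMap
  map_one' := by ext; simp
  map_mul' v w := by
    refine LinearMap.ext fun f => ?_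
    simp [rename_rename]

theorem mulX_apply {n : ℕ} (i : Fin n) (f : MvPolynomial (Fin n) ℂ) : mulX i f = X i * f := rfl

theorem permOp_apply {n : ℕ} (w : Perm (Fin n)) (f : MvPolynomial (Fin n) ℂ) :
    permOp w f = rename w f := rfl

theorem X_sub_X_ne_zero {n : ℕ} {i j : Fin n} (h : i ≠ j) :
    (X i - X j : MvPolynomial (Fin n) ℂ) ≠ 0 := fun H => h (X_injective (sub_eq_zero.1 H))

/-- The divided difference of the variable `x_k`: the factor is `(1 - s_{ij}) x_k / (x_i - x_j)`. -/
theorem X_sub_X_swap {n : ℕ} {i j : Fin n} (hij : i ≠ j) (k : Fin n) :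
    (X k - X (swap i j k) : MvPolynomial (Fin n) ℂ) =
      (X i - X j) * C (if k = i then 1 else if k = j then -1 else 0) := by
  by_cases h1 : k = i
  · subst h1; simp
  by_cases h2 : k = j
  · subst h2; simp [h1]
  · simp [h1, h2, swap_apply_of_ne_of_ne h1 h2]

theorem exists_divDiff {n : ℕ} {i j : Fin n} (hij : i ≠ j) (f : MvPolynomial (Fin n) ℂ) :
    ∃ q, (X i - X j) * q = f - rename (swap i j) f := by
  induction f using MvPolynomial.induction_on with
  | C a => exact ⟨0, by simp⟩
  | add p q hp hq =>
    obtain ⟨p', hp⟩ := hp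
    obtain ⟨q', hq⟩ := hq
    exact ⟨p' + q', by rw [mul_add, hp, hq, map_add]; ring⟩
  | mul_X p k hp =>
    obtain ⟨p', hp⟩ := hp
    refine ⟨p' * X k + rename (swap i j) p * C (if k = i then 1 else if k = j then -1 else 0), ?_⟩
    have h := X_sub_X_swap hij k
    rw [map_mul, rename_X]
    linear_combination X k * hp - rename (swap i j) p * h

/-- The divided difference `f ↦ (f - s_{ij} f) / (x_i - x_j)`, which maps polynomials to
polynomials; it is set to `0` for `i = j`. -/
def divDiff {n : ℕ} (i j : Fin n) : Op n :=
  if hij : i = j then 0 else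
    { toFun := fun f => Classical.choose (exists_divDiff hij f)
      map_add' := fun f g => by
        apply mul_left_cancel₀ (X_sub_X_ne_zero hij)
        rw [mul_add, Classical.choose_spec (exists_divDiff hij f),
          Classical.choose_spec (exists_divDiff hij g),
          Classical.choose_spec (exists_divDiff hij (f + g)), map_add]
        ring
      map_smul' := fun a f => by
        apply mul_left_cancel₀ (X_sub_X_ne_zero hij)
        rw [RingHom.id_apply, mul_smul_comm, Classical.choose_spec (exists_divDiff hij f),
          Classical.choose_spec (exists_divDiff hij (a • f)), map_smul, smul_sub] }

theorem sub_mul_divDiff {n : ℕ} {i j : Fin n} (hij : i ≠ j) (f : MvPolynomial (Fin n) ℂ) :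
    (X i - X j) * divDiff i j f = f - rename (swap i j) f := by
  rw [divDiff, dif_neg hij]
  exact Classical.choose_spec (exists_divDiff hij f)

theorem divDiff_eq {n : ℕ} {i j : Fin n} (hij : i ≠ j) {f q : MvPolynomial (Fin n) ℂ}
    (h : (X i - X j) * q = f - rename (swap i j) f) : divDiff i j f = q := by
  apply mul_left_cancel₀ (X_sub_X_ne_zero hij)
  rw [h, sub_mul_divDiff hij]

theorem divDiff_mul_mulX {n : ℕ} {i j : Fin n} (hij : i ≠ j) (k : Fin n) :
    divDiff i j * mulX k = mulX k * divDiff i j +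
      (if k = i then 1 else if k = j then -1 else 0 : ℂ) • permOp (swap i j) := by
  refine LinearMap.ext fun f => divDiff_eq hij ?_
  have h := X_sub_X_swap hij k
  have h2 := sub_mul_divDiff hij f
  simp only [LinearMap.add_apply, LinearMap.smul_apply, Module.End.mul_apply, mulX_apply,
    permOp_apply, map_mul, rename_X, MvPolynomial.smul_eq_C_mul]
  linear_combination X k * h2 - rename (swap i j) f * h

theorem swap_conj {n : ℕ} (w : Perm (Fin n)) (i j : Fin n) :
    swap (w i) (w j) * w = w * swap i j := by
  rw [swap_apply_apply]; group

theorem permOp_mul_mulX {n : ℕ} (w : Perm (Fin n)) (i : Fin n) :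
    permOp w * mulX i = mulX (w i) * permOp w := by
  refine LinearMap.ext fun f => ?_
  simp [mulX_apply, permOp_apply]

theorem permOp_mul_divDiff {n : ℕ} (w : Perm (Fin n)) (i j : Fin n) :
    permOp w * divDiff i j = divDiff (w i) (w j) * permOp w := by
  by_cases hij : i = j
  · simp [divDiff, hij]
  refine LinearMap.ext fun f => ?_
  have hw : w i ≠ w j := fun h => hij (w.injective h)
  refine (divDiff_eq hw ?_).symm
  have h := congrArg (rename w) (sub_mul_divDiff hij f)
  simp only [map_mul, map_sub, rename_X] at h
  simp only [Module.End.mul_apply, permOp_apply]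
  rw [h, ← permOp_apply, ← permOp_apply, ← permOp_apply, ← permOp_apply,
    ← Module.End.mul_apply, ← Module.End.mul_apply, ← map_mul, ← map_mul, swap_conj]

theorem permOp_mul_pderiv {n : ℕ} (w : Perm (Fin n)) (i : Fin n) (f : MvPolynomial (Fin n) ℂ) :
    rename w (pderiv i f) = pderiv (w i) (rename w f) :=
  (pderiv_rename w.injective i f).symm

/-- The Dunkl operator `T_i = ∂_i + c ∑_{j ≠ i} (1 - s_{ij}) / (x_i - x_j)`. -/
def dunkl {n : ℕ} (c : ℂ) (i : Fin n) : Op n :=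
  (pderiv i : Derivation ℂ (MvPolynomial (Fin n) ℂ) (MvPolynomial (Fin n) ℂ)).toLinearMap +
    c • ∑ j ∈ Finset.univ.erase i, divDiff i j

theorem dunkl_apply {n : ℕ} (c : ℂ) (i : Fin n) (f : MvPolynomial (Fin n) ℂ) :
    dunkl c i f = pderiv i f + c • ∑ j ∈ Finset.univ.erase i, divDiff i j f := by
  simp [dunkl]

theorem permOp_mul_dunkl {n : ℕ} (c : ℂ) (w : Perm (Fin n)) (i : Fin n) :
    permOp w * dunkl c i = dunkl c (w i) * permOp w := by
  rw [dunkl, dunkl, mul_add, add_mul, mul_smul_comm, smul_mul_assoc, Finset.mul_sum,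
    Finset.sum_mul]
  congr 1
  · refine LinearMap.ext fun f => ?_
    exact permOp_mul_pderiv w i f
  · congr 1
    refine Finset.sum_equiv w (by simp) fun j _ => ?_
    exact permOp_mul_divDiff w i j

theorem pderiv_mul_mulX {n : ℕ} (i k : Fin n) :
    ((pderiv i : Derivation ℂ (MvPolynomial (Fin n) ℂ) (MvPolynomial (Fin n) ℂ)).toLinearMap :
        Op n) * mulX k = mulX k *
      (pderiv i : Derivation ℂ (MvPolynomial (Fin n) ℂ) (MvPolynomial (Fin n) ℂ)).toLinearMap +
      if k = i then 1 else 0 := by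
  refine LinearMap.ext fun f => ?_
  by_cases h : k = i
  · subst h; simp [mulX_apply]
  · simp [mulX_apply, h]

theorem dunkl_mul_mulX_of_ne {n : ℕ} (c : ℂ) {i j : Fin n} (hij : i ≠ j) :
    dunkl c i * mulX j = mulX j * dunkl c i - c • permOp (swap i j) := by
  have h : ∑ k ∈ Finset.univ.erase i, divDiff i k * mulX j =
      mulX j * ∑ k ∈ Finset.univ.erase i, divDiff i k - permOp (swap i j) := by
    rw [Finset.mul_sum, eq_sub_iff_add_eq, ← eq_sub_iff_add_eq', ← Finset.sum_sub_distrib,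
      Finset.sum_eq_single j]
    · rw [divDiff_mul_mulX hij, if_neg hij.symm, if_pos rfl]; module
    · intro k hk hkj
      rw [divDiff_mul_mulX (Finset.ne_of_mem_erase hk).symm]
      simp [hij.symm, hkj.symm]
    · simp [hij.symm]
  rw [dunkl, add_mul, pderiv_mul_mulX, smul_mul_assoc, Finset.sum_mul, h, if_neg hij.symm, mul_add,
    mul_smul_comm, smul_sub]
  abel

theorem dunkl_mul_mulX_self {n : ℕ} (c : ℂ) (i : Fin n) :
    dunkl c i * mulX i = mulX i * dunkl c i + 1 +
      c • ∑ j ∈ Finset.univ.erase i, permOp (swap i j) := by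
  have h : ∑ k ∈ Finset.univ.erase i, divDiff i k * mulX i =
      mulX i * ∑ k ∈ Finset.univ.erase i, divDiff i k +
        ∑ j ∈ Finset.univ.erase i, permOp (swap i j) := by
    rw [Finset.mul_sum, ← Finset.sum_add_distrib]
    refine Finset.sum_congr rfl fun k hk => ?_
    rw [divDiff_mul_mulX (Finset.ne_of_mem_erase hk).symm]
    simp
  rw [dunkl, add_mul, pderiv_mul_mulX, smul_mul_assoc, Finset.sum_mul, h, if_pos rfl, mul_add,
    mul_smul_comm, smul_add]
  abel

/-- An operator that commutes with all multiplications and kills `1` vanishes. -/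
theorem op_eq_zero {n : ℕ} {A : Op n} (h : ∀ k, A * mulX k = mulX k * A) (h1 : A 1 = 0) :
    A = 0 := by
  refine LinearMap.ext fun f => ?_
  induction f using MvPolynomial.induction_on with
  | C a => rw [← mul_one (C a), ← smul_eq_C_mul, map_smul, h1]; simp
  | add p q hp hq => rw [map_add, hp, hq]; simp
  | mul_X p k hp =>
    have := LinearMap.congr_fun (h k) p
    simp only [Module.End.mul_apply, mulX_apply] at this
    rw [mul_comm, this, hp]; simp

theorem dunkl_one {n : ℕ} (c : ℂ) (i : Fin n) : dunkl c i 1 = 0 := by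
  rw [dunkl_apply, Finset.sum_eq_zero]
  · simp
  · intro j hj
    exact divDiff_eq (Finset.ne_of_mem_erase hj).symm (by simp)

theorem permOp_swap_mul_dunkl_of_ne {n : ℕ} (c : ℂ) {i j k : Fin n} (hi : k ≠ i) (hj : k ≠ j) :
    permOp (swap i j) * dunkl c k = dunkl c k * permOp (swap i j) := by
  rw [permOp_mul_dunkl, swap_apply_of_ne_of_ne hi hj]

/-- Dunkl operators commute: by the Jacobi identity their commutator commutes with every
multiplication operator, and it kills constants. -/
theorem dunkl_commute {n : ℕ} (c : ℂ) (i j : Fin n) :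
    dunkl c i * dunkl c j = dunkl c j * dunkl c i := by
  by_cases hij : i = j
  · rw [hij]
  rw [← sub_eq_zero]
  -- Multiplication by `x_i` is the case where both commutators have extra terms; stating it for
  -- all pairs covers multiplication by `x_j` as well.
  have key : ∀ i j : Fin n, i ≠ j →
      (dunkl c i * dunkl c j - dunkl c j * dunkl c i) * mulX i =
        mulX i * (dunkl c i * dunkl c j - dunkl c j * dunkl c i) := by
    intro i j hij
    have hji := Ne.symm hij
    have e1 := dunkl_mul_mulX_self c i
    have e2 := dunkl_mul_mulX_of_ne c hji
    -- Only the term `k = j` of the sum of transpositions fails to commute with `T_j`.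
    have e3 : (∑ k ∈ Finset.univ.erase i, permOp (swap i k)) * dunkl c j -
        dunkl c j * (∑ k ∈ Finset.univ.erase i, permOp (swap i k)) =
        dunkl c i * permOp (swap j i) - permOp (swap j i) * dunkl c i := by
      rw [Finset.sum_mul, Finset.mul_sum, ← Finset.sum_sub_distrib, Finset.sum_eq_single j]
      · rw [permOp_mul_dunkl, permOp_mul_dunkl]
        simp [swap_comm]
      · intro k hk hkj
        rw [permOp_swap_mul_dunkl_of_ne c hji hkj.symm, sub_self]
      · simp [hji]
    have l1 : dunkl c i * dunkl c j * mulX i = mulX i * dunkl c i * dunkl c j + dunkl c j +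
        c • ((∑ k ∈ Finset.univ.erase i, permOp (swap i k)) * dunkl c j) -
        c • (dunkl c i * permOp (swap j i)) := by
      rw [mul_assoc, e2, mul_sub, ← mul_assoc, e1, mul_smul_comm, add_mul, add_mul, one_mul,
        smul_mul_assoc]
    have l2 : dunkl c j * dunkl c i * mulX i = mulX i * dunkl c j * dunkl c i + dunkl c j +
        c • (dunkl c j * (∑ k ∈ Finset.univ.erase i, permOp (swap i k))) -
        c • (permOp (swap j i) * dunkl c i) := by
      rw [mul_assoc, e1, mul_add, mul_add, ← mul_assoc, e2, mul_smul_comm, sub_mul,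
        smul_mul_assoc, mul_one]
      abel
    rw [sub_mul, l1, l2, mul_sub, mul_assoc, mul_assoc]
    have e4 := congrArg (fun A => c • A) e3
    simp only [smul_sub] at e4
    rw [← sub_eq_zero] at e4 ⊢
    rw [← e4]
    abel
  refine op_eq_zero (fun k => ?_) (by simp [dunkl_one])
  by_cases hki : k = i
  · subst hki; exact key k j hij
  by_cases hkj : k = j
  · subst hkj
    have := key k i (Ne.symm hij)
    rw [sub_mul, mul_sub, ← sub_eq_zero] at this ⊢
    rw [← neg_eq_zero, ← this]
    abel
  · have e1 := dunkl_mul_mulX_of_ne c (Ne.symm hki)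
    have e2 := dunkl_mul_mulX_of_ne c (Ne.symm hkj)
    have c1 := permOp_swap_mul_dunkl_of_ne c (i := i) (j := k) (k := j) (Ne.symm hij) (Ne.symm hkj)
    have c2 := permOp_swap_mul_dunkl_of_ne c (i := j) (j := k) (k := i) hij (Ne.symm hki)
    rw [sub_mul, mul_assoc, mul_assoc, e1, e2, mul_sub, mul_sub, ← mul_assoc, ← mul_assoc, e1, e2,
      sub_mul, sub_mul, mul_smul_comm, mul_smul_comm, smul_mul_assoc, smul_mul_assoc, c1, c2,
      mul_sub, mul_assoc, mul_assoc]
    abel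

/-! ### Cherednik operators -/

theorem swap_sq_op {n : ℕ} (i j : Fin n) : permOp (swap i j) * permOp (swap i j) = 1 := by
  rw [← map_mul, swap_mul_self, map_one]

/-- The operator `x_i T_i`. -/
def dunklEuler {n : ℕ} (c : ℂ) (i : Fin n) : Op n := mulX i * dunkl c i

theorem permOp_mul_dunklEuler {n : ℕ} (c : ℂ) (w : Perm (Fin n)) (i : Fin n) :
    permOp w * dunklEuler c i = dunklEuler c (w i) * permOp w := by
  rw [dunklEuler, dunklEuler, ← mul_assoc, permOp_mul_mulX, mul_assoc, permOp_mul_dunkl, mul_assoc]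

theorem mulX_commute {n : ℕ} (i j : Fin n) : (mulX i : Op n) * mulX j = mulX j * mulX i := by
  refine LinearMap.ext fun f => ?_
  simp only [Module.End.mul_apply, mulX_apply]
  ring

theorem dunklEuler_mul_sub {n : ℕ} (c : ℂ) {i j : Fin n} (hij : i ≠ j) :
    dunklEuler c i * dunklEuler c j - dunklEuler c j * dunklEuler c i =
      c • ((dunklEuler c j - dunklEuler c i) * permOp (swap i j)) := by
  have h : ∀ i j : Fin n, i ≠ j → dunklEuler c i * dunklEuler c j =
      mulX i * mulX j * (dunkl c i * dunkl c j) - c • (dunklEuler c i * permOp (swap i j)) := by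
    intro i j hij
    have e : permOp (swap i j) * dunkl c j = dunkl c i * permOp (swap i j) := by
      rw [permOp_mul_dunkl, swap_apply_right]
    rw [dunklEuler, dunklEuler, mul_assoc, ← mul_assoc (dunkl c i), dunkl_mul_mulX_of_ne c hij,
      sub_mul, smul_mul_assoc, e, mul_sub, mul_smul_comm]
    simp only [mul_assoc]
  rw [h i j hij, h j i hij.symm, dunkl_commute c j i, mulX_commute j i, swap_comm j i, sub_mul,
    smul_sub]
  abel

/-- The Jucys–Murphy sum `∑_{j > i} s_{ij}`. -/
def jucysMurphy {n : ℕ} (i : Fin n) : Op n := ∑ j ∈ Finset.Ioi i, permOp (swap i j)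

theorem permOp_mul_jucysMurphy {n : ℕ} {w : Perm (Fin n)} {i : Fin n} (hi : w i = i)
    (h : ∀ j, i < j ↔ i < w j) : permOp w * jucysMurphy i = jucysMurphy i * permOp w := by
  rw [jucysMurphy, Finset.mul_sum, Finset.sum_mul]
  refine Finset.sum_equiv w (by simpa using h) fun j _ => ?_
  rw [← map_mul, ← map_mul]
  congr 1
  rw [← swap_conj, hi]

/-- The Cherednik operator `ξ_i = x_i T_i + c ∑_{j > i} s_{ij}`. -/
def cherednik {n : ℕ} (c : ℂ) (i : Fin n) : Op n := dunklEuler c i + c • jucysMurphy i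

theorem cherednik_commute_jucysMurphy {n : ℕ} (c : ℂ) {i j : Fin n} (hij : i < j) :
    cherednik c i * jucysMurphy j = jucysMurphy j * cherednik c i := by
  have key : ∀ l, j < l →
      cherednik c i * permOp (swap j l) = permOp (swap j l) * cherednik c i := by
    intro l hl
    have hi : swap j l i = i := swap_apply_of_ne_of_ne hij.ne (hij.trans hl).ne
    rw [cherednik, add_mul, mul_add, smul_mul_assoc, mul_smul_comm, permOp_mul_dunklEuler, hi,
      permOp_mul_jucysMurphy hi]
    intro k
    rw [swap_apply_def]
    split_ifs with h1 h2
    · subst h1; exact ⟨fun _ => hij.trans hl, fun _ => hij⟩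
    · subst h2; exact ⟨fun _ => hij, fun _ => hij.trans hl⟩
    · rfl
  rw [jucysMurphy, Finset.mul_sum, Finset.sum_mul]
  exact Finset.sum_congr rfl fun l hl => key l (Finset.mem_Ioi.1 hl)

theorem cherednik_commute {n : ℕ} (c : ℂ) (i j : Fin n) :
    cherednik c i * cherednik c j = cherednik c j * cherednik c i := by
  have key : ∀ i j : Fin n, i < j →
      cherednik c i * cherednik c j = cherednik c j * cherednik c i := by
    intro i j hij
    have h1 : jucysMurphy i * dunklEuler c j - dunklEuler c j * jucysMurphy i =
        (dunklEuler c i - dunklEuler c j) * permOp (swap i j) := by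
      rw [jucysMurphy, Finset.mul_sum, Finset.sum_mul, ← Finset.sum_sub_distrib,
        Finset.sum_eq_single j]
      · rw [permOp_mul_dunklEuler, swap_apply_right, sub_mul]
      · intro l _ hl
        rw [permOp_mul_dunklEuler, swap_apply_of_ne_of_ne hij.ne' hl.symm, sub_self]
      · simp [hij]
    have h2 := dunklEuler_mul_sub c hij.ne
    -- The Jucys–Murphy part of `ξ_i` makes up for the commutator of `x_i T_i` and `x_j T_j`.
    have h3 : cherednik c i * dunklEuler c j = dunklEuler c j * cherednik c i := by
      rw [← sub_eq_zero, cherednik, add_mul, mul_add, smul_mul_assoc, mul_smul_comm]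
      have : c • (jucysMurphy i * dunklEuler c j) - c • (dunklEuler c j * jucysMurphy i) =
          c • ((dunklEuler c i - dunklEuler c j) * permOp (swap i j)) := by
        rw [← h1]; exact (smul_sub _ _ _).symm
      rw [add_sub_add_comm, h2, this, ← smul_add, ← add_mul]
      simp
    rw [cherednik.eq_1 c j, mul_add, add_mul, h3, mul_smul_comm, smul_mul_assoc,
      cherednik_commute_jucysMurphy c hij]
  rcases lt_trichotomy i j with h | h | h
  · exact key i j h
  · rw [h]
  · exact (key j i h).symm

open scoped IsMulCommutative in
/-- Polynomials can be evaluated at commuting elements of a noncommutative algebra. -/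
theorem exists_aeval_of_commute {ι A : Type*} [Ring A] [Algebra ℂ A] (x : ι → A)
    (h : ∀ i j, x i * x j = x j * x i) :
    ∃ Θ : MvPolynomial ι ℂ →ₐ[ℂ] A, ∀ i, Θ (X i) = x i := by
  have : IsMulCommutative (Algebra.adjoin ℂ (Set.range x)) :=
    Algebra.isMulCommutative_adjoin ℂ (by rintro _ ⟨i, rfl⟩ _ ⟨j, rfl⟩; exact h i j)
  refine ⟨(Algebra.adjoin ℂ (Set.range x)).val.comp
    (aeval (S₁ := Algebra.adjoin ℂ (Set.range x))
      fun i => ⟨x i, Algebra.subset_adjoin ⟨i, rfl⟩⟩), fun i => ?_⟩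
  simp

/-- The evaluation `p ↦ p(ξ_1, …, ξ_n)` of polynomials at the commuting Cherednik operators. -/
def cherednikHom {n : ℕ} (c : ℂ) : MvPolynomial (Fin n) ℂ →ₐ[ℂ] Op n :=
  Classical.choose (exists_aeval_of_commute (cherednik c) (cherednik_commute c))

theorem cherednikHom_X {n : ℕ} (c : ℂ) (i : Fin n) : cherednikHom c (X i) = cherednik c i :=
  Classical.choose_spec (exists_aeval_of_commute (cherednik c) (cherednik_commute c)) i

theorem cherednikHom_C {n : ℕ} (c a : ℂ) :
    (cherednikHom c (C a) : Op n) = a • (1 : Op n) := by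
  rw [← algebraMap_eq, AlgHom.commutes, Algebra.algebraMap_eq_smul_one]

/-- The polynomial `∏_i (u + x_i)`. -/
def genPoly {n : ℕ} (u : ℂ) : MvPolynomial (Fin n) ℂ := ∏ i, (C u + X i)

/-- The generating function `∏_i (u + ξ_i)` of the symmetric functions of the Cherednik
operators. -/
def genOp {n : ℕ} (c u : ℂ) : Op n := cherednikHom c (genPoly u)

/-- The relations of the degenerate affine Hecke algebra. -/
theorem adjacent_mul_cherednik {n : ℕ} (c : ℂ) {i j : Fin n} (hij : j.val = i.val + 1) :
    permOp (swap i j) * cherednik c i = cherednik c j * permOp (swap i j) + c • 1 := by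
  have hi : Finset.Ioi i = insert j (Finset.Ioi j) := by
    ext k
    rw [Finset.mem_insert, Finset.mem_Ioi, Finset.mem_Ioi, Fin.lt_def, Fin.lt_def, Fin.ext_iff]
    omega
  have hj : i ≠ j := by intro h; rw [h] at hij; omega
  have h1 : permOp (swap i j) * jucysMurphy i = 1 + jucysMurphy j * permOp (swap i j) := by
    rw [jucysMurphy, hi, Finset.sum_insert (by simp), mul_add, swap_sq_op, jucysMurphy,
      Finset.mul_sum, Finset.sum_mul]
    congr 1
    refine Finset.sum_congr rfl fun k hk => ?_
    rw [Finset.mem_Ioi, Fin.lt_def] at hk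
    have e := swap_conj (swap i j) i k
    rw [swap_apply_left, swap_apply_of_ne_of_ne (a := i) (b := j) (x := k)] at e
    · rw [← map_mul, ← e, map_mul]
    · rw [ne_eq, Fin.ext_iff]; omega
    · rw [ne_eq, Fin.ext_iff]; omega
  rw [cherednik, mul_add, mul_smul_comm, h1, permOp_mul_dunklEuler, swap_apply_left, cherednik,
    add_mul, smul_mul_assoc, smul_add]
  abel

theorem adjacent_mul_cherednik_of_ne {n : ℕ} (c : ℂ) {i j k : Fin n} (hij : j.val = i.val + 1)
    (hi : k ≠ i) (hj : k ≠ j) :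
    permOp (swap i j) * cherednik c k = cherednik c k * permOp (swap i j) := by
  have hk : swap i j k = k := swap_apply_of_ne_of_ne hi hj
  rw [cherednik, add_mul, mul_add, smul_mul_assoc, mul_smul_comm, permOp_mul_dunklEuler, hk,
      permOp_mul_jucysMurphy hk]
  intro l
  rw [ne_eq, Fin.ext_iff] at hi hj
  rw [swap_apply_def]
  split_ifs with h1 h2
  · subst h1; simp only [Fin.lt_def]; omega
  · subst h2; simp only [Fin.lt_def]; omega
  · rfl

theorem adjacent_commute_genOp {n : ℕ} (c u : ℂ) {i j : Fin n} (hij : j.val = i.val + 1) :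
    permOp (swap i j) * genOp c u = genOp c u * permOp (swap i j) := by
  have hne : i ≠ j := by intro h; rw [h] at hij; omega
  set s : Op n := permOp (swap i j) with hs
  set a := cherednik c i with ha
  set b := cherednik c j with hb
  have h1 : s * a = b * s + c • 1 := adjacent_mul_cherednik c hij
  have hss : s * s = 1 := swap_sq_op i j
  have h2 : s * b = a * s - c • 1 := by
    have : s * (s * a) * s = s * (b * s + c • 1) * s := by rw [h1]
    rw [← mul_assoc, hss, one_mul, mul_add, add_mul, mul_assoc s (b * s), mul_assoc b, hss,
      mul_one, mul_smul_comm, mul_one, smul_mul_assoc, hss] at this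
    rw [this]; abel
  have hab : a * b = b * a := cherednik_commute c i j
  -- The symmetric functions of `ξ_i` and `ξ_{i+1}` commute with `s`, although the two operators
  -- themselves do not.
  have hpair : s * cherednikHom c ((C u + X i) * (C u + X j)) =
      cherednikHom c ((C u + X i) * (C u + X j)) * s := by
    simp only [map_mul, map_add, cherednikHom_X, cherednikHom_C, ← ha, ← hb]
    have e1 : s * (u • 1 + a) = (u • 1 + b) * s + c • 1 := by
      rw [mul_add, h1, mul_smul_comm, mul_one, add_mul, smul_mul_assoc, one_mul]; abel
    have e2 : s * (u • 1 + b) = (u • 1 + a) * s - c • 1 := by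
      rw [mul_add, h2, mul_smul_comm, mul_one, add_mul, smul_mul_assoc, one_mul]; abel
    have e3 : (u • 1 + b) * (u • 1 + a) = (u • 1 + a) * (u • 1 + b) := by
      simp only [mul_add, add_mul, hab, smul_mul_assoc, mul_smul_comm, one_mul, mul_one, smul_add]
      abel
    rw [← mul_assoc, e1, add_mul, mul_assoc, e2, mul_sub, ← mul_assoc, e3, smul_mul_assoc,
      one_mul, mul_smul_comm, mul_one]
    abel
  have hrest : ∀ t : Finset (Fin n), i ∉ t → j ∉ t →
      s * cherednikHom c (∏ k ∈ t, (C u + X k)) = cherednikHom c (∏ k ∈ t, (C u + X k)) * s := by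
    intro t
    induction t using Finset.induction_on with
    | empty => intro _ _; simp
    | insert k t hk ih =>
      intro hi hj
      rw [Finset.mem_insert, not_or] at hi hj
      have e : s * cherednikHom c (C u + X k) = cherednikHom c (C u + X k) * s := by
        rw [map_add, cherednikHom_X, cherednikHom_C, mul_add, add_mul,
          adjacent_mul_cherednik_of_ne c hij (Ne.symm hi.1) (Ne.symm hj.1), mul_smul_comm, mul_one,
          smul_mul_assoc, one_mul]
      rw [Finset.prod_insert hk, map_mul, ← mul_assoc, e, mul_assoc, ih hi.2 hj.2, mul_assoc]
  have hsplit : (genPoly u : MvPolynomial (Fin n) ℂ) = (C u + X i) * (C u + X j) *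
      ∏ k ∈ (Finset.univ.erase i).erase j, (C u + X k) := by
    have hj : j ∈ Finset.univ.erase i := by simp [hne.symm]
    rw [genPoly, mul_assoc, Finset.mul_prod_erase _ (fun k => (C u + X k)) hj,
      Finset.mul_prod_erase _ (fun k => (C u + X k)) (Finset.mem_univ i)]
  rw [genOp, hsplit, map_mul, ← mul_assoc, hpair, mul_assoc, hrest _ (by simp) (by simp), mul_assoc]

/-- Symmetric functions of the Cherednik operators commute with permutations, as the adjacent
transpositions generate the symmetric group. -/
theorem permOp_commute_genOp {n : ℕ} (c u : ℂ) (w : Perm (Fin n)) :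
    permOp w * genOp c u = genOp c u * permOp w := by
  rcases n with _ | n
  · rw [Subsingleton.elim w 1]; simp
  have hw : w ∈ Submonoid.closure
      (Set.range fun i : Fin n => swap i.castSucc i.succ) := by
    rw [Perm.mclosure_swap_castSucc_succ]; trivial
  induction hw using Submonoid.closure_induction with
  | mem x hx =>
    obtain ⟨i, rfl⟩ := hx
    exact adjacent_commute_genOp c u (by simp)
  | one => simp
  | mul x y _ _ hx hy => rw [map_mul, mul_assoc, hy, ← mul_assoc, hx, mul_assoc]

/-! ### Raising and lowering intertwiners -/

/-- The raising intertwiner `f(x_1, …, x_n) ↦ x_n f(x_n, x_1, …, x_{n-1})`. -/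
def raiseOp {n : ℕ} : Op (n + 1) := mulX (Fin.last n) * permOp (finRotate (n + 1))⁻¹

/-- The lowering intertwiner, for which `raiseOp * lowerOp = ξ_n`. -/
def lowerOp {n : ℕ} (c : ℂ) : Op (n + 1) := permOp (finRotate (n + 1)) * dunkl c (Fin.last n)

theorem dunkl_mul_mulX_zero {n : ℕ} (c : ℂ) :
    dunkl c (0 : Fin (n + 1)) * mulX 0 = cherednik c 0 + 1 := by
  have : Finset.univ.erase (0 : Fin (n + 1)) = Finset.Ioi 0 := by
    ext k; simp
  rw [dunkl_mul_mulX_self, this, cherednik, jucysMurphy, dunklEuler]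
  abel

theorem cherednik_last {n : ℕ} (c : ℂ) :
    cherednik c (Fin.last n) = mulX (Fin.last n) * dunkl c (Fin.last n) := by
  have : Finset.Ioi (Fin.last n) = ∅ := by ext k; simp [Fin.le_last]
  rw [cherednik, jucysMurphy, this, dunklEuler]; simp

theorem raiseOp_mul_lowerOp {n : ℕ} (c : ℂ) :
    raiseOp * lowerOp c = cherednik c (Fin.last n) := by
  rw [raiseOp, lowerOp, mul_assoc, ← mul_assoc (permOp _), ← map_mul, inv_mul_cancel, map_one,
    one_mul, cherednik_last]

theorem lowerOp_mul_raiseOp {n : ℕ} (c : ℂ) :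
    lowerOp c * raiseOp = cherednik c (0 : Fin (n + 1)) + 1 := by
  rw [← dunkl_mul_mulX_zero, raiseOp, lowerOp, permOp_mul_dunkl, finRotate_last, mul_assoc,
    ← mul_assoc (permOp _), permOp_mul_mulX, finRotate_last, mul_assoc, ← map_mul, mul_inv_cancel,
    map_one, mul_one]

theorem cherednik_last_mul_raiseOp {n : ℕ} (c : ℂ) :
    cherednik c (Fin.last n) * raiseOp = raiseOp * (cherednik c 0 + 1) := by
  rw [← raiseOp_mul_lowerOp, mul_assoc, lowerOp_mul_raiseOp]

theorem cherednik_mul_raiseOp {n : ℕ} (c : ℂ) {i : Fin (n + 1)} (hi : i ≠ Fin.last n) :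
    cherednik c i * raiseOp = raiseOp * cherednik c (finRotate _ i) := by
  set l := Fin.last n with hl
  set r := permOp (finRotate (n + 1))⁻¹ with hr
  have hil : i < l := lt_of_le_of_ne (Fin.le_last i) hi
  have hlm : l ∈ Finset.Ioi i := by simpa using hil
  -- The extra term here cancels the one that the Jucys–Murphy sum contributes in `e2`.
  have e1 : dunklEuler c i * mulX l =
      mulX l * dunklEuler c i - c • (mulX i * permOp (swap i l)) := by
    rw [dunklEuler, mul_assoc, dunkl_mul_mulX_of_ne c hi, mul_sub, mul_smul_comm, ← mul_assoc,
      mulX_commute, mul_assoc]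
  have e2 : jucysMurphy i * mulX l = mulX l * ∑ j ∈ (Finset.Ioi i).erase l, permOp (swap i j) +
      mulX i * permOp (swap i l) := by
    rw [jucysMurphy, ← Finset.sum_erase_add _ _ hlm, add_mul, Finset.sum_mul, Finset.mul_sum]
    congr 1
    · refine Finset.sum_congr rfl fun j hj => ?_
      rw [permOp_mul_mulX, swap_apply_of_ne_of_ne hi.symm (Finset.ne_of_mem_erase hj).symm]
    · rw [permOp_mul_mulX, swap_apply_right]
  have e3 : r * jucysMurphy (finRotate _ i) =
      (∑ j ∈ (Finset.Ioi i).erase l, permOp (swap i j)) * r := by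
    rw [jucysMurphy, Finset.mul_sum, Finset.sum_mul]
    symm
    refine Finset.sum_equiv (finRotate (n + 1)) (fun k => ?_) fun k _ => ?_
    · rw [Finset.mem_erase, Finset.mem_Ioi, Finset.mem_Ioi, Fin.lt_def, Fin.lt_def,
        coe_finRotate_of_ne_last hi]
      by_cases hk : k = Fin.last n
      · subst hk; simp [hl]
      · rw [coe_finRotate_of_ne_last hk]; simp [hl, hk]
    · have := swap_conj (finRotate (n + 1)) i k
      rw [hr, ← map_mul, ← map_mul]
      congr 1
      rw [eq_inv_mul_iff_mul_eq, ← mul_assoc, ← this, mul_inv_cancel_right]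
  have e4 : r * dunklEuler c (finRotate _ i) = dunklEuler c i * r := by
    rw [hr, permOp_mul_dunklEuler]; simp
  rw [raiseOp, ← mul_assoc, cherednik, add_mul, smul_mul_assoc, e1, e2, mul_assoc, cherednik,
    mul_add, mul_smul_comm, e3, e4, smul_add]
  rw [sub_add_add_cancel, mul_add, add_mul, mul_smul_comm, smul_mul_assoc, mul_assoc, mul_assoc]

/-- The substitution describing how Cherednik operators pass through `raiseOp`. -/
def shiftHom {n : ℕ} : MvPolynomial (Fin (n + 1)) ℂ →ₐ[ℂ] MvPolynomial (Fin (n + 1)) ℂ :=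
  aeval fun i => if i = Fin.last n then X 0 + 1 else X (finRotate _ i)

theorem cherednikHom_mul_raiseOp {n : ℕ} (c : ℂ) (p : MvPolynomial (Fin (n + 1)) ℂ) :
    cherednikHom c p * raiseOp = raiseOp * cherednikHom c (shiftHom p) := by
  induction p using MvPolynomial.induction_on with
  | C a =>
    rw [shiftHom, aeval_C, algebraMap_eq, cherednikHom_C]; simp
  | add p q hp hq => rw [map_add, map_add, map_add, add_mul, mul_add, hp, hq]
  | mul_X p i hp =>
    have : cherednikHom c (X i) * raiseOp = raiseOp * cherednikHom c (shiftHom (X i)) := by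
      rw [shiftHom, aeval_X]
      split_ifs with h
      · rw [h, map_add, cherednikHom_X, cherednikHom_X, map_one, cherednik_last_mul_raiseOp]
      · rw [cherednikHom_X, cherednikHom_X, cherednik_mul_raiseOp c h]
    rw [map_mul, mul_assoc, this, ← mul_assoc, hp, mul_assoc, map_mul, map_mul]

theorem raiseOp_injective {n : ℕ} : Function.Injective (raiseOp : Op (n + 1)) := by
  intro f g h
  rw [raiseOp, Module.End.mul_apply, Module.End.mul_apply, mulX_apply, mulX_apply] at h
  have := mul_left_cancel₀ (X_ne_zero _) h
  exact rename_injective _ (Equiv.injective _) this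

theorem cherednikHom_mul_lowerOp {n : ℕ} (c : ℂ) (p : MvPolynomial (Fin (n + 1)) ℂ) :
    cherednikHom c (shiftHom p) * lowerOp c = lowerOp c * cherednikHom c p := by
  refine LinearMap.ext fun f => raiseOp_injective ?_
  rw [← Module.End.mul_apply, ← Module.End.mul_apply, ← mul_assoc, ← cherednikHom_mul_raiseOp,
    mul_assoc, raiseOp_mul_lowerOp, ← mul_assoc, raiseOp_mul_lowerOp, ← cherednikHom_X, ← map_mul,
    ← map_mul, mul_comm]

/-- The substitution `shiftHom` replaces the last factor of `∏_i (u + x_i)` by `u + 1 + x_1` and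
permutes the others into the factors with `i ≠ 1`. A separate parameter `v` in the last factor
covers both the raising and the lowering operator. -/
theorem shiftHom_genPoly_aux {n : ℕ} (u v : ℂ) :
    shiftHom ((C v + X (Fin.last n)) * ∏ i ∈ Finset.univ.erase (Fin.last n), (C u + X i)) *
      (C u + X 0) = genPoly u * (C (v + 1) + X 0) := by
  have h : shiftHom (∏ i ∈ Finset.univ.erase (Fin.last n), (C u + X i)) * (C u + X 0) =
      genPoly u := by
    rw [map_prod, genPoly, ← Equiv.prod_comp (finRotate (n + 1)),
      ← Finset.prod_erase_mul _ _ (Finset.mem_univ (Fin.last n)), finRotate_last]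
    congr 1
    refine Finset.prod_congr rfl fun i hi => ?_
    simp [shiftHom, Finset.ne_of_mem_erase hi]
  rw [map_mul, mul_assoc, h]
  simp [shiftHom]
  ring

theorem genPoly_eq {n : ℕ} (u : ℂ) (k : Fin n) :
    genPoly u = (C u + X k) * ∏ i ∈ Finset.univ.erase k, (C u + X i) :=
  (Finset.mul_prod_erase _ (fun i => C u + X i) (Finset.mem_univ k)).symm

theorem cherednikHom_add {n : ℕ} (c u : ℂ) (k : Fin n) :
    cherednikHom c (C u + X k) = u • 1 + cherednik c k := by
  rw [map_add, cherednikHom_X, cherednikHom_C]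

/-- `∏_i (u + ξ_i)` and `raiseOp` commute up to the factor `(u + 1 + ξ_1) / (u + ξ_1)`. -/
theorem genOp_mul_raiseOp {n : ℕ} (c u : ℂ) :
    genOp c u * raiseOp * (u • 1 + cherednik c (0 : Fin (n + 1))) =
      raiseOp * (genOp c u * ((u + 1) • 1 + cherednik c 0)) := by
  have h := congrArg (cherednikHom c) (shiftHom_genPoly_aux (n := n) u u)
  rw [← genPoly_eq, map_mul, map_mul, cherednikHom_add, cherednikHom_add] at h
  rw [genOp, cherednikHom_mul_raiseOp, mul_assoc, h]

/-- `∏_i (u + ξ_i)` and `lowerOp` commute up to the factor `(u - 1 + ξ_n) / (u + ξ_n)`. -/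
theorem genOp_mul_lowerOp {n : ℕ} (c u : ℂ) :
    genOp c u * lowerOp c * (u • 1 + cherednik c (Fin.last n)) =
      lowerOp c * (genOp c u * ((u - 1) • 1 + cherednik c (Fin.last n))) := by
  obtain ⟨q, hq1, hq2⟩ : ∃ q : MvPolynomial (Fin (n + 1)) ℂ, shiftHom q = genPoly u ∧
      q * (C u + X (Fin.last n)) = genPoly u * (C (u - 1) + X (Fin.last n)) := by
    have h := shiftHom_genPoly_aux (n := n) u (u - 1)
    rw [sub_add_cancel] at h
    have hne : (C u + X 0 : MvPolynomial (Fin (n + 1)) ℂ) ≠ 0 := by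
      intro H
      have := congrArg (eval fun _ => 1 - u) H
      simp at this
    refine ⟨_, mul_right_cancel₀ hne h, ?_⟩
    rw [genPoly_eq u (Fin.last n)]
    generalize (∏ i ∈ Finset.univ.erase (Fin.last n), (C u + X i) :
      MvPolynomial (Fin (n + 1)) ℂ) = q
    ring
  have h := cherednikHom_mul_lowerOp c q
  rw [hq1] at h
  rw [genOp, h, ← cherednikHom_add, ← cherednikHom_add, mul_assoc, ← map_mul, hq2, map_mul]

/-! ### Triangularity of the Cherednik operators -/

/-- The sum of the first `k` parts. -/
def topSum {n : ℕ} (lam : Fin n → ℕ) (k : ℕ) : ℕ := ∑ i with i.val < k, lam i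

/-- The exponent `α` is dominated by `lam`: it has the weight of `lam`, and the sum of any `k` of
its entries is at most the sum of the first `k` parts of `lam`. -/
def Below {n : ℕ} (lam : Fin n → ℕ) (α : Fin n →₀ ℕ) : Prop :=
  ∑ i, α i = weight lam ∧ ∀ S : Finset (Fin n), ∑ i ∈ S, α i ≤ topSum lam S.card

/-- The exponent obtained from `α` by moving `r` units from the entry `i` to the entry `j`. -/
def moveExp {n : ℕ} (α : Fin n →₀ ℕ) (i j : Fin n) (r : ℕ) : Fin n →₀ ℕ :=
  α - Finsupp.single i r + Finsupp.single j r

theorem moveExp_add {n : ℕ} {α : Fin n →₀ ℕ} {i : Fin n} (j : Fin n) {r : ℕ} (hr : r ≤ α i) :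
    moveExp α i j r + Finsupp.single i r = α + Finsupp.single j r := by
  have : Finsupp.single i r ≤ α := Finsupp.single_le_iff.2 hr
  rw [moveExp, add_right_comm, tsub_add_cancel_of_le this]

theorem sum_moveExp {n : ℕ} {α : Fin n →₀ ℕ} {i j : Fin n} {r : ℕ} (hr : r ≤ α i)
    (S : Finset (Fin n)) :
    ∑ k ∈ S, moveExp α i j r k + (if i ∈ S then r else 0) =
      ∑ k ∈ S, α k + (if j ∈ S then r else 0) := by
  have h := fun k => DFunLike.congr_fun (moveExp_add j hr) k
  simp only [Finsupp.add_apply] at h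
  have hs : ∀ l : Fin n, (if l ∈ S then r else 0) = ∑ k ∈ S, Finsupp.single l r k := by
    intro l
    simp [Finsupp.single_apply]
  rw [hs, hs, ← Finset.sum_add_distrib, ← Finset.sum_add_distrib]
  exact Finset.sum_congr rfl fun k _ => h k

theorem Below.moveExp {n : ℕ} {lam : Fin n → ℕ} {α : Fin n →₀ ℕ} (h : Below lam α) {i j : Fin n}
    {r : ℕ} (hr : r ≤ α i - α j) (hji : α j ≤ α i) : Below lam (moveExp α i j r) := by
  have hri : r ≤ α i := by omega
  constructor
  · have := sum_moveExp (j := j) hri Finset.univ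
    simp only [Finset.mem_univ, if_true] at this
    rw [← h.1]; omega
  · intro S
    have hS := sum_moveExp (j := j) hri S
    have h1 := h.2 S
    by_cases hi : i ∈ S
    · rw [if_pos hi] at hS
      split_ifs at hS <;> omega
    by_cases hj : j ∈ S
    · rw [if_neg hi, if_pos hj] at hS
      have hi' : i ∉ S.erase j := fun h => hi (Finset.mem_of_mem_erase h)
      have h2 := h.2 (insert i (S.erase j))
      have hc : 0 < S.card := Finset.card_pos.2 ⟨j, hj⟩
      rw [Finset.card_insert_of_notMem hi', Finset.card_erase_of_mem hj, Nat.sub_add_cancel hc,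
        Finset.sum_insert hi'] at h2
      have h3 := Finset.add_sum_erase S α hj
      omega
    · rw [if_neg hi, if_neg hj] at hS
      omega

theorem Below.mapDomain {n : ℕ} {lam : Fin n → ℕ} {α : Fin n →₀ ℕ} (h : Below lam α)
    (w : Perm (Fin n)) : Below lam (α.mapDomain w) := by
  have e : ∀ k, α.mapDomain w k = α (w.symm k) := fun k => Finsupp.mapDomain_equiv_apply α k
  constructor
  · rw [← h.1]
    simp only [e]
    exact Equiv.sum_comp w.symm α
  · intro S
    have := h.2 (S.map w.symm.toEmbedding)
    rw [Finset.card_map, Finset.sum_map] at this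
    simpa [e] using this

theorem topSum_succ {n : ℕ} (lam : Fin n → ℕ) (i : Fin n) :
    topSum lam (i.val + 1) = ∑ k ∈ Finset.Iic i, lam k := by
  rw [topSum]
  congr 1
  ext k
  simp only [Finset.mem_filter, Finset.mem_univ, true_and, Finset.mem_Iic, Fin.le_def]
  omega

/-- `lam` is an extreme point: it is not in the interior of a segment between an exponent that
it dominates and the exponent with two entries exchanged. -/
theorem moveExp_ne {n : ℕ} {lam : Fin n → ℕ} {α : Fin n →₀ ℕ} (h : Below lam α) {i j : Fin n}
    (hij : i ≠ j) {r : ℕ} (hr0 : 0 < r) (hr : r < α i - α j) :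
    moveExp α i j r ≠ Finsupp.equivFunOnFinite.symm lam := by
  intro H
  have hri : r ≤ α i := by omega
  have hlam : ∀ k, moveExp α i j r k = lam k := fun k => by rw [H]; rfl
  rcases lt_or_gt_of_ne hij with hlt | hlt
  · have h1 := h.2 (Finset.Iic i)
    have h2 := sum_moveExp (j := j) hri (Finset.Iic i)
    rw [if_pos (by simp), if_neg (by simpa using hlt)] at h2
    rw [Fin.card_Iic, topSum_succ] at h1
    simp only [hlam] at h2
    omega
  · have hi : i ∉ Finset.Iio j := by simpa using hlt.le
    have h1 := h.2 (insert i (Finset.Iio j))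
    rw [Finset.card_insert_of_notMem hi, Fin.card_Iio, topSum_succ, Finset.sum_insert hi,
      ← Finset.Iio_insert, Finset.sum_insert (by simp)] at h1
    have h2 := sum_moveExp (j := j) hri (Finset.Iio j)
    rw [if_neg hi, if_neg (by simp)] at h2
    simp only [hlam] at h2
    have h3 := DFunLike.congr_fun (moveExp_add j hri) j
    simp [hij, hlam] at h3
    omega

theorem moveExp_zero {n : ℕ} (α : Fin n →₀ ℕ) (i j : Fin n) : moveExp α i j 0 = α := by
  simp [moveExp]

theorem mapDomain_swap {n : ℕ} {α : Fin n →₀ ℕ} {i j : Fin n} (hij : i ≠ j) (h : α j ≤ α i) :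
    α.mapDomain (swap i j) = moveExp α i j (α i - α j) := by
  ext k
  have := DFunLike.congr_fun (moveExp_add (α := α) j (Nat.sub_le (α i) (α j))) k
  rw [Finsupp.mapDomain_equiv_apply, symm_swap]
  simp only [Finsupp.add_apply, Finsupp.single_apply] at this
  by_cases hi : k = i
  · subst hi; rw [swap_apply_left]; simp [hij.symm] at this; omega
  by_cases hj : k = j
  · subst hj; rw [swap_apply_right]; simp [hij] at this; omega
  · rw [swap_apply_of_ne_of_ne hi hj]; simpa [Ne.symm hi, Ne.symm hj] using this.symm

/-- The geometric sum for the divided difference of a monomial. -/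
theorem X_mul_divDiff_monomial {n : ℕ} {i j : Fin n} (hij : i ≠ j) {α : Fin n →₀ ℕ}
    (h : α j ≤ α i) :
    X i * divDiff i j (monomial α (1 : ℂ)) =
      ∑ r ∈ Finset.range (α i - α j), monomial (moveExp α i j r) 1 := by
  have hX : ∀ (k : Fin n) (β : Fin n →₀ ℕ),
      X k * monomial β (1 : ℂ) = monomial (β + Finsupp.single k 1) 1 := by
    intro k β
    rw [X, monomial_mul, one_mul, add_comm]
  have h1 : ∀ r ∈ Finset.range (α i - α j),
      X i * monomial (α - Finsupp.single i (r + 1) + Finsupp.single j r) (1 : ℂ) =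
        monomial (moveExp α i j r) 1 := by
    intro r hr
    rw [Finset.mem_range] at hr
    rw [hX, moveExp]
    congr 2
    ext k
    simp only [Finsupp.add_apply, Finsupp.tsub_apply, Finsupp.single_apply]
    split_ifs <;> first | omega | (subst_vars; omega)
  have h2 : ∀ r ∈ Finset.range (α i - α j),
      X j * monomial (α - Finsupp.single i (r + 1) + Finsupp.single j r) (1 : ℂ) =
        monomial (moveExp α i j (r + 1)) 1 := by
    intro r _
    rw [hX, moveExp, add_assoc, ← Finsupp.single_add]
  have key : divDiff i j (monomial α (1 : ℂ)) = ∑ r ∈ Finset.range (α i - α j),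
      monomial (α - Finsupp.single i (r + 1) + Finsupp.single j r) 1 := by
    apply divDiff_eq hij
    rw [rename_monomial, mapDomain_swap hij h, sub_mul, Finset.mul_sum, Finset.mul_sum,
      Finset.sum_congr rfl h1, Finset.sum_congr rfl h2, ← Finset.sum_sub_distrib,
      Finset.sum_range_sub' fun r => monomial (moveExp α i j r) (1 : ℂ), moveExp_zero]
  rw [key, Finset.mul_sum, Finset.sum_congr rfl h1]

theorem X_mul_divDiff_monomial' {n : ℕ} {i j : Fin n} (hij : i ≠ j) (α : Fin n →₀ ℕ) :
    X i * divDiff i j (monomial α (1 : ℂ)) =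
      -(X i * divDiff i j (monomial (α.mapDomain (swap i j)) (1 : ℂ))) := by
  have : divDiff i j (monomial (α.mapDomain (swap i j)) (1 : ℂ)) =
      -divDiff i j (monomial α (1 : ℂ)) := by
    apply divDiff_eq hij
    rw [mul_neg, sub_mul_divDiff hij, rename_monomial, rename_monomial, ← Finsupp.mapDomain_comp,
      ← Perm.coe_mul, swap_mul_self, Perm.coe_one, Finsupp.mapDomain_id]
    ring
  rw [this]; ring

/-- The polynomials all of whose exponents are dominated by `lam`. -/
def belowSub {n : ℕ} (lam : Fin n → ℕ) : Submodule ℂ (MvPolynomial (Fin n) ℂ) :=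
  restrictSupport ℂ {α | Below lam α}

theorem mem_belowSub {n : ℕ} {lam : Fin n → ℕ} {f : MvPolynomial (Fin n) ℂ} :
    f ∈ belowSub lam ↔ ∀ α, coeff α f ≠ 0 → Below lam α := by
  rw [belowSub, mem_restrictSupport_iff]
  simp [Set.subset_def]

theorem monomial_mem_belowSub {n : ℕ} {lam : Fin n → ℕ} {α : Fin n →₀ ℕ} (h : Below lam α)
    (a : ℂ) : monomial α a ∈ belowSub lam := by
  rw [mem_belowSub]
  intro β hβ
  rw [coeff_monomial] at hβ
  split_ifs at hβ with e
  · rwa [← e]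
  · exact absurd rfl hβ

theorem belowSub_induction {n : ℕ} {lam : Fin n → ℕ} {p : MvPolynomial (Fin n) ℂ → Prop}
    {f : MvPolynomial (Fin n) ℂ} (hf : f ∈ belowSub lam) (h0 : p 0)
    (hadd : ∀ f g, p f → p g → p (f + g)) (hsmul : ∀ (a : ℂ) f, p f → p (a • f))
    (hmon : ∀ α, Below lam α → p (monomial α 1)) : p f := by
  rw [belowSub, restrictSupport_eq_span] at hf
  induction hf using Submodule.span_induction with
  | mem x hx => obtain ⟨α, hα, rfl⟩ := hx; exact hmon α hα
  | zero => exact h0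
  | add x y _ _ hx hy => exact hadd x y hx hy
  | smul a x _ hx => exact hsmul a x hx

/-- The coefficient of `x^α`, for an exponent given as a function. -/
def cf {n : ℕ} (α : Fin n → ℕ) : MvPolynomial (Fin n) ℂ →ₗ[ℂ] ℂ :=
  lcoeff ℂ (Finsupp.equivFunOnFinite.symm α)

theorem cf_apply {n : ℕ} (α : Fin n → ℕ) (f : MvPolynomial (Fin n) ℂ) :
    cf α f = coeff (Finsupp.equivFunOnFinite.symm α) f := rfl

theorem cf_monomial {n : ℕ} (lam : Fin n → ℕ) (α : Fin n →₀ ℕ) :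
    cf lam (monomial α 1) = if (α : Fin n → ℕ) = lam then 1 else 0 := by
  rw [cf_apply, coeff_monomial]
  simp only [Equiv.eq_symm_apply]
  rfl

theorem cf_rename {n : ℕ} (w : Perm (Fin n)) (α : Fin n → ℕ) (f : MvPolynomial (Fin n) ℂ) :
    cf α (rename w f) = cf (α ∘ w) f := by
  have : Finsupp.equivFunOnFinite.symm α =
      (Finsupp.equivFunOnFinite.symm (α ∘ w)).mapDomain w := by
    ext k; rw [Finsupp.mapDomain_equiv_apply]; simp
  rw [cf_apply, cf_apply, this, coeff_rename_mapDomain _ w.injective]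

theorem belowSub_rename {n : ℕ} {lam : Fin n → ℕ} {f : MvPolynomial (Fin n) ℂ}
    (hf : f ∈ belowSub lam) (w : Perm (Fin n)) : rename w f ∈ belowSub lam := by
  refine belowSub_induction (p := fun f => rename w f ∈ belowSub lam) hf (by simp)
    (fun f g hf hg => ?_) (fun a f hf => ?_) fun α hα => ?_
  · rw [map_add]; exact add_mem hf hg
  · rw [map_smul]; exact Submodule.smul_mem _ _ hf
  · rw [rename_monomial]; exact monomial_mem_belowSub (hα.mapDomain w) 1

/-- `x_i (1 - s_{ij}) / (x_i - x_j)` preserves the polynomials with exponents dominated by `lam`.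
The extreme exponent `lam` can only come from the monomials `x^lam` and `s_{ij} x^lam`, which gives
the coefficient of `x^lam` in the image. -/
theorem X_mul_divDiff_belowSub {n : ℕ} {lam : Fin n → ℕ} {f : MvPolynomial (Fin n) ℂ}
    (hf : f ∈ belowSub lam) {i j : Fin n} (hij : i ≠ j) :
    X i * divDiff i j f ∈ belowSub lam ∧ cf lam (X i * divDiff i j f) =
      if lam j < lam i then cf lam f - cf (lam ∘ swap i j) f else 0 := by
  have key : ∀ α, Below lam α → α j ≤ α i →
      X i * divDiff i j (monomial α (1 : ℂ)) ∈ belowSub lam ∧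
      cf lam (X i * divDiff i j (monomial α (1 : ℂ))) =
        if (α : Fin n → ℕ) = lam ∧ α j < α i then 1 else 0 := by
    intro α hα h
    -- A monomial goes to a sum along the segment from `α` towards `s_{ij} α`; by extremality only
    -- the term `r = 0` can be `x^lam`.
    rw [X_mul_divDiff_monomial hij h]
    refine ⟨sum_mem fun r hr => monomial_mem_belowSub (hα.moveExp ?_ h) 1, ?_⟩
    · exact (Finset.mem_range.1 hr).le
    rw [map_sum]
    by_cases hd : α j < α i
    · rw [Finset.sum_eq_single 0]
      · rw [moveExp_zero, cf_monomial]; simp [hd]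
      · intro r hr hr0
        rw [cf_monomial, if_neg]
        intro H
        refine moveExp_ne hα hij (Nat.pos_of_ne_zero hr0) (Finset.mem_range.1 hr) ?_
        exact (Equiv.eq_symm_apply _).2 H
      · simp; omega
    · have : α i - α j = 0 := by omega
      simp [this, hd]
  refine belowSub_induction (p := fun f => X i * divDiff i j f ∈ belowSub lam ∧
    cf lam (X i * divDiff i j f) =
      if lam j < lam i then cf lam f - cf (lam ∘ swap i j) f else 0) hf (by simp)
    (fun f g hf hg => ?_) (fun a f hf => ?_) fun α hα => ?_
  · rw [map_add, mul_add]
    refine ⟨add_mem hf.1 hg.1, ?_⟩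
    rw [map_add, hf.2, hg.2, map_add, map_add]
    split_ifs <;> ring
  · rw [map_smul, mul_smul_comm]
    refine ⟨Submodule.smul_mem _ _ hf.1, ?_⟩
    rw [map_smul, hf.2, map_smul, map_smul, smul_ite, smul_sub, smul_zero]
  · have hsw : ∀ k, (α.mapDomain (swap i j)) k = α (swap i j k) := by
      intro k; rw [Finsupp.mapDomain_equiv_apply, symm_swap]
    rcases le_or_gt (α j) (α i) with h | h
    · obtain ⟨h1, h2⟩ := key α hα h
      refine ⟨h1, ?_⟩
      rw [h2, cf_monomial, cf_monomial]
      by_cases e : (α : Fin n → ℕ) = lam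
      · have e2 : (α : Fin n → ℕ) = lam ∘ swap i j → ¬ lam j < lam i := by
          intro e2
          have := congrFun e2 i
          rw [e] at this
          simp at this
          omega
        rw [e] at e2 ⊢
        by_cases h3 : lam j < lam i
        · rw [if_neg fun H => e2 H h3]; simp [h3]
        · simp [h3]
      · rw [if_neg (fun H => e H.1), if_neg e]
        by_cases h3 : lam j < lam i
        · rw [if_pos h3, if_neg, sub_zero]
          intro e2
          have hi := congrFun e2 i
          have hj := congrFun e2 j
          simp at hi hj
          omega
        · rw [if_neg h3]
    · obtain ⟨h1, h2⟩ := key _ (hα.mapDomain (swap i j)) (by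
        rw [hsw, hsw, swap_apply_left, swap_apply_right]; exact h.le)
      rw [X_mul_divDiff_monomial' hij]
      refine ⟨neg_mem h1, ?_⟩
      have e1 : ((α.mapDomain (swap i j) : Fin n →₀ ℕ) : Fin n → ℕ) = α ∘ swap i j := funext hsw
      have e2 : (α : Fin n → ℕ) ∘ swap i j = lam ↔ (α : Fin n → ℕ) = lam ∘ swap i j := by
        constructor
        · rintro rfl; funext k; simp
        · intro H; rw [H]; funext k; simp
      rw [map_neg, h2, cf_monomial, cf_monomial, hsw, hsw, swap_apply_left, swap_apply_right, e1]
      by_cases e : (α : Fin n → ℕ) = lam ∘ swap i j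
      · have hi := congrFun e i
        have hj := congrFun e j
        simp at hi hj
        rw [if_pos ⟨e2.2 e, h⟩, if_pos (by omega), if_pos e, if_neg]
        · ring
        · intro H
          have := congrFun H i
          omega
      · rw [if_neg (fun H => e (e2.1 H.1)), if_neg e]
        split_ifs with h3 h4
        · rw [h4] at h; omega
        · ring
        · ring

theorem X_mul_pderiv_belowSub {n : ℕ} {lam : Fin n → ℕ} {f : MvPolynomial (Fin n) ℂ}
    (hf : f ∈ belowSub lam) (i : Fin n) :
    X i * pderiv i f ∈ belowSub lam ∧ cf lam (X i * pderiv i f) = lam i * cf lam f := by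
  refine belowSub_induction (p := fun f => X i * pderiv i f ∈ belowSub lam ∧
    cf lam (X i * pderiv i f) = lam i * cf lam f) hf (by simp)
    (fun f g hf hg => ?_) (fun a f hf => ?_) fun α hα => ?_
  · rw [map_add, mul_add]
    refine ⟨add_mem hf.1 hg.1, ?_⟩
    rw [map_add, hf.2, hg.2, map_add, mul_add]
  · rw [Derivation.map_smul, mul_smul_comm]
    refine ⟨Submodule.smul_mem _ _ hf.1, ?_⟩
    rw [map_smul, hf.2, map_smul, smul_eq_mul, smul_eq_mul]; ring
  · rw [X_mul_pderiv_monomial]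
    refine ⟨Submodule.smul_of_tower_mem _ _ (monomial_mem_belowSub hα 1), ?_⟩
    rw [map_nsmul, cf_monomial, nsmul_eq_mul]
    split_ifs with h
    · rw [h]
    · simp

/-- On polynomials with exponents dominated by a partition `lam`, the coefficient of `x^lam` is an
eigenfunctional of every Cherednik operator. -/
theorem cherednik_belowSub {n : ℕ} (c : ℂ) {lam : Fin n → ℕ} (hlam : Antitone lam)
    {f : MvPolynomial (Fin n) ℂ} (hf : f ∈ belowSub lam) (i : Fin n) :
    cherednik c i f ∈ belowSub lam ∧
      cf lam (cherednik c i f) = (lam i + c * ((n : ℂ) - 1 - i)) * cf lam f := by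
  have e : cherednik c i f = X i * pderiv i f +
      c • (∑ j ∈ Finset.univ.erase i, X i * divDiff i j f) +
      c • ∑ j ∈ Finset.Ioi i, rename (swap i j) f := by
    rw [cherednik, LinearMap.add_apply, dunklEuler, Module.End.mul_apply, mulX_apply, dunkl_apply,
      mul_add, mul_smul_comm, Finset.mul_sum, LinearMap.smul_apply, jucysMurphy,
      LinearMap.sum_apply]
    rfl
  have h1 := X_mul_pderiv_belowSub hf i
  have h2 := fun j (hj : j ∈ Finset.univ.erase i) =>
    X_mul_divDiff_belowSub hf (Finset.ne_of_mem_erase hj).symm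
  rw [e]
  refine ⟨add_mem (add_mem h1.1 (Submodule.smul_mem _ _ (sum_mem fun j hj => (h2 j hj).1)))
    (Submodule.smul_mem _ _ (sum_mem fun j _ => belowSub_rename hf _)), ?_⟩
  -- For `j > i` the divided difference and the transposition contribute `cf lam f` together, since
  -- `lam i ≥ lam j`; for `j < i` the divided difference contributes nothing.
  have hsub : Finset.Ioi i ⊆ Finset.univ.erase i := by
    intro j hj
    rw [Finset.mem_Ioi] at hj
    simp [hj.ne']
  rw [map_add, map_add, map_smul, map_smul, map_sum, map_sum, h1.2,
    Finset.sum_congr rfl fun j hj => (h2 j hj).2, ← Finset.sum_subset hsub, add_assoc, ← smul_add,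
    ← Finset.sum_add_distrib, Finset.sum_congr rfl (g := fun _ => cf lam f), Finset.sum_const,
    Fin.card_Ioi, nsmul_eq_mul, smul_eq_mul, Nat.cast_sub, Nat.cast_sub]
  · push_cast; ring
  · have := i.2; omega
  · have := i.2; omega
  · intro j hj
    have hle := hlam (Finset.mem_Ioi.1 hj).le
    rw [cf_rename]
    split_ifs with h
    · ring
    · rw [zero_add]
      congr 2
      funext k
      rw [Function.comp_apply, swap_apply_def]
      split_ifs with h1 h2
      · subst h1; omega
      · subst h2; omega
      · rfl
  · intro j hj hj'
    rw [Finset.mem_Ioi, not_lt] at hj'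
    rw [if_neg]
    exact not_lt.2 (hlam hj')

/-- The spectral vector `λ_i + c (n - i)` of a partition (with `i` counted from `1`). -/
def spec {n : ℕ} (c : ℂ) (lam : Fin n → ℕ) (i : Fin n) : ℂ := lam i + c * ((n : ℂ) - 1 - i)

theorem cherednikHom_belowSub {n : ℕ} (c : ℂ) {lam : Fin n → ℕ} (hlam : Antitone lam)
    {f : MvPolynomial (Fin n) ℂ} (hf : f ∈ belowSub lam) (p : MvPolynomial (Fin n) ℂ) :
    cherednikHom c p f ∈ belowSub lam ∧
      cf lam (cherednikHom c p f) = eval (spec c lam) p * cf lam f := by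
  induction p using MvPolynomial.induction_on with
  | C a =>
    rw [cherednikHom_C]
    exact ⟨Submodule.smul_mem _ _ hf, by simp⟩
  | add p q hp hq =>
    rw [map_add, map_add, add_mul, LinearMap.add_apply, map_add, hp.2, hq.2]
    exact ⟨add_mem hp.1 hq.1, rfl⟩
  | mul_X p i hp =>
    have h := cherednik_belowSub c hlam hp.1 i
    rw [mul_comm, map_mul, cherednikHom_X, Module.End.mul_apply, h.2, hp.2, map_mul, eval_X]
    exact ⟨h.1, by rw [spec]; ring⟩

/-! ### Symmetric polynomials and the dominance order -/

/-- The space of symmetric polynomials. -/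
def symSub (n : ℕ) : Submodule ℂ (MvPolynomial (Fin n) ℂ) :=
  Subalgebra.toSubmodule (symmetricSubalgebra (Fin n) ℂ)

theorem mem_symSub {n : ℕ} {f : MvPolynomial (Fin n) ℂ} :
    f ∈ symSub n ↔ ∀ w : Perm (Fin n), rename w f = f := by
  rw [symSub, Subalgebra.mem_toSubmodule, mem_symmetricSubalgebra]
  rfl

theorem cf_comp {n : ℕ} {f : MvPolynomial (Fin n) ℂ} (hf : f ∈ symSub n) (w : Perm (Fin n))
    (α : Fin n → ℕ) : cf (α ∘ w) f = cf α f := by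
  rw [← cf_rename, mem_symSub.1 hf]

theorem exists_antitone_comp {n : ℕ} (α : Fin n → ℕ) : ∃ w : Perm (Fin n), Antitone (α ∘ w) :=
  ⟨Tuple.sort (OrderDual.toDual ∘ α), Tuple.monotone_sort (OrderDual.toDual ∘ α)⟩

theorem antitone_comp_unique {n : ℕ} {α : Fin n → ℕ} (h : Antitone α) {w : Perm (Fin n)}
    (hw : Antitone (α ∘ w)) : α ∘ w = α := by
  have := Tuple.unique_monotone (f := OrderDual.toDual ∘ α) (σ := w) (τ := 1) hw h
  exact this

/-- A symmetric polynomial is determined by its coefficients at partitions. -/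
theorem symSub_ext {n : ℕ} {f g : MvPolynomial (Fin n) ℂ} (hf : f ∈ symSub n) (hg : g ∈ symSub n)
    (h : ∀ α : Fin n → ℕ, Antitone α → cf α f = cf α g) : f = g := by
  ext m
  obtain ⟨w, hw⟩ := exists_antitone_comp (m : Fin n → ℕ)
  have := h _ hw
  rw [cf_comp hf, cf_comp hg] at this
  simpa [cf_apply] using this

theorem prod_X_pow {n : ℕ} (α : Fin n → ℕ) :
    (∏ i, X i ^ α i : MvPolynomial (Fin n) ℂ) = monomial (Finsupp.equivFunOnFinite.symm α) 1 := by
  rw [← prod_X_pow_eq_monomial, ← Finsupp.prod, Finsupp.prod_fintype _ _ (by simp)]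
  rfl

theorem monomialSymm_eq {n : ℕ} (lam : Fin n → ℕ) : monomialSymm lam =
    ∑ α ∈ Finset.univ.image (fun σ : Perm (Fin n) => lam ∘ σ),
      monomial (Finsupp.equivFunOnFinite.symm α) 1 := by
  rw [monomialSymm]
  exact Finset.sum_congr rfl fun α _ => prod_X_pow α

open scoped Classical in
theorem cf_monomialSymm {n : ℕ} (lam α : Fin n → ℕ) :
    cf α (monomialSymm lam) = if ∃ w : Perm (Fin n), lam ∘ w = α then 1 else 0 := by
  rw [monomialSymm_eq, map_sum]
  have : ∀ β : Fin n → ℕ, cf α (monomial (Finsupp.equivFunOnFinite.symm β) (1 : ℂ)) =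
      if β = α then 1 else 0 := by
    intro β; rw [cf_monomial]; rfl
  simp only [this, Finset.sum_ite_eq', Finset.mem_image, Finset.mem_univ, true_and]

theorem cf_monomialSymm_self {n : ℕ} (lam : Fin n → ℕ) : cf lam (monomialSymm lam) = 1 := by
  rw [cf_monomialSymm, if_pos ⟨1, rfl⟩]

theorem monomialSymm_mem_symSub {n : ℕ} (lam : Fin n → ℕ) : monomialSymm lam ∈ symSub n := by
  rw [mem_symSub]
  intro w
  ext m
  have h1 := cf_rename w (m : Fin n → ℕ) (monomialSymm lam)
  rw [cf_monomialSymm] at h1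
  have h2 := cf_monomialSymm lam (m : Fin n → ℕ)
  have : (∃ v : Perm (Fin n), lam ∘ v = (m : Fin n → ℕ) ∘ w) ↔
      ∃ v : Perm (Fin n), lam ∘ v = (m : Fin n → ℕ) := by
    constructor
    · rintro ⟨v, hv⟩
      refine ⟨v * w⁻¹, ?_⟩
      rw [Perm.coe_mul, ← Function.comp_assoc, hv, Function.comp_assoc, ← Perm.coe_mul,
        mul_inv_cancel, Perm.coe_one, Function.comp_id]
    · rintro ⟨v, hv⟩
      exact ⟨v * w, by rw [Perm.coe_mul, ← Function.comp_assoc, hv]⟩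
  simp only [this] at h1
  rw [← h2] at h1
  simpa [cf_apply] using h1

/-- The coefficient of `x^μ` in `m_λ`, for partitions. -/
theorem cf_monomialSymm_antitone {n : ℕ} {lam μ : Fin n → ℕ} (hl : Antitone lam)
    (hm : Antitone μ) : cf μ (monomialSymm lam) = if lam = μ then 1 else 0 := by
  rw [cf_monomialSymm]
  congr 1
  rw [eq_iff_iff]
  constructor
  · rintro ⟨w, rfl⟩; exact (antitone_comp_unique hl hm).symm
  · rintro rfl; exact ⟨1, rfl⟩

theorem mem_span_monomialSymm {n : ℕ} {f : MvPolynomial (Fin n) ℂ} (hf : f ∈ symSub n) :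
    f ∈ Submodule.span ℂ {q | ∃ μ : Fin n → ℕ, Antitone μ ∧ cf μ f ≠ 0 ∧ q = monomialSymm μ} := by
  classical
  set T : Finset (Fin n → ℕ) :=
    (Finset.image (fun m : Fin n →₀ ℕ => (⇑m)) f.support).filter Antitone with hT
  have hmem : ∀ μ : Fin n → ℕ, μ ∈ T ↔ Antitone μ ∧ cf μ f ≠ 0 := by
    intro μ
    rw [hT, Finset.mem_filter, Finset.mem_image, and_comm, cf_apply]
    refine and_congr_right fun _ => ⟨?_, fun h => ?_⟩
    · rintro ⟨m, hm, rfl⟩; simpa using hm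
    · exact ⟨_, mem_support_iff.2 h, rfl⟩
  have hsum : f = ∑ μ ∈ T, cf μ f • monomialSymm μ := by
    refine symSub_ext hf (sum_mem fun μ _ => Submodule.smul_mem _ _ (monomialSymm_mem_symSub μ)) ?_
    intro α hα
    have : ∀ μ ∈ T, cf α (cf μ f • monomialSymm μ) = if μ = α then cf μ f else 0 := by
      intro μ hμ
      rw [map_smul, cf_monomialSymm_antitone ((hmem μ).1 hμ).1 hα]
      simp
    rw [map_sum, Finset.sum_congr rfl this, Finset.sum_ite_eq']
    split_ifs with h
    · rfl
    · by_contra H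
      exact h ((hmem α).2 ⟨hα, H⟩)
  obtain ⟨S, hS⟩ : ∃ S, S = Submodule.span ℂ
    {q | ∃ μ : Fin n → ℕ, Antitone μ ∧ cf μ f ≠ 0 ∧ q = monomialSymm μ} := ⟨_, rfl⟩
  rw [← hS, hsum]
  refine sum_mem fun μ hμ => Submodule.smul_mem _ _ ?_
  rw [hS]
  refine Submodule.subset_span ?_
  exact ⟨μ, ((hmem μ).1 hμ).1, ((hmem μ).1 hμ).2, rfl⟩

theorem sum_le_topSum {n : ℕ} {μ : Fin n → ℕ} (h : Antitone μ) (S : Finset (Fin n)) :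
    ∑ i ∈ S, μ i ≤ topSum μ S.card := by
  set F : Finset (Fin n) := Finset.univ.filter fun i => i.val < S.card with hF
  have hSn : S.card ≤ n := by simpa using Finset.card_le_univ S
  have hcard : F.card = S.card := by
    rw [hF, Fin.card_filter_val_lt, min_eq_right hSn]
  have h1 := Finset.sum_inter_add_sum_sdiff S F μ
  have h2 := Finset.sum_inter_add_sum_sdiff F S μ
  have h3 : ∑ i ∈ S \ F, μ i ≤ ∑ i ∈ F \ S, μ i := by
    rcases (S \ F).eq_empty_or_nonempty with he | ⟨i, hi⟩
    · simp [he]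
    · have hi' : ¬ i.val < S.card := by simpa [hF] using (Finset.mem_sdiff.1 hi).2
      set k : Fin n := ⟨S.card, by omega⟩
      calc ∑ i ∈ S \ F, μ i ≤ (S \ F).card • μ k := by
            refine Finset.sum_le_card_nsmul _ _ _ fun j hj => h ?_
            have : ¬ j.val < S.card := by simpa [hF] using (Finset.mem_sdiff.1 hj).2
            rw [Fin.le_def]; simp only [k]; omega
        _ = (F \ S).card • μ k := by rw [Finset.card_sdiff_comm hcard.symm]
        _ ≤ _ := by
            refine Finset.card_nsmul_le_sum _ _ _ fun j hj => h ?_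
            have : j.val < S.card := by simpa [hF] using (Finset.mem_sdiff.1 hj).1
            rw [Fin.le_def]; simp only [k]; omega
  rw [Finset.inter_comm] at h2
  change ∑ i ∈ S, μ i ≤ ∑ i ∈ F, μ i
  omega

theorem topSum_le_of_partial_sums {n : ℕ} {μ lam : Fin n → ℕ}
    (h : ∀ i, ∑ j ∈ Finset.Iic i, μ j ≤ ∑ j ∈ Finset.Iic i, lam j) {k : ℕ} (hk : k ≤ n) :
    topSum μ k ≤ topSum lam k := by
  rcases k with _ | k
  · simp [topSum]
  · have := h ⟨k, by omega⟩
    rwa [← topSum_succ, ← topSum_succ] at this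

theorem Below.self {n : ℕ} {lam : Fin n → ℕ} (h : Antitone lam) :
    Below lam (Finsupp.equivFunOnFinite.symm lam) :=
  ⟨rfl, fun S => sum_le_topSum h S⟩

theorem DomLT.below {n : ℕ} {μ lam : Fin n → ℕ} (hμ : Antitone μ) (h : DomLT μ lam) :
    Below lam (Finsupp.equivFunOnFinite.symm μ) :=
  ⟨h.2.1, fun S => (sum_le_topSum hμ S).trans
    (topSum_le_of_partial_sums h.2.2 (by simpa using Finset.card_le_univ S))⟩

theorem Below.domLT {n : ℕ} {μ lam : Fin n → ℕ}
    (h : Below lam (Finsupp.equivFunOnFinite.symm μ)) (hne : μ ≠ lam) : DomLT μ lam := by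
  refine ⟨hne, h.1, fun i => ?_⟩
  have := h.2 (Finset.Iic i)
  rwa [Fin.card_Iic, topSum_succ] at this

/-- The span of the `m_μ` with `μ < lam` in the dominance order. -/
def domSpan {n : ℕ} (lam : Fin n → ℕ) : Submodule ℂ (MvPolynomial (Fin n) ℂ) :=
  Submodule.span ℂ {q | ∃ mu : Fin n → ℕ, Antitone mu ∧ DomLT mu lam ∧ q = monomialSymm mu}

theorem monomialSymm_mem_belowSub {n : ℕ} {μ lam : Fin n → ℕ}
    (h : Below lam (Finsupp.equivFunOnFinite.symm μ)) : monomialSymm μ ∈ belowSub lam := by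
  rw [mem_belowSub]
  intro α hα
  have h1 := cf_monomialSymm μ (α : Fin n → ℕ)
  have h2 : cf (α : Fin n → ℕ) (monomialSymm μ) = coeff α (monomialSymm μ) := by simp [cf_apply]
  rw [h2] at h1
  split_ifs at h1 with hw
  · obtain ⟨w, hw⟩ := hw
    have : α = (Finsupp.equivFunOnFinite.symm μ).mapDomain w.symm := by
      ext k
      rw [Finsupp.mapDomain_equiv_apply, ← hw]
      simp
    rw [this]
    exact h.mapDomain _
  · exact absurd h1 hα

theorem domSpan_le {n : ℕ} (lam : Fin n → ℕ) : domSpan lam ≤ symSub n ⊓ belowSub lam := by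
  rw [domSpan, Submodule.span_le]
  rintro _ ⟨μ, hμ, h, rfl⟩
  exact ⟨monomialSymm_mem_symSub μ, monomialSymm_mem_belowSub (h.below hμ)⟩

theorem cf_domSpan {n : ℕ} {lam : Fin n → ℕ} (hlam : Antitone lam) {f : MvPolynomial (Fin n) ℂ}
    (hf : f ∈ domSpan lam) : cf lam f = 0 := by
  induction hf using Submodule.span_induction with
  | mem x hx =>
    obtain ⟨μ, hμ, h, rfl⟩ := hx
    rw [cf_monomialSymm_antitone hμ hlam, if_neg h.1]
  | zero => simp
  | add x y _ _ hx hy => rw [map_add, hx, hy, add_zero]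
  | smul a x _ hx => rw [map_smul, hx, smul_zero]

theorem mem_domSpan {n : ℕ} {lam : Fin n → ℕ} {f : MvPolynomial (Fin n) ℂ} (hf : f ∈ symSub n)
    (hb : f ∈ belowSub lam) (h0 : cf lam f = 0) : f ∈ domSpan lam := by
  refine Submodule.span_mono ?_ (mem_span_monomialSymm hf)
  rintro _ ⟨μ, hμ, hc, rfl⟩
  refine ⟨μ, hμ, (mem_belowSub.1 hb _ hc).domLT ?_, rfl⟩
  rintro rfl
  exact hc h0

/-! ### The operators `E_1` and `D_2` on symmetric polynomials -/

theorem rename_pderiv_of_sym {n : ℕ} {f : MvPolynomial (Fin n) ℂ} (hf : f ∈ symSub n)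
    (w : Perm (Fin n)) (i : Fin n) : rename w (pderiv i f) = pderiv (w i) f := by
  rw [permOp_mul_pderiv, mem_symSub.1 hf]

theorem dunkl_of_sym {n : ℕ} (c : ℂ) {f : MvPolynomial (Fin n) ℂ} (hf : f ∈ symSub n)
    (i : Fin n) : dunkl c i f = pderiv i f := by
  rw [dunkl_apply, Finset.sum_eq_zero, smul_zero, add_zero]
  intro j hj
  exact divDiff_eq (Finset.ne_of_mem_erase hj).symm (by rw [mem_symSub.1 hf]; ring)

theorem dunklEuler_of_sym {n : ℕ} (c : ℂ) {f : MvPolynomial (Fin n) ℂ} (hf : f ∈ symSub n)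
    (i : Fin n) : dunklEuler c i f = X i * pderiv i f := by
  rw [dunklEuler, Module.End.mul_apply, mulX_apply, dunkl_of_sym c hf]

theorem cherednik_of_sym {n : ℕ} (c : ℂ) {f : MvPolynomial (Fin n) ℂ} (hf : f ∈ symSub n)
    (i : Fin n) : cherednik c i f = X i * pderiv i f + (c * ((n : ℂ) - 1 - i)) • f := by
  have h : ∑ j ∈ Finset.Ioi i, permOp (swap i j) f = ∑ j ∈ Finset.Ioi i, f :=
    Finset.sum_congr rfl fun j _ => mem_symSub.1 hf (swap i j)
  rw [cherednik, LinearMap.add_apply, dunklEuler_of_sym c hf, LinearMap.smul_apply, jucysMurphy,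
    LinearMap.sum_apply, h,
    Finset.sum_const, Fin.card_Ioi, ← Nat.cast_smul_eq_nsmul ℂ, smul_smul]
  rw [Nat.cast_sub (by have := i.2; omega), Nat.cast_sub (by have := i.2; omega)]
  simp

/-- The Euler operator as an operator on polynomials. -/
def eulerP {n : ℕ} (f : MvPolynomial (Fin n) ℂ) : MvPolynomial (Fin n) ℂ :=
  ∑ i, X i * pderiv i f

theorem cherednik_sq_of_sym {n : ℕ} (c : ℂ) {f : MvPolynomial (Fin n) ℂ} (hf : f ∈ symSub n) :
    ∑ i, cherednik c i (cherednik c i f) = ∑ i, dunklEuler c i (X i * pderiv i f) +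
      (c * ((n : ℂ) - 1)) • eulerP f + (∑ i : Fin n, (c * ((n : ℂ) - 1 - i)) ^ 2) • f := by
  have h1 : ∀ i : Fin n, cherednik c i (cherednik c i f) = dunklEuler c i (X i * pderiv i f) +
      c • ∑ j ∈ Finset.Ioi i, X j * pderiv j f +
      (c * ((n : ℂ) - 1 - i)) • (X i * pderiv i f) + ((c * ((n : ℂ) - 1 - i)) ^ 2) • f := by
    intro i
    rw [cherednik_of_sym c hf, map_add, map_smul, cherednik_of_sym c hf, cherednik,
      LinearMap.add_apply, LinearMap.smul_apply, jucysMurphy, LinearMap.sum_apply]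
    have : ∀ j ∈ Finset.Ioi i, permOp (swap i j) (X i * pderiv i f) = X j * pderiv j f := by
      intro j _
      rw [permOp_apply, map_mul, rename_X, rename_pderiv_of_sym hf, swap_apply_left]
    rw [Finset.sum_congr rfl this, smul_add, smul_smul, pow_two]
    abel
  have h2 : ∑ i : Fin n, ∑ j ∈ Finset.Ioi i, X j * pderiv j f =
      ∑ j : Fin n, (j : ℂ) • (X j * pderiv j f) := by
    rw [Finset.sum_comm' (t' := Finset.univ) (s' := fun j => Finset.Iio j) (by simp)]
    refine Finset.sum_congr rfl fun j _ => ?_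
    rw [Finset.sum_const, Fin.card_Iio, Nat.cast_smul_eq_nsmul]
  rw [Finset.sum_congr rfl fun i _ => h1 i, Finset.sum_add_distrib, Finset.sum_add_distrib,
    Finset.sum_add_distrib, ← Finset.smul_sum, h2, Finset.sum_smul, eulerP, Finset.smul_sum,
    Finset.smul_sum]
  congr 1
  rw [add_assoc, ← Finset.sum_add_distrib]
  congr 1
  refine Finset.sum_congr rfl fun i _ => ?_
  rw [smul_smul, ← add_smul]
  congr 1
  ring

theorem sum_erase_comm {n : ℕ} {M : Type*} [AddCommMonoid M] (F : Fin n → Fin n → M) :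
    ∑ i, ∑ j ∈ Finset.univ.erase i, F i j = ∑ i, ∑ j ∈ Finset.univ.erase i, F j i :=
  Finset.sum_comm' (by simp [eq_comm])

/-- The operator `D_2` on symmetric polynomials, as a polynomial in the Cherednik operators: the sum
of `ξ_i² - ξ_i` up to a constant. Away from symmetric polynomials it differs from `D_2`. -/
def jackP {n : ℕ} (c : ℂ) : Op n :=
  cherednikHom c
    (∑ i : Fin n, (X i ^ 2 - X i + C (c * ((n : ℂ) - 1 - i) - (c * ((n : ℂ) - 1 - i)) ^ 2)))

theorem jackP_apply {n : ℕ} (c : ℂ) {f : MvPolynomial (Fin n) ℂ} (hf : f ∈ symSub n) :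
    jackP c f = ∑ i, dunklEuler c i (X i * pderiv i f) + (c * ((n : ℂ) - 1) - 1) • eulerP f := by
  have h := cherednik_sq_of_sym c hf
  have h2 : ∀ i : Fin n, cherednikHom c (X i ^ 2 - X i + C (c * ((n : ℂ) - 1 - i) -
      (c * ((n : ℂ) - 1 - i)) ^ 2)) f = cherednik c i (cherednik c i f) - X i * pderiv i f
      - ((c * ((n : ℂ) - 1 - i)) ^ 2) • f := by
    intro i
    rw [map_add, map_sub, map_pow, cherednikHom_X, cherednikHom_C, LinearMap.add_apply,
      LinearMap.sub_apply, pow_two (cherednik c i), Module.End.mul_apply, cherednik_of_sym c hf,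
      LinearMap.smul_apply, Module.End.one_apply]
    module
  rw [jackP, map_sum, LinearMap.sum_apply, Finset.sum_congr rfl fun i _ => h2 i,
    Finset.sum_sub_distrib, Finset.sum_sub_distrib, h, Finset.sum_smul, sub_smul, one_smul, eulerP]
  abel

theorem toRat_injective {n : ℕ} : Function.Injective (toRat (n := n)) :=
  IsFractionRing.injective _ _

theorem toRat_sub_ne_zero {n : ℕ} {i j : Fin n} (hij : i ≠ j) :
    toRat (X i - X j : MvPolynomial (Fin n) ℂ) ≠ 0 := by
  rw [ne_eq, ← map_zero (algebraMap (MvPolynomial (Fin n) ℂ) (RatFun n))]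
  exact fun h => X_sub_X_ne_zero hij (toRat_injective h)

/-- The singular terms of `D_2` come from the divided differences in `∑ ξ_i²`. -/
theorem jackOp_eq {n : ℕ} (κ : ℝ) {f : MvPolynomial (Fin n) ℂ} (hf : f ∈ symSub n) :
    jackOp κ f = toRat (jackP (κ : ℂ) f) := by
  set c : ℂ := (κ : ℂ)
  have h1 : ∀ i : Fin n, dunklEuler c i (X i * pderiv i f) = X i * pderiv i f +
      X i ^ 2 * pderiv i (pderiv i f) + C c *
        ∑ j ∈ Finset.univ.erase i, X i * divDiff i j (X i * pderiv i f) := by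
    intro i
    rw [dunklEuler, Module.End.mul_apply, mulX_apply, dunkl_apply, Derivation.leibniz,
      pderiv_X_self, smul_eq_mul, smul_eq_mul, smul_eq_C_mul, ← Finset.mul_sum]
    ring
  have h2 : ∀ i j : Fin n, j ∈ Finset.univ.erase i →
      toRat (X i * divDiff i j (X i * pderiv i f)) =
        toRat (X i) * (toRat (X i * pderiv i f) / toRat (X i - X j)) -
        toRat (X i) * (toRat (X j * pderiv j f) / toRat (X i - X j)) := by
    intro i j hj
    have hij := (Finset.ne_of_mem_erase hj).symm
    have h := congrArg toRat (sub_mul_divDiff hij (X i * pderiv i f))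
    rw [map_mul (rename _), rename_X, rename_pderiv_of_sym hf, swap_apply_left] at h
    simp only [toRat, map_mul, map_sub] at h ⊢
    have hne := toRat_sub_ne_zero hij
    simp only [toRat, map_sub] at hne
    field_simp
    linear_combination h
  -- The terms for `(i, j)` and `(j, i)` are combined through `x_i / (x_i - x_j) - x_j / (x_j - x_i)
  -- = 2 x_i / (x_i - x_j) - 1`.
  have h3 : ∀ i j : Fin n, j ∈ Finset.univ.erase i →
      toRat (X i) * (toRat (X i * pderiv i f) / toRat (X i - X j)) -
        toRat (X j) * (toRat (X i * pderiv i f) / toRat (X j - X i)) =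
      2 * (toRat (X i ^ 2) / toRat (X i - X j) * toRat (pderiv i f)) -
        toRat (X i * pderiv i f) := by
    intro i j hj
    have hij := (Finset.ne_of_mem_erase hj).symm
    have hne := toRat_sub_ne_zero hij
    have hne' := toRat_sub_ne_zero hij.symm
    simp only [toRat, map_sub, map_mul, map_pow] at hne hne' ⊢
    field_simp
    ring
  have h4 : toRat (∑ i, ∑ j ∈ Finset.univ.erase i, X i * divDiff i j (X i * pderiv i f)) =
      2 * (∑ i, ∑ j ∈ Finset.univ.erase i,
        toRat (X i ^ 2) / toRat (X i - X j) * toRat (pderiv i f)) -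
      ((n : RatFun n) - 1) * toRat (eulerP f) := by
    rw [toRat, map_sum]
    simp only [map_sum]
    rw [Finset.sum_congr rfl fun i _ => Finset.sum_congr rfl fun j hj => h2 i j hj]
    simp only [Finset.sum_sub_distrib]
    rw [sum_erase_comm fun i j => toRat (X i) * (toRat (X j * pderiv j f) / toRat (X i - X j))]
    simp only [← Finset.sum_sub_distrib]
    rw [Finset.sum_congr rfl fun i _ => Finset.sum_congr rfl fun j hj => h3 i j hj]
    simp only [Finset.sum_sub_distrib, ← Finset.mul_sum]
    congr 1
    rw [eulerP, toRat, map_sum, Finset.mul_sum]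
    refine Finset.sum_congr rfl fun i _ => ?_
    rw [Finset.sum_const, Finset.card_erase_of_mem (Finset.mem_univ i), Finset.card_univ,
      Fintype.card_fin, nsmul_eq_mul, Nat.cast_sub (by have := i.2; omega), Nat.cast_one]
  have h5 : jackP c f = ∑ i, X i ^ 2 * pderiv i (pderiv i f) +
      C c * ∑ i, ∑ j ∈ Finset.univ.erase i, X i * divDiff i j (X i * pderiv i f) +
      C c * ((n : MvPolynomial (Fin n) ℂ) - 1) * eulerP f := by
    rw [jackP_apply c hf, Finset.sum_congr rfl fun i _ => h1 i, Finset.sum_add_distrib,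
      Finset.sum_add_distrib, smul_eq_C_mul, ← Finset.mul_sum, eulerP]
    simp only [map_sub, map_mul, map_natCast, map_one]
    ring
  rw [h5, jackOp]
  simp only [toRat, map_add, map_mul, map_sub, map_natCast, map_one, map_ofNat] at h4 ⊢
  rw [h4]
  ring

theorem besselOp_eq_jackOp_add {n : ℕ} (κ a : ℝ) (f : MvPolynomial (Fin n) ℂ) :
    besselOp κ a f = jackOp κ f + toRat (C (a : ℂ) * eulerP f + 2 * ∑ i, pderiv i f) := by
  rw [besselOp, jackOp, eulerP, add_right_comm]
  congr 3
  rw [Finset.mul_sum, Finset.mul_sum, ← Finset.sum_add_distrib]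
  exact Finset.sum_congr rfl fun i _ => by ring

/-! ### Triangular operators -/

section Triangular

variable {ι V : Type*} [AddCommGroup V] [Module ℂ V] {r : ι → ι → Prop} {rank : ι → ℕ}
  {e : ι → V} {D : V →ₗ[ℂ] V} {ε : ι → ℂ}

/-! A linear operator `D` is triangular for a family `e` and a transitive relation `r` when
`D (e i) = ε i • e i` up to the span of the `e j` with `r j i`. The function `rank` serves for
induction along `r`. -/

/-- Away from its diagonal entries, the shift of a triangular operator is surjective on the span of
lower vectors. -/
theorem triangular_span_le (hr : ∀ i j k, r i j → r j k → r i k)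
    (hrank : ∀ i j, r i j → rank i < rank j)
    (hD : ∀ i, D (e i) - ε i • e i ∈ Submodule.span ℂ (e '' {j | r j i})) {i : ι} {c : ℂ}
    (hc : ∀ j, r j i → ε j ≠ c) :
    Submodule.span ℂ (e '' {j | r j i}) ≤
      (Submodule.span ℂ (e '' {j | r j i})).map (D - c • LinearMap.id) := by
  have key : ∀ N j, rank j = N → r j i →
      e j ∈ (Submodule.span ℂ (e '' {j | r j i})).map (D - c • LinearMap.id) := by
    intro N
    induction N using Nat.strong_induction_on with
    | _ N ih =>
      intro j hN hj
      have h1 : Submodule.span ℂ (e '' {k | r k j}) ≤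
          (Submodule.span ℂ (e '' {j | r j i})).map (D - c • LinearMap.id) := by
        rw [Submodule.span_le]
        rintro _ ⟨k, hk, rfl⟩
        exact ih (rank k) (hN ▸ hrank k j hk) k rfl (hr k j i hk hj)
      have h2 : (D - c • LinearMap.id : V →ₗ[ℂ] V) (e j) ∈
          (Submodule.span ℂ (e '' {j | r j i})).map (D - c • LinearMap.id) :=
        Submodule.mem_map_of_mem (Submodule.subset_span ⟨j, hj, rfl⟩)
      have h3 : (ε j - c) • e j =
          (D - c • LinearMap.id : V →ₗ[ℂ] V) (e j) - (D (e j) - ε j • e j) := by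
        simp only [LinearMap.sub_apply, LinearMap.smul_apply, LinearMap.id_apply]
        module
      have h4 : (ε j - c) • e j ∈
          (Submodule.span ℂ (e '' {j | r j i})).map (D - c • LinearMap.id) := by
        rw [h3]; exact sub_mem h2 (h1 (hD j))
      have := Submodule.smul_mem _ (ε j - c)⁻¹ h4
      rwa [inv_smul_smul₀ (sub_ne_zero.2 (hc j hj))] at this
  rw [Submodule.span_le]
  rintro _ ⟨j, hj, rfl⟩
  exact key _ j rfl hj

theorem triangular_map_mem (hr : ∀ i j k, r i j → r j k → r i k)
    (hD : ∀ i, D (e i) - ε i • e i ∈ Submodule.span ℂ (e '' {j | r j i})) {i : ι} {z : V}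
    (hz : z ∈ Submodule.span ℂ (e '' {j | r j i})) :
    D z ∈ Submodule.span ℂ (e '' {j | r j i}) := by
  induction hz using Submodule.span_induction with
  | mem x hx =>
    obtain ⟨j, hj, rfl⟩ := hx
    have h1 : Submodule.span ℂ (e '' {k | r k j}) ≤ Submodule.span ℂ (e '' {k | r k i}) :=
      Submodule.span_mono (Set.image_mono fun k hk => hr k j i hk hj)
    have h2 := add_mem (h1 (hD j))
      (Submodule.smul_mem _ (ε j) (Submodule.subset_span (Set.mem_image_of_mem e hj)))
    rwa [sub_add_cancel] at h2
  | zero => rw [map_zero]; exact zero_mem _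
  | add x y _ _ hx hy => rw [map_add]; exact add_mem hx hy
  | smul a x _ hx => rw [map_smul]; exact Submodule.smul_mem _ _ hx

/-- A triangular operator has no eigenvalue on a span of finitely many lower vectors other than
its diagonal entries there: it is surjective up to the shift, hence injective. -/
theorem triangular_eq_zero (hr : ∀ i j k, r i j → r j k → r i k)
    (hrank : ∀ i j, r i j → rank i < rank j)
    (hD : ∀ i, D (e i) - ε i • e i ∈ Submodule.span ℂ (e '' {j | r j i})) {i : ι}
    (hfin : {j | r j i}.Finite) {c : ℂ} (hc : ∀ j, r j i → ε j ≠ c) {z : V}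
    (hz : z ∈ Submodule.span ℂ (e '' {j | r j i})) (h0 : D z = c • z) : z = 0 := by
  set N := Submodule.span ℂ (e '' {j | r j i}) with hN
  have hmap : ∀ x ∈ N, (D - c • LinearMap.id : V →ₗ[ℂ] V) x ∈ N := fun x hx => by
    simp only [LinearMap.sub_apply, LinearMap.smul_apply, LinearMap.id_apply]
    exact sub_mem (triangular_map_mem hr hD hx) (Submodule.smul_mem _ _ hx)
  have : FiniteDimensional ℂ N := FiniteDimensional.span_of_finite ℂ (hfin.image e)
  set A : N →ₗ[ℂ] N := (D - c • LinearMap.id).restrict hmap with hA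
  have hsurj : Function.Surjective A := by
    rintro ⟨y, hy⟩
    obtain ⟨x, hx, hxy⟩ := triangular_span_le hr hrank hD hc hy
    exact ⟨⟨x, hx⟩, Subtype.ext hxy⟩
  have hinj := LinearMap.injective_iff_surjective.2 hsurj
  have : A ⟨z, hz⟩ = 0 := by
    apply Subtype.ext
    simp [hA, h0]
  have := hinj (this.trans (map_zero A).symm)
  simpa using congrArg Subtype.val this

/-- An eigenvector of a triangular operator with leading term `e i`. -/
theorem triangular_exists (hr : ∀ i j k, r i j → r j k → r i k)
    (hrank : ∀ i j, r i j → rank i < rank j)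
    (hD : ∀ i, D (e i) - ε i • e i ∈ Submodule.span ℂ (e '' {j | r j i})) {i : ι}
    (hc : ∀ j, r j i → ε j ≠ ε i) :
    ∃ v, v - e i ∈ Submodule.span ℂ (e '' {j | r j i}) ∧ D v = ε i • v := by
  obtain ⟨y, hy, h⟩ := triangular_span_le hr hrank hD hc (hD i)
  refine ⟨e i - y, by simpa using hy, ?_⟩
  simp only [LinearMap.sub_apply, LinearMap.smul_apply, LinearMap.id_apply] at h
  rw [map_sub, smul_sub, sub_eq_sub_iff_sub_eq_sub, ← h]

theorem triangular_eigenvalue (hr : ∀ i j k, r i j → r j k → r i k)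
    (hD : ∀ i, D (e i) - ε i • e i ∈ Submodule.span ℂ (e '' {j | r j i})) {i : ι}
    (hi : e i ∉ Submodule.span ℂ (e '' {j | r j i})) {v : V} {c : ℂ}
    (hv : v - e i ∈ Submodule.span ℂ (e '' {j | r j i})) (h : D v = c • v) : c = ε i := by
  by_contra hne
  apply hi
  have h1 := triangular_map_mem hr hD hv
  have h2 : (c - ε i) • e i = D (v - e i) + (D (e i) - ε i • e i) - c • (v - e i) := by
    rw [map_sub, h]; module
  have h3 : (c - ε i) • e i ∈ Submodule.span ℂ (e '' {j | r j i}) := by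
    rw [h2]; exact sub_mem (add_mem h1 (hD i)) (Submodule.smul_mem _ _ hv)
  have := Submodule.smul_mem _ (c - ε i)⁻¹ h3
  rwa [inv_smul_smul₀ (sub_ne_zero.2 hne)] at this

/-- Uniqueness of the eigenvector of a triangular operator with a given leading term. -/
theorem triangular_unique (hr : ∀ i j k, r i j → r j k → r i k)
    (hrank : ∀ i j, r i j → rank i < rank j)
    (hD : ∀ i, D (e i) - ε i • e i ∈ Submodule.span ℂ (e '' {j | r j i})) {i : ι}
    (hfin : {j | r j i}.Finite) (hc : ∀ j, r j i → ε j ≠ ε i)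
    (hi : e i ∉ Submodule.span ℂ (e '' {j | r j i})) {v w : V} {c d : ℂ}
    (hv : v - e i ∈ Submodule.span ℂ (e '' {j | r j i})) (hDv : D v = c • v)
    (hw : w - e i ∈ Submodule.span ℂ (e '' {j | r j i})) (hDw : D w = d • w) : v = w := by
  rw [triangular_eigenvalue hr hD hi hv hDv] at hDv
  rw [triangular_eigenvalue hr hD hi hw hDw] at hDw
  rw [← sub_eq_zero]
  refine triangular_eq_zero hr hrank hD hfin hc ?_ (by rw [map_sub, hDv, hDw, smul_sub])
  have := sub_mem hv hw
  rwa [sub_sub_sub_cancel_right] at this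

end Triangular

/-! ### Dominance order and eigenvalues of `D_2` -/

/-- Partitions with at most `n` parts. -/
abbrev Part (n : ℕ) : Type := {lam : Fin n → ℕ // Antitone lam}

theorem eq_of_partial_sums {n : ℕ} {μ lam : Fin n → ℕ}
    (h : ∀ i, ∑ j ∈ Finset.Iic i, μ j = ∑ j ∈ Finset.Iic i, lam j) : μ = lam := by
  funext i
  induction i using WellFoundedLT.induction with
  | _ i ih =>
    have h1 := h i
    rw [← Finset.Iio_insert, Finset.sum_insert (by simp), Finset.sum_insert (by simp),
      Finset.sum_congr rfl fun j hj => ih j (Finset.mem_Iio.1 hj)] at h1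
    exact Nat.add_right_cancel h1

theorem DomLT.trans {n : ℕ} {μ ν lam : Fin n → ℕ} (h1 : DomLT μ ν) (h2 : DomLT ν lam) :
    DomLT μ lam := by
  refine ⟨?_, h1.2.1.trans h2.2.1, fun i => (h1.2.2 i).trans (h2.2.2 i)⟩
  rintro rfl
  exact h1.1 (eq_of_partial_sums fun i => le_antisymm (h1.2.2 i) (h2.2.2 i))

/-- The sum of all partial sums, which increases along the dominance order. -/
def domRank {n : ℕ} (lam : Fin n → ℕ) : ℕ := ∑ i, ∑ j ∈ Finset.Iic i, lam j

theorem DomLT.domRank_lt {n : ℕ} {μ lam : Fin n → ℕ} (h : DomLT μ lam) :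
    domRank μ < domRank lam := by
  refine Finset.sum_lt_sum (fun i _ => h.2.2 i) ?_
  by_contra! H
  exact h.1 (eq_of_partial_sums fun i => le_antisymm (h.2.2 i) (H i (Finset.mem_univ i)))

theorem le_weight {n : ℕ} (lam : Fin n → ℕ) (i : Fin n) : lam i ≤ weight lam :=
  Finset.single_le_sum (f := lam) (fun _ _ => Nat.zero_le _) (Finset.mem_univ i)

theorem finite_domLT {n : ℕ} (lam : Part n) : {μ : Part n | DomLT μ.1 lam.1}.Finite := by
  refine Set.Finite.of_finite_image (f := Subtype.val) ?_ Subtype.val_injective.injOn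
  refine (Set.finite_Iic fun _ : Fin n => weight lam.1).subset ?_
  rintro _ ⟨μ, hμ, rfl⟩ i
  exact (le_weight μ.1 i).trans hμ.2.1.le

/-- Summation by parts: a decreasing nonnegative weight preserves nonnegativity of partial
sums. -/
theorem sum_mul_nonneg_of_antitone : ∀ {n : ℕ} {w d : Fin n → ℝ}, Antitone w → (∀ i, 0 ≤ w i) →
    (∀ i, 0 ≤ ∑ j ∈ Finset.Iic i, d j) → 0 ≤ ∑ i, w i * d i := by
  intro n
  induction n with
  | zero => intros; simp
  | succ n ih =>
    intro w d hw h0 hd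
    have h1 : ∑ i, w i * d i = ∑ i : Fin n, (w i.castSucc - w (Fin.last n)) * d i.castSucc +
        w (Fin.last n) * ∑ i, d i := by
      rw [Fin.sum_univ_castSucc, Fin.sum_univ_castSucc d, mul_add, Finset.mul_sum, ← add_assoc,
        ← Finset.sum_add_distrib]
      congr 1
      exact Finset.sum_congr rfl fun i _ => by ring
    rw [h1]
    refine add_nonneg (ih ?_ ?_ ?_) (mul_nonneg (h0 _) ?_)
    · intro i j hij
      exact sub_le_sub_right (hw (Fin.castSucc_le_castSucc_iff.2 hij)) _
    · intro i
      exact sub_nonneg.2 (hw (Fin.le_last _))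
    · intro i
      have := hd i.castSucc
      rwa [← Fin.map_castSuccEmb_Iic, Finset.sum_map] at this
    · have := hd (Fin.last n)
      rwa [show Finset.Iic (Fin.last n) = Finset.univ from by ext; simp [Fin.le_last]] at this

/-- The eigenvalue of `D_2` on the Jack polynomial of `lam`. -/
def jackEig {n : ℕ} (κ : ℝ) (lam : Fin n → ℕ) : ℝ :=
  ∑ i : Fin n, (lam i : ℝ) * (lam i - 1 + 2 * κ * ((n : ℝ) - 1 - i))

theorem cast_le_sub_one {n : ℕ} (i : Fin n) : 0 ≤ (n : ℝ) - 1 - i := by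
  have : (i : ℝ) + 1 ≤ n := by exact_mod_cast i.2
  linarith

/-- The difference of the eigenvalues is `∑ (λ_i - μ_i)²` plus a pairing of `λ - μ` with a
decreasing sequence, which is nonnegative by summation by parts. -/
theorem DomLT.jackEig_lt {n : ℕ} {κ : ℝ} (hκ : 0 ≤ κ) {μ lam : Fin n → ℕ} (hμ : Antitone μ)
    (h : DomLT μ lam) : jackEig κ μ < jackEig κ lam := by
  have hw : ∑ i, (lam i : ℝ) = ∑ i, (μ i : ℝ) := by exact_mod_cast h.2.1.symm
  have h1 : jackEig κ lam - jackEig κ μ = ∑ i, ((lam i : ℝ) - μ i) ^ 2 +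
      ∑ i : Fin n, (2 * μ i + 2 * κ * ((n : ℝ) - 1 - i)) * ((lam i : ℝ) - μ i) := by
    have h2 : ∑ i, ((lam i : ℝ) - μ i) = 0 := by rw [Finset.sum_sub_distrib, hw, sub_self]
    rw [← sub_zero (_ + _), ← h2, jackEig, jackEig, ← Finset.sum_add_distrib,
      ← Finset.sum_sub_distrib, ← Finset.sum_sub_distrib]
    exact Finset.sum_congr rfl fun i _ => by ring
  have h2 : 0 ≤ ∑ i : Fin n, (2 * μ i + 2 * κ * ((n : ℝ) - 1 - i)) * ((lam i : ℝ) - μ i) := by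
    refine sum_mul_nonneg_of_antitone ?_ ?_ ?_
    · intro i j hij
      have h3 : (μ j : ℝ) ≤ μ i := by exact_mod_cast hμ hij
      have h4 : (i : ℝ) ≤ j := by exact_mod_cast hij
      have : κ * ((n : ℝ) - 1 - j) ≤ κ * ((n : ℝ) - 1 - i) :=
        mul_le_mul_of_nonneg_left (by linarith) hκ
      simp only
      linarith
    · intro i
      have := mul_nonneg hκ (cast_le_sub_one i)
      have h3 : (0 : ℝ) ≤ μ i := by positivity
      linarith
    · intro i
      rw [Finset.sum_sub_distrib, sub_nonneg]
      exact_mod_cast h.2.2 i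
  have h3 : 0 < ∑ i, ((lam i : ℝ) - μ i) ^ 2 := by
    obtain ⟨i, hi⟩ := Function.ne_iff.1 h.1
    refine Finset.sum_pos' (fun i _ => sq_nonneg _) ⟨i, Finset.mem_univ i, ?_⟩
    have : (lam i : ℝ) - μ i ≠ 0 := by
      rw [sub_ne_zero]; exact_mod_cast hi.symm
    positivity
  linarith

theorem eval_spec_jackEig {n : ℕ} (κ : ℝ) (lam : Fin n → ℕ) :
    eval (spec (κ : ℂ) lam) (∑ i : Fin n, (X i ^ 2 - X i +
      C ((κ : ℂ) * ((n : ℂ) - 1 - i) - ((κ : ℂ) * ((n : ℂ) - 1 - i)) ^ 2))) = jackEig κ lam := by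
  rw [map_sum, jackEig, Complex.ofReal_sum]
  refine Finset.sum_congr rfl fun i _ => ?_
  simp only [map_add, map_sub, map_pow, eval_X, eval_C, spec]
  push_cast
  ring

/-! ### Jack polynomials -/

theorem eulerP_belowSub {n : ℕ} {lam : Fin n → ℕ} {f : MvPolynomial (Fin n) ℂ}
    (hf : f ∈ belowSub lam) : eulerP f = (weight lam : ℂ) • f := by
  refine belowSub_induction (p := fun f => eulerP f = (weight lam : ℂ) • f) hf
    (by simp [eulerP]) (fun f g hf hg => ?_) (fun a f hf => ?_) fun α hα => ?_
  · rw [smul_add, ← hf, ← hg, eulerP, eulerP, eulerP, ← Finset.sum_add_distrib]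
    exact Finset.sum_congr rfl fun i _ => by rw [map_add, mul_add]
  · rw [smul_comm, ← hf, eulerP, eulerP, Finset.smul_sum]
    exact Finset.sum_congr rfl fun i _ => by rw [Derivation.map_smul, mul_smul_comm]
  · rw [eulerP, Finset.sum_congr rfl fun i _ => X_mul_pderiv_monomial, ← Finset.sum_smul, hα.1,
      Nat.cast_smul_eq_nsmul]

theorem jackP_mem_symSub {n : ℕ} (c : ℂ) {f : MvPolynomial (Fin n) ℂ} (hf : f ∈ symSub n) :
    jackP c f ∈ symSub n := by
  rw [mem_symSub]
  intro w
  have h1 : rename w (eulerP f) = eulerP f := by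
    rw [eulerP, map_sum, ← Equiv.sum_comp w fun i => X i * pderiv i f]
    exact Finset.sum_congr rfl fun i _ => by
      rw [map_mul, rename_X, rename_pderiv_of_sym hf]
  rw [jackP_apply c hf, map_add, map_smul, h1, map_sum]
  congr 1
  rw [← Equiv.sum_comp w fun i => dunklEuler c i (X i * pderiv i f)]
  refine Finset.sum_congr rfl fun i _ => ?_
  rw [← permOp_apply, ← Module.End.mul_apply, permOp_mul_dunklEuler, Module.End.mul_apply,
    permOp_apply, map_mul, rename_X, rename_pderiv_of_sym hf]

theorem genOp_mem_symSub {n : ℕ} (c u : ℂ) {f : MvPolynomial (Fin n) ℂ} (hf : f ∈ symSub n) :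
    genOp c u f ∈ symSub n := by
  rw [mem_symSub]
  intro w
  rw [← permOp_apply, ← Module.End.mul_apply, permOp_commute_genOp, Module.End.mul_apply,
    permOp_apply, mem_symSub.1 hf]

theorem domSpan_eq {n : ℕ} (lam : Part n) : domSpan lam.1 =
    Submodule.span ℂ ((fun μ : Part n => monomialSymm μ.1) '' {μ : Part n | DomLT μ.1 lam.1}) := by
  rw [domSpan]
  congr 1
  ext q
  constructor
  · rintro ⟨μ, hμ, h, rfl⟩; exact ⟨⟨μ, hμ⟩, h, rfl⟩
  · rintro ⟨μ, h, rfl⟩; exact ⟨μ.1, μ.2, h, rfl⟩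

theorem jackP_monomialSymm {n : ℕ} (κ : ℝ) (lam : Part n) :
    jackP (κ : ℂ) (monomialSymm lam.1) - (jackEig κ lam.1 : ℂ) • monomialSymm lam.1 ∈
      domSpan lam.1 := by
  have h1 := monomialSymm_mem_belowSub (Below.self lam.2)
  have h2 := cherednikHom_belowSub (κ : ℂ) lam.2 h1 (∑ i : Fin n, (X i ^ 2 - X i +
      C ((κ : ℂ) * ((n : ℂ) - 1 - i) - ((κ : ℂ) * ((n : ℂ) - 1 - i)) ^ 2)))
  have hs := monomialSymm_mem_symSub lam.1
  refine mem_domSpan (sub_mem (jackP_mem_symSub _ hs) (Submodule.smul_mem _ _ hs))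
    (sub_mem h2.1 (Submodule.smul_mem _ _ h1)) ?_
  rw [eval_spec_jackEig] at h2
  rw [map_sub, map_smul, jackP, h2.2, smul_eq_mul, sub_self]

theorem monomialSymm_notMem {n : ℕ} (lam : Part n) : monomialSymm lam.1 ∉ domSpan lam.1 := by
  intro h
  have := cf_domSpan lam.2 h
  rw [cf_monomialSymm_self] at this
  exact one_ne_zero this

theorem isJack_iff {n : ℕ} (κ : ℝ) (lam : Part n) (P : MvPolynomial (Fin n) ℂ) :
    IsJack κ lam.1 P ↔ P - monomialSymm lam.1 ∈ domSpan lam.1 ∧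
      ∃ c : ℂ, jackP (κ : ℂ) P = c • P := by
  rw [IsJack, ← domSpan]
  refine and_congr_right fun h => ?_
  have hle := domSpan_le lam.1 h
  have hs : P ∈ symSub n := by
    have := add_mem hle.1 (monomialSymm_mem_symSub lam.1)
    rwa [sub_add_cancel] at this
  have hb : P ∈ belowSub lam.1 := by
    have := add_mem hle.2 (monomialSymm_mem_belowSub (Below.self lam.2))
    rwa [sub_add_cancel] at this
  constructor
  · rintro ⟨_, c, hc⟩
    refine ⟨c, ?_⟩
    rw [jackOp_eq κ hs] at hc
    rw [smul_eq_C_mul]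
    exact toRat_injective hc
  · rintro ⟨c, hc⟩
    refine ⟨⟨weight lam.1, ?_⟩, c, by rw [jackOp_eq κ hs, hc, smul_eq_C_mul]⟩
    have := eulerP_belowSub hb
    rw [eulerP] at this
    rw [eulerOp, this, smul_eq_C_mul]

theorem jack_triangular_ne {n : ℕ} {κ : ℝ} (hκ : 0 ≤ κ) (lam μ : Part n)
    (h : DomLT μ.1 lam.1) : (jackEig κ μ.1 : ℂ) ≠ jackEig κ lam.1 := by
  rw [ne_eq, Complex.ofReal_inj]
  exact (h.jackEig_lt hκ μ.2).ne

theorem exists_isJack {n : ℕ} {κ : ℝ} (hκ : 0 ≤ κ) (lam : Part n) : ∃ P, IsJack κ lam.1 P := by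
  obtain ⟨v, h1, h2⟩ := triangular_exists (r := fun μ lam : Part n => DomLT μ.1 lam.1)
    (rank := fun μ => domRank μ.1) (e := fun μ : Part n => monomialSymm μ.1)
    (D := jackP (κ : ℂ)) (ε := fun μ => (jackEig κ μ.1 : ℂ))
    (fun _ _ _ h h' => h.trans h') (fun _ _ h => h.domRank_lt)
    (fun μ => by rw [← domSpan_eq]; exact jackP_monomialSymm κ μ) (i := lam)
    (fun μ h => jack_triangular_ne hκ lam μ h)
  rw [← domSpan_eq] at h1
  exact ⟨v, (isJack_iff κ lam v).2 ⟨h1, _, h2⟩⟩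

theorem isJack_unique {n : ℕ} {κ : ℝ} (hκ : 0 ≤ κ) (lam : Part n) {P Q : MvPolynomial (Fin n) ℂ}
    (hP : IsJack κ lam.1 P) (hQ : IsJack κ lam.1 Q) : P = Q := by
  rw [isJack_iff, domSpan_eq] at hP hQ
  obtain ⟨hP1, c, hP2⟩ := hP
  obtain ⟨hQ1, d, hQ2⟩ := hQ
  exact triangular_unique (r := fun μ lam : Part n => DomLT μ.1 lam.1)
    (rank := fun μ => domRank μ.1) (e := fun μ : Part n => monomialSymm μ.1)
    (D := jackP (κ : ℂ)) (ε := fun μ => (jackEig κ μ.1 : ℂ))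
    (fun _ _ _ h h' => h.trans h') (fun _ _ h => h.domRank_lt)
    (fun μ => by rw [← domSpan_eq]; exact jackP_monomialSymm κ μ) (finite_domLT lam)
    (fun μ h => jack_triangular_ne hκ lam μ h)
    (by rw [← domSpan_eq]; exact monomialSymm_notMem lam) hP1 hP2 hQ1 hQ2

open scoped Classical in
/-- The Jack polynomial `P_λ`; it is set to `0` when it does not exist, which does not happen for
`0 ≤ κ`. -/
def jack {n : ℕ} (κ : ℝ) (lam : Part n) : MvPolynomial (Fin n) ℂ :=
  if h : ∃ P, IsJack κ lam.1 P then Classical.choose h else 0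

theorem isJack_jack {n : ℕ} {κ : ℝ} (hκ : 0 ≤ κ) (lam : Part n) :
    IsJack κ lam.1 (jack κ lam) := by
  rw [jack, dif_pos (exists_isJack hκ lam)]
  exact Classical.choose_spec (exists_isJack hκ lam)

theorem jack_sub_mem {n : ℕ} {κ : ℝ} (hκ : 0 ≤ κ) (lam : Part n) :
    jack κ lam - monomialSymm lam.1 ∈ domSpan lam.1 :=
  ((isJack_iff κ lam _).1 (isJack_jack hκ lam)).1

theorem jack_mem_symSub {n : ℕ} {κ : ℝ} (hκ : 0 ≤ κ) (lam : Part n) : jack κ lam ∈ symSub n := by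
  have := add_mem (domSpan_le _ (jack_sub_mem hκ lam)).1 (monomialSymm_mem_symSub lam.1)
  rwa [sub_add_cancel] at this

theorem jack_mem_belowSub {n : ℕ} {κ : ℝ} (hκ : 0 ≤ κ) (lam : Part n) :
    jack κ lam ∈ belowSub lam.1 := by
  have := add_mem (domSpan_le _ (jack_sub_mem hκ lam)).2
    (monomialSymm_mem_belowSub (Below.self lam.2))
  rwa [sub_add_cancel] at this

theorem cf_jack {n : ℕ} {κ : ℝ} (hκ : 0 ≤ κ) (lam : Part n) : cf lam.1 (jack κ lam) = 1 := by
  have := cf_domSpan lam.2 (jack_sub_mem hκ lam)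
  rwa [map_sub, cf_monomialSymm_self, sub_eq_zero] at this

theorem jackP_jack {n : ℕ} {κ : ℝ} (hκ : 0 ≤ κ) (lam : Part n) :
    jackP (κ : ℂ) (jack κ lam) = (jackEig κ lam.1 : ℂ) • jack κ lam := by
  obtain ⟨h1, c, h2⟩ := (isJack_iff κ lam _).1 (isJack_jack hκ lam)
  rw [domSpan_eq] at h1
  rwa [triangular_eigenvalue (r := fun μ lam : Part n => DomLT μ.1 lam.1)
    (e := fun μ : Part n => monomialSymm μ.1)
    (D := jackP (κ : ℂ)) (ε := fun μ => (jackEig κ μ.1 : ℂ)) (fun _ _ _ h h' => h.trans h')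
    (fun μ => by rw [← domSpan_eq]; exact jackP_monomialSymm κ μ)
    (by rw [← domSpan_eq]; exact monomialSymm_notMem lam) h1 h2] at h2

/-- Jack polynomials are eigenfunctions of all symmetric functions of the Cherednik operators, since
these commute with `D_2`: the image minus the expected multiple of `P_λ` is an eigenfunction of
`D_2` in the span of lower terms with the eigenvalue of `P_λ`, hence zero. -/
theorem genOp_jack {n : ℕ} {κ : ℝ} (hκ : 0 ≤ κ) (lam : Part n) (u : ℂ) :
    genOp (κ : ℂ) u (jack κ lam) = (∏ i, (u + spec (κ : ℂ) lam.1 i)) • jack κ lam := by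
  have hs := jack_mem_symSub hκ lam
  have hb := jack_mem_belowSub hκ lam
  have h := cherednikHom_belowSub (κ : ℂ) lam.2 hb (genPoly u)
  have he : eval (spec (κ : ℂ) lam.1) (genPoly u) = ∏ i, (u + spec (κ : ℂ) lam.1 i) := by
    rw [genPoly, map_prod]; simp
  rw [he] at h
  rw [← sub_eq_zero]
  refine triangular_eq_zero (r := fun μ lam : Part n => DomLT μ.1 lam.1)
    (rank := fun μ => domRank μ.1) (e := fun μ : Part n => monomialSymm μ.1)
    (D := jackP (κ : ℂ)) (ε := fun μ => (jackEig κ μ.1 : ℂ))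
    (fun _ _ _ h h' => h.trans h') (fun _ _ h => h.domRank_lt)
    (fun μ => by rw [← domSpan_eq]; exact jackP_monomialSymm κ μ) (finite_domLT lam)
    (fun μ h => jack_triangular_ne hκ lam μ h) ?_ ?_
  · rw [← domSpan_eq]
    refine mem_domSpan (sub_mem (genOp_mem_symSub _ _ hs) (Submodule.smul_mem _ _ hs))
      (sub_mem h.1 (Submodule.smul_mem _ _ hb)) ?_
    rw [map_sub, map_smul, genOp, h.2, smul_eq_mul, sub_self]
  · have hcomm : jackP (κ : ℂ) (genOp (κ : ℂ) u (jack κ lam)) =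
        genOp (κ : ℂ) u (jackP (κ : ℂ) (jack κ lam)) := by
      rw [← Module.End.mul_apply, ← Module.End.mul_apply, jackP, genOp, ← map_mul, ← map_mul,
        mul_comm]
    rw [map_sub, map_smul, hcomm, jackP_jack hκ, map_smul, smul_sub, smul_comm]

/-! ### The basis of Jack polynomials -/

theorem domSpan_le_span_jack {n : ℕ} {κ : ℝ} (hκ : 0 ≤ κ) (lam : Part n) : domSpan lam.1 ≤
    Submodule.span ℂ (jack κ '' {μ : Part n | DomLT μ.1 lam.1}) := by
  suffices H : ∀ N (μ : Part n), domRank μ.1 = N → DomLT μ.1 lam.1 → monomialSymm μ.1 ∈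
      Submodule.span ℂ (jack κ '' {μ : Part n | DomLT μ.1 lam.1}) by
    rw [domSpan_eq, Submodule.span_le]
    rintro _ ⟨μ, hμ, rfl⟩
    exact H _ μ rfl hμ
  intro N
  induction N using Nat.strong_induction_on with
  | _ N ih =>
    intro μ hN hμ
    have h1 : domSpan μ.1 ≤ Submodule.span ℂ (jack κ '' {μ : Part n | DomLT μ.1 lam.1}) := by
      rw [domSpan_eq, Submodule.span_le]
      rintro _ ⟨ν, hν, rfl⟩
      exact ih _ (hN ▸ hν.domRank_lt) ν rfl (hν.trans hμ)
    have h2 := sub_mem (Submodule.subset_span (Set.mem_image_of_mem (jack κ) hμ))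
      (h1 (jack_sub_mem hκ μ))
    rwa [sub_sub_cancel] at h2

theorem linearIndependent_jack {n : ℕ} {κ : ℝ} (hκ : 0 ≤ κ) :
    LinearIndependent ℂ (jack κ : Part n → MvPolynomial (Fin n) ℂ) := by
  classical
  rw [linearIndependent_iff']
  intro s g hg
  by_contra! H
  obtain ⟨i₀, hi₀, hgi₀⟩ := H
  obtain ⟨i, hi, hmax⟩ := Finset.exists_max_image (s.filter fun i => g i ≠ 0)
    (fun i => domRank i.1) ⟨i₀, Finset.mem_filter.2 ⟨hi₀, hgi₀⟩⟩
  rw [Finset.mem_filter] at hi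
  have h := congrArg (cf i.1) hg
  rw [map_sum, map_zero, Finset.sum_eq_single i] at h
  · rw [map_smul, cf_jack hκ, smul_eq_mul, mul_one] at h
    exact hi.2 h
  · intro j hj hji
    rw [map_smul, smul_eq_mul]
    by_contra hne
    obtain ⟨h1, h2⟩ := mul_ne_zero_iff.1 hne
    have hb := mem_belowSub.1 (jack_mem_belowSub hκ j) _ h2
    have := (hb.domLT fun e => hji (Subtype.ext e.symm)).domRank_lt
    exact absurd (hmax j (Finset.mem_filter.2 ⟨hj, h1⟩)) (not_le.2 this)
  · intro h; exact absurd hi.1 h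

theorem symSub_le_span_jack {n : ℕ} {κ : ℝ} (hκ : 0 ≤ κ) :
    symSub n ≤ Submodule.span ℂ (Set.range (jack κ)) := by
  intro f hf
  refine Submodule.span_le.2 ?_ (mem_span_monomialSymm hf)
  rintro _ ⟨μ, hμ, _, rfl⟩
  have h1 := jack_sub_mem hκ ⟨μ, hμ⟩
  have h2 := Submodule.span_mono (Set.image_subset_range _ _) (domSpan_le_span_jack hκ _ h1)
  have h3 := sub_mem (Submodule.subset_span (Set.mem_range_self (f := jack κ) ⟨μ, hμ⟩)) h2
  rwa [sub_sub_cancel] at h3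

/-- The Jack polynomials as a basis of the space of symmetric polynomials. -/
def jackBasis {n : ℕ} {κ : ℝ} (hκ : 0 ≤ κ) : Module.Basis (Part n) ℂ (symSub n) :=
  Module.Basis.mk (v := fun lam => ⟨jack κ lam, jack_mem_symSub hκ lam⟩)
    (LinearIndependent.of_comp (symSub n).subtype (linearIndependent_jack hκ)) (by
      rintro ⟨f, hf⟩ _
      have h := symSub_le_span_jack hκ hf
      have e : Set.range (jack κ : Part n → MvPolynomial (Fin n) ℂ) = (symSub n).subtype ''
          Set.range fun lam => (⟨jack κ lam, jack_mem_symSub hκ lam⟩ : symSub n) := by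
        rw [← Set.range_comp]; rfl
      rw [e, ← Submodule.map_span] at h
      obtain ⟨x, hx, hxf⟩ := h
      have : x = ⟨f, hf⟩ := Subtype.ext hxf
      rwa [← this])

theorem jackBasis_apply {n : ℕ} {κ : ℝ} (hκ : 0 ≤ κ) (lam : Part n) :
    (jackBasis hκ lam : MvPolynomial (Fin n) ℂ) = jack κ lam := by
  rw [jackBasis, Module.Basis.mk_apply]

/-! ### Multiplication by `p_1` and `∑ ∂_i` on symmetric polynomials -/

/-- The symmetrization `f ↦ ∑_w w f`. -/
def symmetrize {n : ℕ} : MvPolynomial (Fin n) ℂ →ₗ[ℂ] symSub n :=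
  LinearMap.codRestrict (symSub n) (∑ w : Perm (Fin n), permOp w) (fun f => by
    rw [mem_symSub]
    intro v
    rw [LinearMap.sum_apply, map_sum, ← Equiv.sum_comp (Equiv.mulLeft v) fun w => permOp w f]
    refine Finset.sum_congr rfl fun w _ => ?_
    rw [← permOp_apply, ← Module.End.mul_apply, ← map_mul]
    rfl)

theorem coe_symmetrize {n : ℕ} (f : MvPolynomial (Fin n) ℂ) :
    (symmetrize f : MvPolynomial (Fin n) ℂ) = ∑ w : Perm (Fin n), permOp w f := by
  rw [symmetrize, LinearMap.codRestrict_apply, LinearMap.sum_apply]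

theorem symmetrize_permOp {n : ℕ} (v : Perm (Fin n)) (f : MvPolynomial (Fin n) ℂ) :
    symmetrize (permOp v f) = symmetrize f := by
  apply Subtype.ext
  rw [coe_symmetrize, coe_symmetrize, ← Equiv.sum_comp (Equiv.mulRight v) fun w => permOp w f]
  refine Finset.sum_congr rfl fun w _ => ?_
  rw [← Module.End.mul_apply, ← map_mul]
  rfl

/-- The operator `∏ (u + ξ_i)` on symmetric polynomials. -/
def genS {n : ℕ} (c u : ℂ) : symSub n →ₗ[ℂ] symSub n :=
  (genOp c u).restrict fun _ hf => genOp_mem_symSub c u hf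

theorem symmetrize_genOp {n : ℕ} (c u : ℂ) (f : MvPolynomial (Fin n) ℂ) :
    symmetrize (genOp c u f) = genS c u (symmetrize f) := by
  apply Subtype.ext
  rw [genS, LinearMap.coe_restrict_apply, coe_symmetrize, coe_symmetrize, map_sum]
  refine Finset.sum_congr rfl fun w _ => ?_
  rw [← Module.End.mul_apply, permOp_commute_genOp, Module.End.mul_apply]

theorem sum_X_mem {n : ℕ} : (∑ i, X i : MvPolynomial (Fin n) ℂ) ∈ symSub n := by
  rw [mem_symSub]
  intro w
  rw [map_sum, ← Equiv.sum_comp w fun i => (X i : MvPolynomial (Fin n) ℂ)]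
  exact Finset.sum_congr rfl fun i _ => rename_X _ _

theorem mul_mem_symSub {n : ℕ} {f g : MvPolynomial (Fin n) ℂ} (hf : f ∈ symSub n)
    (hg : g ∈ symSub n) : f * g ∈ symSub n := by
  rw [mem_symSub] at *
  intro w
  rw [map_mul, hf, hg]

/-- Multiplication by `p_1 = ∑ x_i` on symmetric polynomials. -/
def p1S {n : ℕ} : symSub n →ₗ[ℂ] symSub n :=
  (LinearMap.mulLeft ℂ (∑ i, X i)).restrict fun _ hf => mul_mem_symSub sum_X_mem hf

theorem sum_pderiv_mem {n : ℕ} {f : MvPolynomial (Fin n) ℂ} (hf : f ∈ symSub n) :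
    ∑ i, pderiv i f ∈ symSub n := by
  rw [mem_symSub]
  intro w
  rw [map_sum, ← Equiv.sum_comp w fun i => pderiv i f]
  exact Finset.sum_congr rfl fun i _ => rename_pderiv_of_sym hf w i

/-- The operator `∑ ∂_i` on symmetric polynomials. -/
def e0S {n : ℕ} : symSub n →ₗ[ℂ] symSub n where
  toFun f := ⟨∑ i, pderiv i (f : MvPolynomial (Fin n) ℂ), sum_pderiv_mem f.2⟩
  map_add' f g := Subtype.ext (by simp [Finset.sum_add_distrib])
  map_smul' a f := Subtype.ext (by simp [Finset.smul_sum])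

theorem coe_p1S {n : ℕ} (f : symSub n) :
    (p1S f : MvPolynomial (Fin n) ℂ) = (∑ i, X i) * (f : MvPolynomial (Fin n) ℂ) := rfl

theorem coe_e0S {n : ℕ} (f : symSub n) :
    (e0S f : MvPolynomial (Fin n) ℂ) = ∑ i, pderiv i (f : MvPolynomial (Fin n) ℂ) := rfl

theorem e0S_p1S {n : ℕ} (f : symSub n) : e0S (p1S f) = p1S (e0S f) + (n : ℂ) • f := by
  apply Subtype.ext
  have h : ∀ i : Fin n, pderiv i (∑ j, X j : MvPolynomial (Fin n) ℂ) = 1 := by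
    intro i
    rw [map_sum, Finset.sum_eq_single i (fun j _ hj => pderiv_X_of_ne hj)
      (by simp), pderiv_X_self]
  rw [coe_e0S, coe_p1S, Submodule.coe_add, coe_p1S, coe_e0S, Submodule.coe_smul, Finset.mul_sum]
  rw [Finset.sum_congr rfl fun i _ => by
    rw [Derivation.leibniz, h i, smul_eq_mul, smul_eq_mul, mul_one], Finset.sum_add_distrib]
  simp [Finset.sum_const, nsmul_eq_mul, smul_eq_C_mul]

/-- If the function `i ↦ F i` is permuted by the symmetric group, the symmetrization of one of its
values is a multiple of the sum. -/
theorem symmetrize_orbit {n : ℕ} (F : Fin (n + 1) → MvPolynomial (Fin (n + 1)) ℂ)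
    (hF : ∀ w i, permOp w (F i) = F (w i)) (k : Fin (n + 1)) :
    ((n + 1 : ℕ) : ℂ) • (symmetrize (F k) : MvPolynomial (Fin (n + 1)) ℂ) =
      (Fintype.card (Perm (Fin (n + 1))) : ℂ) • ∑ i, F i := by
  have h1 : ∀ i, symmetrize (F i) = symmetrize (F k) := fun i => by
    rw [← symmetrize_permOp (swap i k) (F i), hF, swap_apply_left]
  have h2 : ∑ i, (symmetrize (F i) : MvPolynomial (Fin (n + 1)) ℂ) =
      ∑ w : Perm (Fin (n + 1)), ∑ i, F i := by
    simp only [coe_symmetrize, hF]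
    rw [Finset.sum_comm]
    exact Finset.sum_congr rfl fun w _ => Equiv.sum_comp w F
  rw [Finset.sum_congr rfl fun i _ => by rw [h1 i], Finset.sum_const, Finset.sum_const,
    Finset.card_univ, Finset.card_univ, Fintype.card_fin] at h2
  rw [Nat.cast_smul_eq_nsmul, Nat.cast_smul_eq_nsmul, h2]

/-- On symmetric polynomials, multiplication by `p_1` is the symmetrized raising intertwiner, up to
a nonzero factor. -/
theorem symmetrize_raiseOp {n : ℕ} (f : symSub (n + 1)) :
    ((n + 1 : ℕ) : ℂ) • symmetrize (raiseOp (f : MvPolynomial (Fin (n + 1)) ℂ)) =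
      (Fintype.card (Perm (Fin (n + 1))) : ℂ) • p1S f := by
  apply Subtype.ext
  have hf := mem_symSub.1 f.2
  have h := symmetrize_orbit (fun i => X i * (f : MvPolynomial (Fin (n + 1)) ℂ))
    (fun w i => by rw [permOp_apply, map_mul, rename_X, hf]) (Fin.last n)
  rw [Submodule.coe_smul, Submodule.coe_smul, coe_p1S, Finset.sum_mul, ← h, raiseOp,
    Module.End.mul_apply, mulX_apply, permOp_apply, hf]

/-- On symmetric polynomials, `∑ ∂_i` is the symmetrized lowering intertwiner, up to a nonzero
factor. -/
theorem symmetrize_lowerOp {n : ℕ} (c : ℂ) (f : symSub (n + 1)) :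
    ((n + 1 : ℕ) : ℂ) • symmetrize (lowerOp c (f : MvPolynomial (Fin (n + 1)) ℂ)) =
      (Fintype.card (Perm (Fin (n + 1))) : ℂ) • e0S f := by
  apply Subtype.ext
  have h := symmetrize_orbit (fun i => pderiv i (f : MvPolynomial (Fin (n + 1)) ℂ))
    (fun w i => rename_pderiv_of_sym f.2 w i) (Fin.last n)
  rw [Submodule.coe_smul, Submodule.coe_smul, coe_e0S, ← h, lowerOp,
    Module.End.mul_apply, symmetrize_permOp, dunkl_of_sym c f.2]

/-! ### Matrix elements of `p_1` and `∑ ∂_i` between Jack polynomials -/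

/-- The product `∏ (u + λ_i + c (n - i))`. -/
def genEig {n : ℕ} (c : ℂ) (lam : Fin n → ℕ) (u : ℂ) : ℂ := ∏ i, (u + spec c lam i)

theorem coord_genS {n : ℕ} {κ : ℝ} (hκ : 0 ≤ κ) (ν : Part n) (u : ℂ) (f : symSub n) :
    (jackBasis hκ).coord ν (genS (κ : ℂ) u f) =
      genEig (κ : ℂ) ν.1 u * (jackBasis hκ).coord ν f := by
  have : (jackBasis hκ).coord ν ∘ₗ genS (κ : ℂ) u =
      genEig (κ : ℂ) ν.1 u • (jackBasis hκ).coord ν := by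
    refine (jackBasis hκ).ext fun lam => ?_
    have h : genS (κ : ℂ) u (jackBasis hκ lam) = genEig (κ : ℂ) lam.1 u • jackBasis hκ lam := by
      apply Subtype.ext
      rw [genS, LinearMap.coe_restrict_apply, jackBasis_apply, genOp_jack hκ, Submodule.coe_smul,
        jackBasis_apply]
      rfl
    rw [LinearMap.comp_apply, h, map_smul, LinearMap.smul_apply, Module.Basis.coord_apply,
      Module.Basis.repr_self, Finsupp.single_apply]
    split_ifs with e
    · rw [e]
    · simp
  exact LinearMap.congr_fun this f

theorem genOp_commute_cherednik {n : ℕ} (c u : ℂ) (i : Fin n) (f : MvPolynomial (Fin n) ℂ) :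
    genOp c u (cherednik c i f) = cherednik c i (genOp c u f) := by
  rw [← cherednikHom_X, ← Module.End.mul_apply, ← Module.End.mul_apply, genOp, ← map_mul,
    ← map_mul, mul_comm]

/-- The relation between the spectra of two Jack polynomials that is forced by a nonzero matrix
element of `p_1`: the generating functions agree up to one linear factor, which is shifted by `1`.
It applies with `f` a Jack polynomial and `L` a coordinate of the symmetrization. -/
theorem exists_shift_of_raise {n : ℕ} {c : ℂ} {d δ : ℂ → ℂ}
    {L : MvPolynomial (Fin (n + 1)) ℂ →ₗ[ℂ] ℂ} {f : MvPolynomial (Fin (n + 1)) ℂ}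
    (hL : ∀ u g, L (genOp c u g) = d u * L g) (hf : ∀ u, genOp c u f = δ u • f)
    (h0 : L (raiseOp f) ≠ 0) : ∃ c₀ : ℂ, ∀ u, d u * (u + c₀) = δ u * (u + c₀ + 1) := by
  refine ⟨L (raiseOp (cherednik c 0 f)) / L (raiseOp f), fun u => ?_⟩
  have h := congrArg L (LinearMap.congr_fun (genOp_mul_raiseOp c u) f)
  simp only [Module.End.mul_apply, LinearMap.add_apply, LinearMap.smul_apply,
    Module.End.one_apply] at h
  rw [hL, map_add (genOp c u), genOp_commute_cherednik, map_smul (genOp c u), hf] at h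
  simp only [map_add, map_smul, smul_eq_mul] at h
  field_simp
  linear_combination h

/-- The analogue of `exists_shift_of_raise` for `∑ ∂_i`. -/
theorem exists_shift_of_lower {n : ℕ} {c : ℂ} {d δ : ℂ → ℂ}
    {L : MvPolynomial (Fin (n + 1)) ℂ →ₗ[ℂ] ℂ} {f : MvPolynomial (Fin (n + 1)) ℂ}
    (hL : ∀ u g, L (genOp c u g) = d u * L g) (hf : ∀ u, genOp c u f = δ u • f)
    (h0 : L (lowerOp c f) ≠ 0) : ∃ c₀ : ℂ, ∀ u, δ u * (u + c₀) = d u * (u + c₀ + 1) := by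
  refine ⟨L (lowerOp c (cherednik c (Fin.last n) f)) / L (lowerOp c f) - 1, fun u => ?_⟩
  have h := congrArg L (LinearMap.congr_fun (genOp_mul_lowerOp c u) f)
  simp only [Module.End.mul_apply, LinearMap.add_apply, LinearMap.smul_apply,
    Module.End.one_apply] at h
  rw [hL, map_add (genOp c u), genOp_commute_cherednik, map_smul (genOp c u), hf] at h
  simp only [map_add, map_smul, smul_eq_mul] at h
  field_simp
  linear_combination -h

theorem eq_add_single_of_le {n : ℕ} {lam ν : Fin n → ℕ} (h : lam ≤ ν)
    (hw : weight ν = weight lam + 1) : ∃ i, ν = lam + Pi.single i 1 := by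
  obtain ⟨i, hi⟩ : ∃ i, lam i < ν i := by
    by_contra! H
    have : ν = lam := le_antisymm H h
    rw [this] at hw; omega
  have hle : lam + Pi.single i 1 ≤ ν := by
    intro j
    by_cases hj : j = i
    · subst hj; simpa using hi
    · simpa [hj] using h j
  refine ⟨i, (le_antisymm hle ?_).symm⟩
  intro j
  by_contra! H
  have : weight (lam + Pi.single i 1) < weight ν :=
    Finset.sum_lt_sum (fun k _ => hle k) ⟨j, Finset.mem_univ j, H⟩
  have h2 : weight (lam + Pi.single i 1) = weight lam + 1 := by
    simp [weight, Finset.sum_add_distrib]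
  omega

/-- The spectral vector as a real vector. -/
def specR {n : ℕ} (κ : ℝ) (lam : Fin n → ℕ) (i : Fin n) : ℝ := lam i + κ * ((n : ℝ) - 1 - i)

theorem spec_eq {n : ℕ} (κ : ℝ) (lam : Fin n → ℕ) (i : Fin n) :
    spec (κ : ℂ) lam i = (specR κ lam i : ℂ) := by
  rw [spec, specR]; push_cast; ring

theorem specR_antitone {n : ℕ} {κ : ℝ} (hκ : 0 ≤ κ) {lam : Fin n → ℕ} (h : Antitone lam) :
    Antitone (specR κ lam) := by
  intro i j hij
  have h3 : (lam j : ℝ) ≤ lam i := by exact_mod_cast h hij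
  have h4 : (i : ℝ) ≤ j := by exact_mod_cast hij
  have : κ * ((n : ℝ) - 1 - j) ≤ κ * ((n : ℝ) - 1 - i) :=
    mul_le_mul_of_nonneg_left (by linarith) hκ
  rw [specR, specR]
  linarith

/-- A multiset `s` of complex numbers is determined by the polynomial `∏ (u + a)` over `a ∈ s`. -/
theorem multiset_eq_of_prod_eq {s t : Multiset ℂ}
    (h : ∀ u : ℂ, (s.map fun a => u + a).prod = (t.map fun a => u + a).prod) : s = t := by
  have key : ∀ s : Multiset ℂ, ((s.map Neg.neg).map fun a => Polynomial.X - Polynomial.C a).prod =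
      (s.map fun a => Polynomial.X + Polynomial.C a).prod := by
    intro s
    rw [Multiset.map_map]
    congr 1
    exact Multiset.map_congr rfl fun a _ => by simp
  have h1 : (s.map fun a => Polynomial.X + Polynomial.C a).prod =
      (t.map fun a => Polynomial.X + Polynomial.C a).prod := by
    refine Polynomial.funext fun u => ?_
    simpa [Polynomial.eval_multiset_prod, Multiset.map_map, Function.comp_def] using h u
  rw [← key, ← key] at h1
  have h2 := congrArg Polynomial.roots h1
  rw [Polynomial.roots_multiset_prod_X_sub_C, Polynomial.roots_multiset_prod_X_sub_C] at h2
  exact Multiset.map_injective neg_injective h2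

/-- If the spectrum of `ν` arises from that of `lam` by increasing one entry by `1`, then `ν` is
obtained from `lam` by adding one box. -/
theorem eq_add_single_of_genEig {n : ℕ} {κ : ℝ} (hκ : 0 ≤ κ) {lam ν : Part n} {c₀ : ℂ}
    (h : ∀ u, genEig (κ : ℂ) ν.1 u * (u + c₀) = genEig (κ : ℂ) lam.1 u * (u + c₀ + 1)) :
    ∃ i, ν.1 = lam.1 + Pi.single i 1 := by
  have hm : c₀ ::ₘ Finset.univ.val.map (spec (κ : ℂ) ν.1) =
      (c₀ + 1) ::ₘ Finset.univ.val.map (spec (κ : ℂ) lam.1) := by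
    refine multiset_eq_of_prod_eq fun u => ?_
    have := h u
    rw [genEig, genEig, Finset.prod, Finset.prod] at this
    simp only [Multiset.map_cons, Multiset.prod_cons, Multiset.map_map, Function.comp_def]
    linear_combination this
  have hm' := congrArg (Multiset.map Complex.re) hm
  simp only [Multiset.map_cons, Multiset.map_map, Function.comp_def, spec_eq, Complex.ofReal_re,
    Complex.add_re, Complex.one_re] at hm'
  -- Increasing one entry of the spectrum cannot lower the number of entries above a threshold; as
  -- the spectra are sorted, this bounds the entries of `lam` by those of `ν` one by one.
  have hcount : ∀ t : ℝ, (Finset.univ.filter fun i => t ≤ specR κ lam.1 i).card ≤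
      (Finset.univ.filter fun i => t ≤ specR κ ν.1 i).card := by
    intro t
    have h1 := congrArg (Multiset.countP fun a => t ≤ a) hm'
    simp only [Multiset.countP_cons, Multiset.countP_map] at h1
    rw [Finset.card_def, Finset.card_def, Finset.filter_val, Finset.filter_val]
    split_ifs at h1 with h2 h3
    · omega
    · linarith
    · omega
    · omega
  have hle : lam.1 ≤ ν.1 := by
    intro k
    by_contra! H
    have hlt : specR κ ν.1 k < specR κ lam.1 k := by
      rw [specR, specR]
      have : (ν.1 k : ℝ) < lam.1 k := by exact_mod_cast H
      linarith
    have h1 : (Finset.Iic k).card ≤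
        (Finset.univ.filter fun i => specR κ lam.1 k ≤ specR κ lam.1 i).card := by
      refine Finset.card_le_card fun i hi => ?_
      simpa using specR_antitone hκ lam.2 (Finset.mem_Iic.1 hi)
    have h2 : (Finset.univ.filter fun i => specR κ lam.1 k ≤ specR κ ν.1 i).card ≤
        (Finset.Iio k).card := by
      refine Finset.card_le_card fun i hi => ?_
      rw [Finset.mem_Iio]
      by_contra! hik
      have h3 := specR_antitone hκ ν.2 hik
      have h4 := (Finset.mem_filter.1 hi).2
      linarith
    have h3 := hcount (specR κ lam.1 k)
    rw [Fin.card_Iic] at h1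
    rw [Fin.card_Iio] at h2
    omega
  refine eq_add_single_of_le hle ?_
  have hs := congrArg Multiset.sum hm'
  simp only [Multiset.sum_cons] at hs
  change _ + ∑ i, specR κ ν.1 i = _ + ∑ i, specR κ lam.1 i at hs
  simp only [specR, Finset.sum_add_distrib] at hs
  have : (∑ i, (ν.1 i : ℝ)) = ∑ i, (lam.1 i : ℝ) + 1 := by linarith
  exact_mod_cast this

/-- The Pieri rule: `p_1 P_λ` is a combination of the `P_ν` with `ν` obtained from `λ` by adding
one box. -/
theorem coord_p1S {n : ℕ} {κ : ℝ} (hκ : 0 ≤ κ) {lam ν : Part n}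
    (h : (jackBasis hκ).coord ν (p1S (jackBasis hκ lam)) ≠ 0) :
    ∃ i, ν.1 = lam.1 + Pi.single i 1 := by
  rcases n with _ | n
  · have : p1S (jackBasis hκ lam) = 0 := Subtype.ext (by rw [coe_p1S]; simp)
    rw [this, map_zero] at h
    exact absurd rfl h
  · have h1 := congrArg ((jackBasis hκ).coord ν) (symmetrize_raiseOp (jackBasis hκ lam))
    rw [map_smul, map_smul, jackBasis_apply] at h1
    have hc : (Fintype.card (Perm (Fin (n + 1))) : ℂ) ≠ 0 :=
      Nat.cast_ne_zero.2 Fintype.card_ne_zero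
    obtain ⟨c₀, hc₀⟩ := exists_shift_of_raise (c := (κ : ℂ)) (d := genEig (κ : ℂ) ν.1)
      (δ := genEig (κ : ℂ) lam.1) (L := (jackBasis hκ).coord ν ∘ₗ symmetrize) (f := jack κ lam)
      (fun u g => by
        rw [LinearMap.comp_apply, symmetrize_genOp, coord_genS]; rfl)
      (fun u => genOp_jack hκ lam u) (fun H => by
        rw [LinearMap.comp_apply] at H
        rw [H, smul_zero] at h1
        exact smul_ne_zero hc h h1.symm)
    exact eq_add_single_of_genEig hκ hc₀

/-- `∑ ∂_i P_λ` is a combination of the `P_ν` with `ν` obtained from `λ` by removing one box. -/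
theorem coord_e0S {n : ℕ} {κ : ℝ} (hκ : 0 ≤ κ) {lam ν : Part n}
    (h : (jackBasis hκ).coord ν (e0S (jackBasis hκ lam)) ≠ 0) :
    ∃ i, lam.1 = ν.1 + Pi.single i 1 := by
  rcases n with _ | n
  · have : e0S (jackBasis hκ lam) = 0 := Subtype.ext (by rw [coe_e0S]; simp)
    rw [this, map_zero] at h
    exact absurd rfl h
  · have h1 := congrArg ((jackBasis hκ).coord ν) (symmetrize_lowerOp (κ : ℂ) (jackBasis hκ lam))
    rw [map_smul, map_smul, jackBasis_apply] at h1
    have hc : (Fintype.card (Perm (Fin (n + 1))) : ℂ) ≠ 0 :=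
      Nat.cast_ne_zero.2 Fintype.card_ne_zero
    obtain ⟨c₀, hc₀⟩ := exists_shift_of_lower (c := (κ : ℂ)) (d := genEig (κ : ℂ) ν.1)
      (δ := genEig (κ : ℂ) lam.1) (L := (jackBasis hκ).coord ν ∘ₗ symmetrize) (f := jack κ lam)
      (fun u g => by
        rw [LinearMap.comp_apply, symmetrize_genOp, coord_genS]; rfl)
      (fun u => genOp_jack hκ lam u) (fun H => by
        rw [LinearMap.comp_apply] at H
        rw [H, smul_zero] at h1
        exact smul_ne_zero hc h h1.symm)
    exact eq_add_single_of_genEig hκ hc₀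

/-! ### The components of `p_1` that add a box in a given row -/

theorem single_add_single_ne {n : ℕ} {j k l l' : Fin n} (hjk : j ≠ k) (hlj : l ≠ j) :
    (Pi.single j 1 + Pi.single l' 1 : Fin n → ℕ) ≠ Pi.single k 1 + Pi.single l 1 := by
  intro h
  have := congrFun h j
  simp [Pi.single_apply, hjk, hlj.symm] at this

theorem add_single_injective {n : ℕ} {lam : Fin n → ℕ} {j k : Fin n}
    (h : lam + Pi.single j 1 = lam + Pi.single k 1) : j = k := by
  by_contra hjk
  have := congrFun (add_left_cancel h) j
  simp [hjk] at this

theorem mem_span_jack_iff {n : ℕ} {κ : ℝ} (hκ : 0 ≤ κ) {s : Set (Part n)} {f : symSub n} :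
    f ∈ Submodule.span ℂ (jackBasis hκ '' s) ↔ ∀ ν, (jackBasis hκ).coord ν f ≠ 0 → ν ∈ s := by
  rw [Module.Basis.mem_span_image]
  simp only [Set.subset_def, Finset.mem_coe, Finsupp.mem_support_iff, Module.Basis.coord_apply]

theorem coord_jackBasis {n : ℕ} {κ : ℝ} (hκ : 0 ≤ κ) (ν lam : Part n) :
    (jackBasis hκ).coord ν (jackBasis hκ lam) = if lam = ν then 1 else 0 := by
  classical
  rw [Module.Basis.coord_apply, Module.Basis.repr_self, Finsupp.single_apply]

theorem ext_coord {n : ℕ} {κ : ℝ} (hκ : 0 ≤ κ) {f g : symSub n}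
    (h : ∀ ν, (jackBasis hκ).coord ν f = (jackBasis hκ).coord ν g) : f = g :=
  (jackBasis hκ).repr.injective (Finsupp.ext h)

open scoped Classical in
/-- The part of multiplication by `p_1` that adds a box in row `j`, relative to the basis of Jack
polynomials. -/
def rowUp {n : ℕ} {κ : ℝ} (hκ : 0 ≤ κ) (j : Fin n) : symSub n →ₗ[ℂ] symSub n :=
  (jackBasis hκ).constr ℂ fun σ =>
    if h : Antitone (σ.1 + Pi.single j 1) then
      (jackBasis hκ).coord ⟨_, h⟩ (p1S (jackBasis hκ σ)) • jackBasis hκ ⟨_, h⟩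
    else 0

theorem rowUp_of_antitone {n : ℕ} {κ : ℝ} (hκ : 0 ≤ κ) {j : Fin n} {σ ν : Part n}
    (h : ν.1 = σ.1 + Pi.single j 1) : rowUp hκ j (jackBasis hκ σ) =
      (jackBasis hκ).coord ν (p1S (jackBasis hκ σ)) • jackBasis hκ ν := by
  obtain ⟨ν, hν⟩ := ν
  subst h
  rw [rowUp, Module.Basis.constr_basis, dif_pos hν]

theorem rowUp_of_not_antitone {n : ℕ} {κ : ℝ} (hκ : 0 ≤ κ) {j : Fin n} {σ : Part n}
    (h : ¬ Antitone (σ.1 + Pi.single j 1)) : rowUp hκ j (jackBasis hκ σ) = 0 := by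
  rw [rowUp, Module.Basis.constr_basis, dif_neg h]

theorem coord_rowUp {n : ℕ} {κ : ℝ} (hκ : 0 ≤ κ) (j : Fin n) (σ ν : Part n) :
    (jackBasis hκ).coord ν (rowUp hκ j (jackBasis hκ σ)) =
      if ν.1 = σ.1 + Pi.single j 1 then (jackBasis hκ).coord ν (p1S (jackBasis hκ σ)) else 0 := by
  by_cases h : Antitone (σ.1 + Pi.single j 1)
  · rw [rowUp_of_antitone hκ (ν := ⟨_, h⟩) rfl, map_smul, coord_jackBasis]
    by_cases e : ν.1 = σ.1 + Pi.single j 1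
    · have : ν = ⟨_, h⟩ := Subtype.ext e
      rw [if_pos this.symm, if_pos e, ← this, smul_eq_mul, mul_one]
    · rw [if_neg e, if_neg (fun e' => e (congrArg Subtype.val e').symm), smul_zero]
  · rw [rowUp_of_not_antitone hκ h, map_zero, if_neg]
    rintro e
    exact h (e ▸ ν.2)

theorem sum_rowUp {n : ℕ} {κ : ℝ} (hκ : 0 ≤ κ) (f : symSub n) :
    ∑ j, rowUp hκ j f = p1S f := by
  have : (∑ j : Fin n, rowUp hκ j) = p1S := by
    refine (jackBasis hκ).ext fun σ => ext_coord hκ fun ν => ?_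
    rw [LinearMap.sum_apply, map_sum]
    simp only [coord_rowUp]
    by_cases h : (jackBasis hκ).coord ν (p1S (jackBasis hκ σ)) = 0
    · simp [h]
    · obtain ⟨i, hi⟩ := coord_p1S hκ h
      rw [Finset.sum_eq_single i, if_pos hi]
      · intro j _ hj
        rw [if_neg]
        intro e
        exact hj (add_single_injective (e.symm.trans hi))
      · simp
  rw [← this, LinearMap.sum_apply]

/-- The commutator of `∑ ∂_i` with the component of `p_1` adding a box in row `j` is diagonal: an
off-diagonal matrix element would contribute to the commutator of `∑ ∂_i` with `p_1`, which is a
scalar. -/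
theorem coord_e0S_rowUp {n : ℕ} {κ : ℝ} (hκ : 0 ≤ κ) (j : Fin n) {σ τ : Part n}
    (h : (jackBasis hκ).coord τ
      (e0S (rowUp hκ j (jackBasis hκ σ)) - rowUp hκ j (e0S (jackBasis hκ σ))) ≠ 0) : τ = σ := by
  set c : Fin n → ℂ := fun k => (jackBasis hκ).coord τ
      (e0S (rowUp hκ k (jackBasis hκ σ)) - rowUp hκ k (e0S (jackBasis hκ σ))) with hc
  -- Both orders of the two operators add a box in row `k` and remove one.
  have hk : ∀ k, c k ≠ 0 → ∃ l, σ.1 + Pi.single k 1 = τ.1 + Pi.single l 1 := by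
    intro k hck
    by_contra H
    apply hck
    simp only [hc]
    rw [map_sub]
    have h1 : (jackBasis hκ).coord τ (e0S (rowUp hκ k (jackBasis hκ σ))) = 0 := by
      by_cases hA : Antitone (σ.1 + Pi.single k 1)
      · rw [rowUp_of_antitone hκ (ν := ⟨_, hA⟩) rfl, map_smul, map_smul]
        by_contra hne
        exact H (coord_e0S hκ (fun e => hne (by rw [e, smul_zero])))
      · rw [rowUp_of_not_antitone hκ hA, map_zero, map_zero]
    have h2 : (jackBasis hκ).coord τ (rowUp hκ k (e0S (jackBasis hκ σ))) = 0 := by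
      conv_lhs => rw [← (jackBasis hκ).linearCombination_repr (e0S (jackBasis hκ σ)),
        Finsupp.linearCombination_apply, Finsupp.sum, map_sum, map_sum]
      refine Finset.sum_eq_zero fun ρ hρ => ?_
      rw [map_smul, map_smul, coord_rowUp]
      split_ifs with e
      · obtain ⟨l, hl⟩ := coord_e0S hκ (Finsupp.mem_support_iff.1 hρ)
        exact absurd ⟨l, by rw [e, hl]; exact add_right_comm _ _ _⟩ H
      · rw [smul_zero]
    rw [h1, h2, sub_zero]
  by_contra hne
  obtain ⟨l, hl⟩ := hk j h
  have hlj : l ≠ j := by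
    rintro rfl
    exact hne (Subtype.ext (add_right_cancel hl).symm)
  -- An off-diagonal `τ` determines the row `j` in which a box is added to reach it from `σ`.
  have h0 : ∀ k, k ≠ j → c k = 0 := by
    intro k hkj
    by_contra hck
    obtain ⟨l', hl'⟩ := hk k hck
    apply single_add_single_ne (l' := l') hkj.symm hlj
    have : τ.1 + (Pi.single j 1 + Pi.single l' 1) = τ.1 + (Pi.single k 1 + Pi.single l 1) := by
      rw [add_comm (Pi.single j 1), ← add_assoc, ← hl', add_comm (Pi.single k 1), ← add_assoc, ← hl]
      exact add_right_comm _ _ _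
    exact add_left_cancel this
  have hsum : ∑ k, c k = 0 := by
    simp only [hc]
    rw [← map_sum, Finset.sum_sub_distrib, ← map_sum, sum_rowUp, sum_rowUp, e0S_p1S,
      add_sub_cancel_left, map_smul, coord_jackBasis, if_neg (fun e => hne e.symm), smul_zero]
  rw [Finset.sum_eq_single j (fun k _ hkj => h0 k hkj) (by simp)] at hsum
  exact h hsum

/-! ### The operator `D^B` on symmetric polynomials -/

theorem eulerP_mem_symSub {n : ℕ} {f : MvPolynomial (Fin n) ℂ} (hf : f ∈ symSub n) :
    eulerP f ∈ symSub n := by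
  rw [mem_symSub]
  intro w
  rw [eulerP, map_sum, ← Equiv.sum_comp w fun i => X i * pderiv i f]
  exact Finset.sum_congr rfl fun i _ => by rw [map_mul, rename_X, rename_pderiv_of_sym hf]

/-- The operator `D_2 + a E_1` on symmetric polynomials. -/
def diagS {n : ℕ} (κ a : ℝ) : symSub n →ₗ[ℂ] symSub n where
  toFun f := ⟨jackP (κ : ℂ) (f : MvPolynomial (Fin n) ℂ) + (a : ℂ) • eulerP f,
    add_mem (jackP_mem_symSub _ f.2) (Submodule.smul_mem _ _ (eulerP_mem_symSub f.2))⟩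
  map_add' f g := Subtype.ext (by
    simp only [eulerP, Submodule.coe_add, map_add, mul_add, Finset.sum_add_distrib, smul_add]
    abel)
  map_smul' s f := Subtype.ext (by
    simp only [eulerP, SetLike.val_smul, map_smul, mul_smul_comm, ← Finset.smul_sum,
      RingHom.id_apply, smul_add, Derivation.map_smul]
    rw [smul_comm])

/-- The operator `D^B` on symmetric polynomials. -/
def besselS {n : ℕ} (κ a : ℝ) : symSub n →ₗ[ℂ] symSub n := diagS κ a + (2 : ℂ) • e0S

/-- The eigenvalue of `D^B` on the Bessel polynomial of `lam`. -/
def besselEig {n : ℕ} (κ a : ℝ) (lam : Fin n → ℕ) : ℝ := jackEig κ lam + a * weight lam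

theorem diagS_jack {n : ℕ} {κ : ℝ} (hκ : 0 ≤ κ) (a : ℝ) (lam : Part n) :
    diagS κ a (jackBasis hκ lam) = (besselEig κ a lam.1 : ℂ) • jackBasis hκ lam := by
  apply Subtype.ext
  change jackP (κ : ℂ) (jackBasis hκ lam : MvPolynomial (Fin n) ℂ) +
    (a : ℂ) • eulerP (jackBasis hκ lam : MvPolynomial (Fin n) ℂ) = _
  rw [Submodule.coe_smul, jackBasis_apply, jackP_jack hκ,
    eulerP_belowSub (jack_mem_belowSub hκ lam), besselEig, smul_smul, ← add_smul]
  push_cast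
  rfl

theorem besselS_apply {n : ℕ} (κ a : ℝ) (f : symSub n) :
    besselS κ a f = diagS κ a f + (2 : ℂ) • e0S f := rfl

/-- Adding a box changes the eigenvalue by an amount that depends on its content. -/
theorem besselEig_add_single {n : ℕ} (κ a : ℝ) (σ : Fin n → ℕ) (j : Fin n) :
    besselEig κ a (σ + Pi.single j 1) = besselEig κ a σ + 2 * specR κ σ j + a := by
  have h1 : weight (σ + Pi.single j 1) = weight σ + 1 := by
    simp [weight, Finset.sum_add_distrib]
  have h2 : jackEig κ (σ + Pi.single j 1) - jackEig κ σ = 2 * specR κ σ j := by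
    rw [jackEig, jackEig, ← Finset.sum_sub_distrib, Finset.sum_eq_single j]
    · simp only [Pi.add_apply, Pi.single_eq_same, specR]; push_cast; ring
    · intro k _ hk
      simp [hk]
    · simp
  rw [besselEig, besselEig, h1]
  push_cast
  linarith

/-- The span of the Jack polynomials of the partitions contained in `μ`. -/
def lowSpan {n : ℕ} {κ : ℝ} (hκ : 0 ≤ κ) (μ : Part n) : Submodule ℂ (symSub n) :=
  Submodule.span ℂ (jackBasis hκ '' Set.Iic μ)

theorem lowSpan_mono {n : ℕ} {κ : ℝ} (hκ : 0 ≤ κ) {μ ν : Part n} (h : μ ≤ ν) :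
    lowSpan hκ μ ≤ lowSpan hκ ν :=
  Submodule.span_mono (Set.image_mono (Set.Iic_subset_Iic.2 h))

theorem jackBasis_mem_lowSpan {n : ℕ} {κ : ℝ} (hκ : 0 ≤ κ) {μ ν : Part n} (h : μ ≤ ν) :
    jackBasis hκ μ ∈ lowSpan hκ ν := Submodule.subset_span ⟨μ, h, rfl⟩

/-- Up to terms in the span of the Jack polynomials of the partitions contained in `μ`, adding a
box in row `j` maps an eigenfunction of `D^B` with leading term `P_μ` to an eigenfunction. -/
theorem besselS_rowUp {n : ℕ} {κ : ℝ} (hκ : 0 ≤ κ) (a : ℝ) (μ : Part n) (j : Fin n) {y : symSub n}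
    (hy : y ∈ lowSpan hκ μ) (hD : besselS κ a y = (besselEig κ a μ.1 : ℂ) • y) :
    besselS κ a (rowUp hκ j y) -
      ((besselEig κ a μ.1 + 2 * specR κ μ.1 j + a : ℝ) : ℂ) • rowUp hκ j y ∈ lowSpan hκ μ := by
  -- For `z = P_σ` the operator `D_2 + a E_1` produces the content of the box added to `σ` instead
  -- of `μ`; these agree if rows `j` of `σ` and `μ` do, and otherwise the new diagram stays in `μ`.
  have key : ∀ z ∈ lowSpan hκ μ, besselS κ a (rowUp hκ j z) - rowUp hκ j (besselS κ a z) -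
      ((2 * specR κ μ.1 j + a : ℝ) : ℂ) • rowUp hκ j z ∈ lowSpan hκ μ := by
    intro z hz
    induction hz using Submodule.span_induction with
    | mem x hx =>
      obtain ⟨σ, hσ, rfl⟩ := hx
      have hcomm : e0S (rowUp hκ j (jackBasis hκ σ)) - rowUp hκ j (e0S (jackBasis hκ σ)) ∈
          lowSpan hκ μ := by
        refine lowSpan_mono hκ hσ ((mem_span_jack_iff hκ).2 fun τ hτ => ?_)
        exact (coord_e0S_rowUp hκ j hτ).le
      have hdiag : diagS κ a (rowUp hκ j (jackBasis hκ σ)) =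
          ((besselEig κ a σ.1 + 2 * specR κ σ.1 j + a : ℝ) : ℂ) • rowUp hκ j (jackBasis hκ σ) := by
        by_cases hA : Antitone (σ.1 + Pi.single j 1)
        · rw [rowUp_of_antitone hκ (ν := ⟨_, hA⟩) rfl, map_smul, diagS_jack, smul_comm,
            besselEig_add_single]
        · rw [rowUp_of_not_antitone hκ hA, map_zero, smul_zero]
      have hrest : ((2 * specR κ σ.1 j - 2 * specR κ μ.1 j : ℝ) : ℂ) • rowUp hκ j (jackBasis hκ σ) ∈
          lowSpan hκ μ := by
        by_cases hA : Antitone (σ.1 + Pi.single j 1)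
        · rcases (hσ j).lt_or_eq with hlt | heq
          · rw [rowUp_of_antitone hκ (ν := ⟨_, hA⟩) rfl]
            refine Submodule.smul_mem _ _ (Submodule.smul_mem _ _ (jackBasis_mem_lowSpan hκ ?_))
            intro k
            by_cases hk : k = j
            · subst hk; simpa using hlt
            · simpa [hk] using hσ k
          · have h0 : (2 * specR κ σ.1 j - 2 * specR κ μ.1 j : ℝ) = 0 := by
              rw [specR, specR, heq]; ring
            rw [h0, Complex.ofReal_zero, zero_smul]
            exact zero_mem _
        · rw [rowUp_of_not_antitone hκ hA, smul_zero]
          exact zero_mem _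
      have := add_mem (Submodule.smul_mem _ (2 : ℂ) hcomm) hrest
      rw [besselS_apply, besselS_apply, hdiag, diagS_jack, map_add, map_smul, map_smul]
      convert this using 1
      push_cast
      module
    | zero => simp
    | add x y _ _ hx hy =>
      simp only [map_add, smul_add]
      convert add_mem hx hy using 1
      module
    | smul s x _ hx =>
      simp only [map_smul]
      convert Submodule.smul_mem _ s hx using 1
      module
  have h := key y hy
  rw [hD, map_smul] at h
  convert h using 1
  push_cast
  module

/-! ### Every nonempty diagram is reached by adding a box -/

/-- The operator `∑ x_i² ∂_i` on symmetric polynomials. -/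
def euler2S {n : ℕ} : symSub n →ₗ[ℂ] symSub n where
  toFun f := ⟨∑ i, X i ^ 2 * pderiv i (f : MvPolynomial (Fin n) ℂ), by
    rw [mem_symSub]
    intro w
    rw [map_sum, ← Equiv.sum_comp w fun i => X i ^ 2 * pderiv i (f : MvPolynomial (Fin n) ℂ)]
    exact Finset.sum_congr rfl fun i _ => by
      rw [map_mul, map_pow, rename_X, rename_pderiv_of_sym f.2]⟩
  map_add' f g := Subtype.ext (by simp [Finset.sum_add_distrib, mul_add])
  map_smul' a f := Subtype.ext (by simp [Finset.smul_sum])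

theorem coe_euler2S {n : ℕ} (f : symSub n) : (euler2S f : MvPolynomial (Fin n) ℂ) =
    ∑ i, X i ^ 2 * pderiv i (f : MvPolynomial (Fin n) ℂ) := rfl

theorem rename_sum_X {n : ℕ} (w : Perm (Fin n)) :
    rename w (∑ k, X k : MvPolynomial (Fin n) ℂ) = ∑ k, X k := mem_symSub.1 sum_X_mem w

theorem pderiv_sum_X {n : ℕ} (i : Fin n) : pderiv i (∑ k, X k : MvPolynomial (Fin n) ℂ) = 1 := by
  rw [map_sum, Finset.sum_eq_single i (fun j _ hj => pderiv_X_of_ne hj) (by simp), pderiv_X_self]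

theorem dunkl_sum_X_mul {n : ℕ} (c : ℂ) (i : Fin n) (f : MvPolynomial (Fin n) ℂ) :
    dunkl c i ((∑ k, X k) * f) = (∑ k, X k) * dunkl c i f + f := by
  have h : ∀ j ∈ Finset.univ.erase i, divDiff i j ((∑ k, X k) * f) =
      (∑ k, X k) * divDiff i j f := by
    intro j hj
    have hij := (Finset.ne_of_mem_erase hj).symm
    apply divDiff_eq hij
    rw [map_mul, rename_sum_X]
    linear_combination (∑ k, X k) * sub_mul_divDiff hij f
  rw [dunkl_apply, dunkl_apply, Finset.sum_congr rfl h, ← Finset.mul_sum, Derivation.leibniz,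
    pderiv_sum_X, smul_eq_mul, smul_eq_mul, mul_add, mul_smul_comm]
  ring

theorem dunkl_X_mul_of_sym {n : ℕ} (c : ℂ) {f : MvPolynomial (Fin n) ℂ} (hf : f ∈ symSub n)
    (i : Fin n) : dunkl c i (X i * f) = X i * pderiv i f + (1 + c * ((n : ℂ) - 1)) • f := by
  have h := LinearMap.congr_fun (dunkl_mul_mulX_self c i) f
  have h2 : ∑ j ∈ Finset.univ.erase i, permOp (swap i j) f = ∑ j ∈ Finset.univ.erase i, f :=
    Finset.sum_congr rfl fun j _ => mem_symSub.1 hf (swap i j)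
  rw [Module.End.mul_apply, mulX_apply] at h
  rw [h, LinearMap.add_apply, LinearMap.add_apply, Module.End.mul_apply, mulX_apply,
    dunkl_of_sym c hf, LinearMap.smul_apply, LinearMap.sum_apply, h2, Finset.sum_const,
    Finset.card_erase_of_mem (Finset.mem_univ i), Finset.card_univ, Fintype.card_fin,
    ← Nat.cast_smul_eq_nsmul ℂ, smul_smul, Nat.cast_sub (by have := i.2; omega), Nat.cast_one,
    Module.End.one_apply, add_smul, one_smul]
  abel

/-- The commutator of `D_2` and `p_1`. -/
theorem jackP_sum_X_mul {n : ℕ} (c : ℂ) {f : MvPolynomial (Fin n) ℂ} (hf : f ∈ symSub n) :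
    jackP c ((∑ k, X k) * f) = (∑ k, X k) * jackP c f + (2 : ℂ) • ∑ i, X i ^ 2 * pderiv i f +
      (2 * c * ((n : ℂ) - 1)) • ((∑ k, X k) * f) := by
  have h1 : ∀ i : Fin n, X i * pderiv i ((∑ k, X k) * f) =
      (∑ k, X k) * (X i * pderiv i f) + X i * f := by
    intro i
    rw [Derivation.leibniz, pderiv_sum_X, smul_eq_mul, smul_eq_mul]
    ring
  have h2 : ∀ i : Fin n, dunklEuler c i (X i * pderiv i ((∑ k, X k) * f)) =
      (∑ k, X k) * dunklEuler c i (X i * pderiv i f) + (2 : ℂ) • (X i ^ 2 * pderiv i f) +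
        (1 + c * ((n : ℂ) - 1)) • (X i * f) := by
    intro i
    rw [h1, dunklEuler, Module.End.mul_apply, Module.End.mul_apply, map_add, mulX_apply,
      mulX_apply, dunkl_sum_X_mul, dunkl_X_mul_of_sym c hf, two_smul, mul_add, mul_add, mul_add,
      mul_smul_comm]
    ring
  rw [jackP_apply c (mul_mem_symSub sum_X_mem hf), jackP_apply c hf,
    Finset.sum_congr rfl fun i _ => h2 i, eulerP, Finset.sum_congr rfl fun i _ => h1 i, eulerP]
  simp only [Finset.sum_add_distrib, ← Finset.mul_sum, ← Finset.smul_sum, ← Finset.sum_mul]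
  rw [mul_add, mul_smul_comm]
  module

theorem coord_diagS_zero {n : ℕ} {κ : ℝ} (hκ : 0 ≤ κ) (ν : Part n) (f : symSub n) :
    (jackBasis hκ).coord ν (diagS κ 0 f) =
      (besselEig κ 0 ν.1 : ℂ) * (jackBasis hκ).coord ν f := by
  have : (jackBasis hκ).coord ν ∘ₗ diagS κ 0 =
      (besselEig κ 0 ν.1 : ℂ) • (jackBasis hκ).coord ν := by
    refine (jackBasis hκ).ext fun lam => ?_
    rw [LinearMap.comp_apply, diagS_jack, map_smul, LinearMap.smul_apply, coord_jackBasis]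
    split_ifs with e
    · rw [e]
    · simp
  exact LinearMap.congr_fun this f

/-- The operator `∑ x_i² ∂_i` is a combination of `p_1` and its commutator with `D_2`, so that a
coordinate that vanishes on the image of `p_1` also vanishes on its image. -/
theorem coord_euler2S {n : ℕ} {κ : ℝ} (hκ : 0 ≤ κ) {ν : Part n}
    (h : ∀ f, (jackBasis hκ).coord ν (p1S f) = 0) (f : symSub n) :
    (jackBasis hκ).coord ν (euler2S f) = 0 := by
  have h1 : diagS κ 0 (p1S f) = p1S (diagS κ 0 f) + (2 : ℂ) • euler2S f +
      (2 * κ * ((n : ℂ) - 1)) • p1S f := by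
    apply Subtype.ext
    have := jackP_sum_X_mul (κ : ℂ) f.2
    simp only [diagS, LinearMap.coe_mk, AddHom.coe_mk, Submodule.coe_add, Submodule.coe_smul,
      Complex.ofReal_zero, zero_smul, add_zero, coe_p1S, coe_euler2S]
    exact this
  have h2 := congrArg ((jackBasis hκ).coord ν) h1
  rw [coord_diagS_zero, h, map_add, map_add, map_smul, map_smul, h, h] at h2
  simpa using h2.symm

/-- For a polynomial with exponents dominated by `ν`, the coordinate at `P_ν` is the leading
coefficient. -/
theorem coord_eq_cf {n : ℕ} {κ : ℝ} (hκ : 0 ≤ κ) (ν : Part n) (f : symSub n)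
    (hf : (f : MvPolynomial (Fin n) ℂ) ∈ belowSub ν.1) :
    (jackBasis hκ).coord ν f = cf ν.1 (f : MvPolynomial (Fin n) ℂ) := by
  set a := cf ν.1 (f : MvPolynomial (Fin n) ℂ) with ha
  have h1 : (f : MvPolynomial (Fin n) ℂ) - a • jack κ ν ∈ domSpan ν.1 := by
    refine mem_domSpan (sub_mem f.2 (Submodule.smul_mem _ _ (jack_mem_symSub hκ ν)))
      (sub_mem hf (Submodule.smul_mem _ _ (jack_mem_belowSub hκ ν))) ?_
    rw [map_sub, map_smul, cf_jack hκ, smul_eq_mul, mul_one, sub_self]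
  have h2 := domSpan_le_span_jack hκ ν h1
  have h3 : f - a • jackBasis hκ ν ∈
      Submodule.span ℂ (jackBasis hκ '' {μ : Part n | DomLT μ.1 ν.1}) := by
    have e : jack κ '' {μ : Part n | DomLT μ.1 ν.1} =
        (symSub n).subtype '' (jackBasis hκ '' {μ : Part n | DomLT μ.1 ν.1}) := by
      rw [Set.image_image]
      exact Set.image_congr fun μ _ => (jackBasis_apply hκ μ).symm
    rw [e, ← Submodule.map_span] at h2
    obtain ⟨x, hx, hxf⟩ := h2
    have : x = f - a • jackBasis hκ ν := Subtype.ext (by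
      rw [Submodule.subtype_apply] at hxf
      rw [hxf, Submodule.coe_sub, Submodule.coe_smul, jackBasis_apply])
    rwa [← this]
  have h4 : (jackBasis hκ).coord ν (f - a • jackBasis hκ ν) = 0 := by
    by_contra hne
    exact ((mem_span_jack_iff hκ).1 h3 ν hne).1 rfl
  rw [map_sub, map_smul, coord_jackBasis, if_pos rfl, smul_eq_mul, mul_one, sub_eq_zero] at h4
  exact h4

theorem topSum_add_single {n : ℕ} (lam : Fin n → ℕ) (i : Fin n) (k : ℕ) :
    topSum (lam + Pi.single i 1) k = topSum lam k + if i.val < k then 1 else 0 := by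
  simp only [topSum, Pi.add_apply, Finset.sum_add_distrib, Pi.single_apply]
  congr 1
  rw [Finset.sum_ite_eq']
  simp

/-- If `ν` arises from `lam` by adding a box that completes the last row of maximal length `r`, then
adding a box to an exponent dominated by `lam` gives an exponent dominated by `ν`, provided that the
box is not added to an entry equal to `r`. -/
theorem Below.add_single {n : ℕ} {lam : Fin n → ℕ} {i : Fin n} {r : ℕ}
    (hr : ∀ j, (lam + Pi.single i 1 : Fin n → ℕ) j ≤ r)
    (hri : ∀ j ≤ i, (lam + Pi.single i 1 : Fin n → ℕ) j = r)
    {α : Fin n →₀ ℕ} (h : Below lam α) {j : Fin n} (hj : α j ≠ r) :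
    (∀ k, α k ≤ r) ∧ Below (lam + Pi.single i 1) (α + Finsupp.single j 1) := by
  have hts : ∀ k, topSum (lam + Pi.single i 1) k ≤ k * r := by
    intro k
    rw [topSum]
    calc _ ≤ (Finset.univ.filter fun i : Fin n => i.val < k).card • r :=
          Finset.sum_le_card_nsmul _ _ _ fun j _ => hr j
      _ ≤ k * r := by
          rw [smul_eq_mul]
          refine Nat.mul_le_mul_right _ ?_
          have : ((Finset.univ.filter fun i : Fin n => i.val < k).map Fin.valEmbedding).card ≤
              (Finset.range k).card := Finset.card_le_card fun x hx => by
            simp only [Finset.mem_map, Finset.mem_filter] at hx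
            obtain ⟨y, hy, rfl⟩ := hx
            simpa using hy.2
          simpa using this
  have hα : ∀ k, α k ≤ r := by
    intro k
    have h1 := h.2 {k}
    have h2 := hts 1
    rw [topSum_add_single] at h2
    simp only [Finset.sum_singleton, Finset.card_singleton] at h1
    omega
  refine ⟨hα, ?_, fun S => ?_⟩
  · have : weight (lam + Pi.single i 1) = weight lam + 1 := by
      simp [weight, Finset.sum_add_distrib]
    rw [this, ← h.1]
    simp [Finset.sum_add_distrib]
  · have e : ∑ k ∈ S, (α + Finsupp.single j 1 : Fin n →₀ ℕ) k =
        ∑ k ∈ S, α k + if j ∈ S then 1 else 0 := by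
      simp only [Finsupp.add_apply, Finset.sum_add_distrib, Finsupp.single_apply]
      rw [Finset.sum_ite_eq]
    rw [e]
    by_cases hS : i.val < S.card
    · rw [topSum_add_single, if_pos hS]
      have := h.2 S
      split_ifs <;> omega
    by_cases hjS : j ∈ S
    · rw [if_pos hjS]
      have h1 : topSum (lam + Pi.single i 1) S.card = S.card * r := by
        rw [topSum, Finset.sum_congr rfl (g := fun _ => r), Finset.sum_const, smul_eq_mul]
        · congr 1
          have hSn : S.card ≤ n := by simpa using Finset.card_le_univ S
          rw [Fin.card_filter_val_lt, min_eq_right hSn]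
        · intro k hk
          refine hri k ?_
          rw [Fin.le_def]
          have := (Finset.mem_filter.1 hk).2
          omega
      rw [h1, ← Finset.add_sum_erase S α hjS]
      have h2 : ∑ k ∈ S.erase j, α k ≤ (S.erase j).card • r :=
        Finset.sum_le_card_nsmul _ _ _ fun k _ => hα k
      have h3 := Finset.card_erase_add_one hjS
      have h4 : α j < r := lt_of_le_of_ne (hα j) hj
      rw [← h3, Nat.add_mul, one_mul]
      rw [smul_eq_mul] at h2
      omega
    · rw [if_neg hjS, topSum_add_single, if_neg hS]
      exact h.2 S

theorem sum_X_sub_euler2_monomial {n : ℕ} (r : ℕ) (α : Fin n →₀ ℕ) :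
    (r : ℂ) • ((∑ k, X k) * monomial α (1 : ℂ)) - ∑ k, X k ^ 2 * pderiv k (monomial α (1 : ℂ)) =
      ∑ k, ((r : ℂ) - α k) • monomial (α + Finsupp.single k 1) 1 := by
  rw [Finset.sum_mul, Finset.smul_sum, ← Finset.sum_sub_distrib]
  refine Finset.sum_congr rfl fun k _ => ?_
  have h : X k * monomial α (1 : ℂ) = monomial (α + Finsupp.single k 1) 1 := by
    rw [X, monomial_mul, one_mul, add_comm]
  rw [pow_two, mul_assoc, X_mul_pderiv_monomial, mul_smul_comm, h, ← Nat.cast_smul_eq_nsmul ℂ,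
    sub_smul]

/-- Every nonempty partition `ν` occurs in some product `p_1 P_σ`. If not, the coefficient of
`P_ν` would vanish on the images of `p_1` and of its commutator with `D_2`; but it does not vanish
on a suitable combination of the two, which has leading term `x^ν`. -/
theorem exists_coord_p1S_ne_zero {n : ℕ} {κ : ℝ} (hκ : 0 ≤ κ) {ν : Part n} (hν : ν.1 ≠ 0) :
    ∃ σ, (jackBasis hκ).coord ν (p1S (jackBasis hκ σ)) ≠ 0 := by
  by_contra! H
  have h0 : ∀ f, (jackBasis hκ).coord ν (p1S f) = 0 := by
    have : (jackBasis hκ).coord ν ∘ₗ p1S = 0 := (jackBasis hκ).ext H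
    exact LinearMap.congr_fun this
  have h2 := coord_euler2S hκ h0
  obtain ⟨k₀, hk₀⟩ := Function.ne_iff.1 hν
  have hn : 0 < n := k₀.pos
  set r := ν.1 ⟨0, hn⟩ with hr
  have hle : ∀ j, ν.1 j ≤ r := fun j => ν.2 (by rw [Fin.le_def]; exact Nat.zero_le _)
  have hrpos : 0 < r := lt_of_lt_of_le (Nat.pos_of_ne_zero hk₀) (hle k₀)
  obtain ⟨i, hi, hmax⟩ := Finset.exists_max_image (Finset.univ.filter fun j => ν.1 j = r) id
    ⟨⟨0, hn⟩, by simp [hr]⟩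
  replace hi : ν.1 i = r := by simpa using hi
  replace hmax : ∀ j, ν.1 j = r → j ≤ i := fun j hj => hmax j (by simpa using hj)
  set lam : Fin n → ℕ := Function.update ν.1 i (r - 1) with hlam
  have hνl : ν.1 = lam + Pi.single i 1 := by
    funext j
    by_cases hj : j = i
    · subst hj; simp [hlam, hi]; omega
    · simp [hlam, hj]
  have hle' : ∀ j, (lam + Pi.single i 1 : Fin n → ℕ) j ≤ r := hνl ▸ hle
  have hri : ∀ j ≤ i, (lam + Pi.single i 1 : Fin n → ℕ) j = r := by
    rw [← hνl]
    intro j hj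
    exact le_antisymm (hle j) (hi ▸ ν.2 hj)
  have hlamA : Antitone lam := by
    intro j k hjk
    by_cases hki : k = i
    · subst hki
      by_cases hj : j = k
      · rw [hj]
      · have := hri j hjk
        rw [← hνl] at this
        simp only [hlam, Function.update_self, Function.update_of_ne hj]
        omega
    · by_cases hj : j = i
      · subst hj
        have h1 := hle k
        have h3 : ν.1 k ≠ r := fun e => hki (le_antisymm (hmax k e) hjk)
        simp only [hlam, Function.update_self, Function.update_of_ne hki]
        omega
      · simp only [hlam, Function.update_of_ne hki, Function.update_of_ne hj]
        exact ν.2 hjk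
  -- The combination `r p_1 - ∑ x_k² ∂_k` kills the terms in which a box is added to an entry equal
  -- to `r`; the remaining terms are dominated by `ν`.
  set h : symSub n := (r : ℂ) • p1S ⟨_, monomialSymm_mem_symSub lam⟩ -
    euler2S ⟨_, monomialSymm_mem_symSub lam⟩ with hh
  have hcoe : (h : MvPolynomial (Fin n) ℂ) = (r : ℂ) • ((∑ k, X k) * monomialSymm lam) -
      ∑ k, X k ^ 2 * pderiv k (monomialSymm lam) := rfl
  have hbelow : ∀ f ∈ belowSub lam, (r : ℂ) • ((∑ k, X k) * f) - ∑ k, X k ^ 2 * pderiv k f ∈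
      belowSub ν.1 := by
    intro f hf
    refine belowSub_induction (p := fun f => (r : ℂ) • ((∑ k, X k) * f) -
      ∑ k, X k ^ 2 * pderiv k f ∈ belowSub ν.1) hf (by simp) (fun f g hf hg => ?_)
      (fun a f hf => ?_) fun α hα => ?_
    · convert add_mem hf hg using 1
      simp only [map_add, mul_add, Finset.sum_add_distrib, smul_add]
      abel
    · convert Submodule.smul_mem _ a hf using 1
      simp only [Derivation.map_smul, mul_smul_comm, ← Finset.smul_sum, smul_sub]
      rw [smul_comm]
    · rw [sum_X_sub_euler2_monomial]
      refine sum_mem fun k _ => ?_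
      by_cases hk : α k = r
      · rw [hk, sub_self, zero_smul]; exact zero_mem _
      · rw [hνl]
        exact Submodule.smul_mem _ _ (monomial_mem_belowSub
          (Below.add_single hle' hri hα hk).2 1)
  have hc := coord_eq_cf hκ ν h
    (by rw [hcoe]; exact hbelow _ (monomialSymm_mem_belowSub (Below.self hlamA)))
  have hz : (jackBasis hκ).coord ν h = 0 := by
    rw [hh, map_sub, map_smul, h0, h2, smul_zero, sub_zero]
  -- The leading coefficient is a sum of natural numbers, one of which is `r - lam i = 1`.
  have hcf : cf ν.1 (h : MvPolynomial (Fin n) ℂ) = ((∑ α ∈ Finset.univ.image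
      (fun w : Perm (Fin n) => lam ∘ w), ∑ k, if α + Pi.single k 1 = ν.1 then r - α k else 0 : ℕ) :
        ℂ) := by
    have e : (h : MvPolynomial (Fin n) ℂ) = ∑ α ∈ Finset.univ.image
        (fun w : Perm (Fin n) => lam ∘ w), ∑ k, ((r : ℂ) - α k) •
          monomial (Finsupp.equivFunOnFinite.symm α + Finsupp.single k 1) 1 := by
      rw [hcoe, monomialSymm_eq]
      simp only [map_sum, Finset.mul_sum, Finset.smul_sum]
      rw [Finset.sum_comm (s := Finset.univ) (t := Finset.univ.image _), ← Finset.sum_sub_distrib]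
      refine Finset.sum_congr rfl fun α _ => ?_
      have := sum_X_sub_euler2_monomial r (Finsupp.equivFunOnFinite.symm α)
      rw [this]
      rfl
    rw [e, map_sum]
    push_cast
    refine Finset.sum_congr rfl fun α _ => ?_
    rw [map_sum]
    refine Finset.sum_congr rfl fun k _ => ?_
    have e2 : ((Finsupp.equivFunOnFinite.symm α + Finsupp.single k 1 : Fin n →₀ ℕ) : Fin n → ℕ) =
        α + Pi.single k 1 := by
      rw [Finsupp.coe_add, Finsupp.single_eq_pi_single]; rfl
    rw [map_smul, cf_monomial, e2]
    split_ifs with hα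
    · have : α k + 1 ≤ r := by
        have h5 := hle k
        rw [← hα] at h5
        simpa using h5
      rw [smul_eq_mul, mul_one, Nat.cast_sub (by omega)]
    · simp
  rw [hz, hcf] at hc
  have hpos := Nat.cast_eq_zero.1 hc.symm
  rw [Finset.sum_eq_zero_iff] at hpos
  have h6 := hpos lam (Finset.mem_image.2 ⟨1, Finset.mem_univ _, rfl⟩)
  rw [Finset.sum_eq_zero_iff] at h6
  have h7 := h6 i (Finset.mem_univ i)
  rw [if_pos hνl.symm] at h7
  have h8 : lam i = r - 1 := by simp [hlam]
  omega

/-! ### Bessel polynomials -/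

theorem besselOp_eq {n : ℕ} (κ a : ℝ) (f : symSub n) :
    besselOp κ a (f : MvPolynomial (Fin n) ℂ) = toRat (besselS κ a f : MvPolynomial (Fin n) ℂ) := by
  have h : (besselS κ a f : MvPolynomial (Fin n) ℂ) = jackP (κ : ℂ) (f : MvPolynomial (Fin n) ℂ) +
      (C (a : ℂ) * eulerP (f : MvPolynomial (Fin n) ℂ) +
        2 * ∑ i, pderiv i (f : MvPolynomial (Fin n) ℂ)) := by
    have hd : (diagS κ a f : MvPolynomial (Fin n) ℂ) =
      jackP (κ : ℂ) (f : MvPolynomial (Fin n) ℂ) + (a : ℂ) • eulerP (f : MvPolynomial (Fin n) ℂ) :=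
        rfl
    rw [besselS_apply, Submodule.coe_add, Submodule.coe_smul, coe_e0S, hd, two_smul, smul_eq_C_mul]
    ring
  rw [h, besselOp_eq_jackOp_add, jackOp_eq κ f.2, ← map_add]

theorem besselS_jack {n : ℕ} {κ : ℝ} (hκ : 0 ≤ κ) (a : ℝ) (lam : Part n) :
    besselS κ a (jackBasis hκ lam) - (besselEig κ a lam.1 : ℂ) • jackBasis hκ lam ∈
      Submodule.span ℂ (jackBasis hκ '' {μ | μ < lam}) := by
  rw [besselS_apply, diagS_jack, add_sub_cancel_left]
  refine Submodule.smul_mem _ _ ((mem_span_jack_iff hκ).2 fun ν hν => ?_)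
  obtain ⟨i, hi⟩ := coord_e0S hκ hν
  have h1 : ν.1 ≤ lam.1 := hi ▸ le_self_add
  refine lt_of_le_of_ne h1 ?_
  intro e
  rw [e] at hi
  have := congrFun hi i
  simp at this

theorem weight_lt {n : ℕ} {μ lam : Part n} (h : μ < lam) : weight μ.1 < weight lam.1 := by
  obtain ⟨h1, i, hi⟩ := Pi.lt_def.1 (show μ.1 < lam.1 from h)
  exact Finset.sum_lt_sum (fun j _ => h1 j) ⟨i, Finset.mem_univ i, hi⟩

/-- Under the hypothesis on the parameters, the eigenvalues strictly decrease along inclusion. -/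
theorem besselEig_lt {n m : ℕ} {κ a : ℝ} (hκ : 0 ≤ κ)
    (ha : a < -2 * ((m : ℝ) + κ * ((n : ℝ) - 1)) + 1) {μ lam : Part n} (h : μ < lam)
    (hw : weight lam.1 ≤ m) : besselEig κ a lam.1 < besselEig κ a μ.1 := by
  have e : ∀ ν : Part n, besselEig κ a ν.1 =
      ∑ i : Fin n, (ν.1 i : ℝ) * (ν.1 i - 1 + a + 2 * κ * ((n : ℝ) - 1 - i)) := by
    intro ν
    rw [besselEig, jackEig, weight, Nat.cast_sum, Finset.mul_sum, ← Finset.sum_add_distrib]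
    exact Finset.sum_congr rfl fun i _ => by ring
  obtain ⟨h1, i, hi⟩ := Pi.lt_def.1 (show μ.1 < lam.1 from h)
  have key : ∀ i, μ.1 i < lam.1 i →
      (lam.1 i : ℝ) * (lam.1 i - 1 + a + 2 * κ * ((n : ℝ) - 1 - i)) <
        (μ.1 i : ℝ) * (μ.1 i - 1 + a + 2 * κ * ((n : ℝ) - 1 - i)) := by
    intro i hi
    have h2 : (lam.1 i : ℝ) ≤ m := by exact_mod_cast (le_weight lam.1 i).trans hw
    have h3 : (μ.1 i : ℝ) + 1 ≤ lam.1 i := by exact_mod_cast hi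
    have h4 : κ * ((n : ℝ) - 1 - i) ≤ κ * ((n : ℝ) - 1) := by
      refine mul_le_mul_of_nonneg_left ?_ hκ
      have : (0 : ℝ) ≤ i := by positivity
      linarith
    have h5 : (lam.1 i : ℝ) + μ.1 i + a - 1 + 2 * κ * ((n : ℝ) - 1 - i) < 0 := by linarith
    have h6 : 0 < (lam.1 i : ℝ) - μ.1 i := by linarith
    nlinarith [mul_neg_of_pos_of_neg h6 h5]
  rw [e, e]
  refine Finset.sum_lt_sum (fun j _ => ?_) ⟨i, Finset.mem_univ i, key i hi⟩
  rcases (show μ.1 j ≤ lam.1 j from h1 j).lt_or_eq with hj | hj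
  · exact (key j hj).le
  · rw [hj]

/-- A polynomial `y` has the form `P_λ + ∑_{μ ⊂ λ} v_μ P_μ` and is an eigenfunction of `D^B`, for
the eigenvalue of `λ`. -/
def IsBesselS {n : ℕ} {κ : ℝ} (hκ : 0 ≤ κ) (a : ℝ) (lam : Part n) (y : symSub n) : Prop :=
  y - jackBasis hκ lam ∈ Submodule.span ℂ (jackBasis hκ '' {μ | μ < lam}) ∧
    besselS κ a y = (besselEig κ a lam.1 : ℂ) • y

theorem jackBasis_notMem {n : ℕ} {κ : ℝ} (hκ : 0 ≤ κ) (lam : Part n) :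
    jackBasis hκ lam ∉ Submodule.span ℂ (jackBasis hκ '' {μ | μ < lam}) := by
  intro h
  have h1 := (mem_span_jack_iff hκ).1 h lam
  rw [coord_jackBasis, if_pos rfl] at h1
  exact lt_irrefl lam (h1 one_ne_zero)

theorem finite_lt {n : ℕ} (lam : Part n) : {μ : Part n | μ < lam}.Finite := by
  refine Set.Finite.of_finite_image (f := Subtype.val) ?_ Subtype.val_injective.injOn
  refine (Set.finite_Iic lam.1).subset ?_
  rintro _ ⟨μ, hμ, rfl⟩
  exact le_of_lt (show μ < lam from hμ)

theorem exists_isBesselS {n m : ℕ} {κ a : ℝ} (hκ : 0 ≤ κ)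
    (ha : a < -2 * ((m : ℝ) + κ * ((n : ℝ) - 1)) + 1) {lam : Part n}
    (hw : weight lam.1 ≤ m) : ∃ y, IsBesselS hκ a lam y :=
  triangular_exists (r := fun μ lam : Part n => μ < lam)
    (rank := fun μ => weight μ.1) (e := jackBasis hκ)
    (D := besselS κ a) (ε := fun μ => (besselEig κ a μ.1 : ℂ))
    (fun _ _ _ h h' => h.trans h') (fun _ _ h => weight_lt h) (besselS_jack hκ a) (i := lam)
    (fun μ h => by
      rw [ne_eq, Complex.ofReal_inj]
      exact (besselEig_lt hκ ha h hw).ne')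

theorem isBesselS_unique {n m : ℕ} {κ a : ℝ} (hκ : 0 ≤ κ)
    (ha : a < -2 * ((m : ℝ) + κ * ((n : ℝ) - 1)) + 1) {lam : Part n}
    (hw : weight lam.1 ≤ m) {y z : symSub n} (hy : IsBesselS hκ a lam y)
    (hz : IsBesselS hκ a lam z) : y = z :=
  triangular_unique (r := fun μ lam : Part n => μ < lam)
    (rank := fun μ => weight μ.1) (e := jackBasis hκ)
    (D := besselS κ a) (ε := fun μ => (besselEig κ a μ.1 : ℂ))
    (fun _ _ _ h h' => h.trans h') (fun _ _ h => weight_lt h) (besselS_jack hκ a) (i := lam)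
    (finite_lt lam) (fun μ h => by
      rw [ne_eq, Complex.ofReal_inj]
      exact (besselEig_lt hκ ha h hw).ne') (jackBasis_notMem hκ lam) hy.1 hy.2 hz.1 hz.2

/-- Bessel polynomials in terms of operators on symmetric polynomials. The eigenvalue, which
`IsBessel` leaves open, is determined by the leading term. -/
theorem isBessel_iff {n : ℕ} {κ : ℝ} (hκ : 0 ≤ κ) (a : ℝ) (lam : Part n)
    (Y : MvPolynomial (Fin n) ℂ) :
    IsBessel κ a lam.1 Y ↔ ∃ y : symSub n, (y : MvPolynomial (Fin n) ℂ) = Y ∧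
      IsBesselS hκ a lam y := by
  have hspan : Submodule.span ℂ {Q | ∃ mu : Fin n → ℕ, Antitone mu ∧ mu < lam.1 ∧ IsJack κ mu Q} =
      (Submodule.span ℂ (jackBasis hκ '' {μ | μ < lam})).map (symSub n).subtype := by
    rw [Submodule.map_span, Set.image_image]
    congr 1
    ext Q
    constructor
    · rintro ⟨μ, hμ, h, hQ⟩
      refine ⟨⟨μ, hμ⟩, h, ?_⟩
      refine (jackBasis_apply hκ _).trans ?_
      exact isJack_unique hκ ⟨μ, hμ⟩ (isJack_jack hκ _) hQ
    · rintro ⟨μ, h, rfl⟩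
      refine ⟨μ.1, μ.2, h, ?_⟩
      simpa only [Submodule.subtype_apply, jackBasis_apply] using isJack_jack hκ μ
  rw [IsBessel, hspan]
  constructor
  · rintro ⟨⟨P, hP, x, hx, hxY⟩, c, hc⟩
    have hPj : P = jackBasis hκ lam := by
      rw [jackBasis_apply]; exact isJack_unique hκ lam hP (isJack_jack hκ lam)
    have hY : ((x + jackBasis hκ lam : symSub n) : MvPolynomial (Fin n) ℂ) = Y := by
      rw [Submodule.coe_add, ← hPj]
      rw [Submodule.subtype_apply] at hxY
      rw [hxY, sub_add_cancel]
    have h1 : (x + jackBasis hκ lam) - jackBasis hκ lam ∈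
        Submodule.span ℂ (jackBasis hκ '' {μ | μ < lam}) := by rwa [add_sub_cancel_right]
    have h2 : besselS κ a (x + jackBasis hκ lam) = c • (x + jackBasis hκ lam) := by
      apply Subtype.ext
      rw [← hY, besselOp_eq] at hc
      rw [Submodule.coe_smul, smul_eq_C_mul]
      exact toRat_injective hc
    refine ⟨x + jackBasis hκ lam, hY, h1, ?_⟩
    rwa [triangular_eigenvalue (r := fun μ lam : Part n => μ < lam) (e := jackBasis hκ)
      (D := besselS κ a) (ε := fun μ => (besselEig κ a μ.1 : ℂ)) (fun _ _ _ h h' => h.trans h')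
      (besselS_jack hκ a) (jackBasis_notMem hκ lam) h1 h2] at h2
  · rintro ⟨y, rfl, h1, h2⟩
    refine ⟨⟨jack κ lam, isJack_jack hκ lam, _, h1, ?_⟩, (besselEig κ a lam.1 : ℂ), ?_⟩
    · rw [Submodule.subtype_apply, Submodule.coe_sub, jackBasis_apply]
    · rw [besselOp_eq, h2, Submodule.coe_smul, smul_eq_C_mul]

theorem IsBesselS.mem_lowSpan {n : ℕ} {κ a : ℝ} {hκ : 0 ≤ κ} {lam : Part n} {y : symSub n}
    (h : IsBesselS hκ a lam y) : y ∈ lowSpan hκ lam := by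
  have h1 : Submodule.span ℂ (jackBasis hκ '' {μ | μ < lam}) ≤ lowSpan hκ lam :=
    Submodule.span_mono (Set.image_mono fun μ hμ => le_of_lt (show μ < lam from hμ))
  have := add_mem (h1 h.1) (jackBasis_mem_lowSpan hκ le_rfl)
  rwa [sub_add_cancel] at this

/-- A subspace that contains a Bessel polynomial for each element of a lower set of partitions
contains the Jack polynomials of these partitions. -/
theorem span_jack_le_of_isBesselS {n : ℕ} {κ a : ℝ} (hκ : 0 ≤ κ)
    {N : Submodule ℂ (symSub n)} {s : Set (Part n)} (hs : IsLowerSet s)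
    (hN : ∀ μ ∈ s, ∃ y ∈ N, IsBesselS hκ a μ y) :
    Submodule.span ℂ (jackBasis hκ '' s) ≤ N := by
  suffices H : ∀ k (μ : Part n), weight μ.1 = k → μ ∈ s → jackBasis hκ μ ∈ N by
    rw [Submodule.span_le]
    rintro _ ⟨μ, hμ, rfl⟩
    exact H _ μ rfl hμ
  intro k
  induction k using Nat.strong_induction_on with
  | _ k ih =>
    intro μ hk hμ
    obtain ⟨y, hy, hyb⟩ := hN μ hμ
    have h1 : Submodule.span ℂ (jackBasis hκ '' {ν | ν < μ}) ≤ N := by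
      rw [Submodule.span_le]
      rintro _ ⟨ν, hν, rfl⟩
      exact ih _ (hk ▸ weight_lt hν) ν rfl (hs (le_of_lt hν) hμ)
    have := sub_mem hy (h1 hyb.1)
    rwa [sub_sub_cancel] at this

/-! ### Orthogonality for a form that makes `D^B` symmetric -/

/-- The symmetric polynomials of degree at most `d`, in terms of Jack polynomials. -/
def degS {n : ℕ} {κ : ℝ} (hκ : 0 ≤ κ) (d : ℕ) : Submodule ℂ (symSub n) :=
  Submodule.span ℂ (jackBasis hκ '' {σ | weight σ.1 ≤ d})

theorem weight_mono {n : ℕ} {μ lam : Fin n → ℕ} (h : μ ≤ lam) : weight μ ≤ weight lam :=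
  Finset.sum_le_sum fun i _ => h i

theorem weight_add_single {n : ℕ} (lam : Fin n → ℕ) (i : Fin n) :
    weight (lam + Pi.single i 1) = weight lam + 1 := by
  simp [weight, Finset.sum_add_distrib]

theorem degS_mono {n : ℕ} {κ : ℝ} (hκ : 0 ≤ κ) {d e : ℕ} (h : d ≤ e) :
    degS (n := n) hκ d ≤ degS hκ e :=
  Submodule.span_mono (Set.image_mono fun _ hσ => le_trans (Set.mem_ofPred.1 hσ) h)

theorem lowSpan_le_degS {n : ℕ} {κ : ℝ} (hκ : 0 ≤ κ) (μ : Part n) :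
    lowSpan hκ μ ≤ degS hκ (weight μ.1) :=
  Submodule.span_mono (Set.image_mono fun σ hσ => weight_mono (show σ.1 ≤ μ.1 from hσ))

theorem rowUp_mem_degS {n : ℕ} {κ : ℝ} (hκ : 0 ≤ κ) (j : Fin n) {d : ℕ} {f : symSub n}
    (hf : f ∈ degS hκ d) : rowUp hκ j f ∈ degS hκ (d + 1) := by
  have : degS hκ d ≤ (degS hκ (d + 1)).comap (rowUp hκ j) := by
    rw [degS, Submodule.span_le]
    rintro _ ⟨σ, hσ, rfl⟩
    refine (mem_span_jack_iff hκ).2 fun ν hν => ?_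
    rw [coord_rowUp] at hν
    have e : ν.1 = σ.1 + Pi.single j 1 := by
      by_contra e
      exact hν (if_neg e)
    rw [Set.mem_ofPred, e, weight_add_single]
    exact Nat.succ_le_succ hσ
  exact this hf

theorem besselS_mem_degS {n : ℕ} {κ : ℝ} (hκ : 0 ≤ κ) (a : ℝ) {d : ℕ} {f : symSub n}
    (hf : f ∈ degS hκ d) : besselS κ a f ∈ degS hκ d := by
  have : degS (n := n) hκ d ≤ (degS hκ d).comap (besselS κ a) := by
    conv_lhs => rw [degS]
    rw [Submodule.span_le]
    rintro _ ⟨σ, hσ, rfl⟩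
    have h1 : Submodule.span ℂ (jackBasis hκ '' {μ | μ < σ}) ≤ degS hκ d :=
      Submodule.span_mono (Set.image_mono fun τ hτ => (weight_lt hτ).le.trans hσ)
    have h2 := add_mem (h1 (besselS_jack hκ a σ)) (Submodule.smul_mem _ (besselEig κ a σ.1 : ℂ)
      (Submodule.subset_span ⟨σ, hσ, rfl⟩ : jackBasis hκ σ ∈ degS hκ d))
    rwa [sub_add_cancel] at h2
  exact this hf

/-- A Hermitian form, well behaved on pairs of symmetric polynomials whose degrees have sum at
most `2 m`, for which `p_1` and `D^B` are symmetric. Additivity is only required for such pairs,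
since the integral that defines the form need not converge in higher degrees. -/
structure IsBesselForm {n : ℕ} {κ : ℝ} (hκ : 0 ≤ κ) (a : ℝ) (m : ℕ)
    (B : symSub n → symSub n → ℂ) : Prop where
  add_left : ∀ {p q : ℕ}, p + q ≤ 2 * m → ∀ {f f' g : symSub n}, f ∈ degS hκ p → f' ∈ degS hκ p →
    g ∈ degS hκ q → B (f + f') g = B f g + B f' g
  smul_left : ∀ (c : ℂ) (f g : symSub n), B (c • f) g = c * B f g
  conj : ∀ f g : symSub n, starRingEnd ℂ (B f g) = B g f
  p1S_left : ∀ f g : symSub n, B (p1S f) g = B f (p1S g)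
  besselS_left : ∀ {p q : ℕ}, p + q ≤ 2 * m → ∀ {f g : symSub n}, f ∈ degS hκ p → g ∈ degS hκ q →
    B (besselS κ a f) g = B f (besselS κ a g)

namespace IsBesselForm

variable {n m : ℕ} {κ a : ℝ} {hκ : 0 ≤ κ} {B : symSub n → symSub n → ℂ}

theorem smul_right (hB : IsBesselForm hκ a m B) (c : ℝ) (f g : symSub n) :
    B f ((c : ℂ) • g) = c * B f g := by
  rw [← hB.conj, hB.smul_left, map_mul, hB.conj, Complex.conj_ofReal]

/-- The polynomials of degree at most `p` that are orthogonal to `g`. -/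
def perp (hB : IsBesselForm hκ a m B) {p q : ℕ} (hpq : p + q ≤ 2 * m) {g : symSub n}
    (hg : g ∈ degS hκ q) : Submodule ℂ (symSub n) where
  carrier := {f | f ∈ degS hκ p ∧ B f g = 0}
  add_mem' {f f'} hf hf' :=
    ⟨add_mem hf.1 hf'.1, by rw [hB.add_left hpq hf.1 hf'.1 hg, hf.2, hf'.2, add_zero]⟩
  zero_mem' := ⟨zero_mem _, by
    have := hB.smul_left 0 0 g
    rwa [zero_smul, zero_mul] at this⟩
  smul_mem' c f hf := ⟨Submodule.smul_mem _ _ hf.1, by rw [hB.smul_left, hf.2, mul_zero]⟩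

/-- If `g` is an eigenfunction of `D^B`, and `f` is an eigenfunction for another eigenvalue up to
a term orthogonal to `g`, then `f` and `g` are orthogonal. -/
theorem eq_zero_of_eigen (hB : IsBesselForm hκ a m B) {p q : ℕ} (hpq : p + q ≤ 2 * m)
    {f g : symSub n} (hf : f ∈ degS hκ p) (hg : g ∈ degS hκ q) {c e : ℝ} (hce : c ≠ e)
    (hfc : B (besselS κ a f - (c : ℂ) • f) g = 0) (hge : besselS κ a g = (e : ℂ) • g) :
    B f g = 0 := by
  have h1 : B (besselS κ a f) g = B (besselS κ a f - (c : ℂ) • f) g + B ((c : ℂ) • f) g := by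
    rw [← hB.add_left hpq (sub_mem (besselS_mem_degS hκ a hf) (Submodule.smul_mem _ _ hf))
      (Submodule.smul_mem _ _ hf) hg, sub_add_cancel]
  rw [hB.besselS_left hpq hf hg, hfc, hge, hB.smul_right, hB.smul_left, zero_add] at h1
  by_contra h
  exact hce (Complex.ofReal_inj.1 (mul_right_cancel₀ h h1)).symm

theorem sum_left (hB : IsBesselForm hκ a m B) {p q : ℕ} (hpq : p + q ≤ 2 * m) {ι : Type*}
    (s : Finset ι) {F : ι → symSub n} {g : symSub n} (hF : ∀ i, F i ∈ degS hκ p)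
    (hg : g ∈ degS hκ q) : B (∑ i ∈ s, F i) g = ∑ i ∈ s, B (F i) g := by
  classical
  induction s using Finset.induction_on with
  | empty => exact (hB.perp hpq hg).zero_mem.2
  | insert i s hi ih =>
    rw [Finset.sum_insert hi, Finset.sum_insert hi,
      hB.add_left hpq (hF i) (sum_mem fun j _ => hF j) hg, ih]

end IsBesselForm

/-- Two boxes that can both be added to `σ` have different contents. -/
theorem specR_ne {n : ℕ} {κ : ℝ} (hκ : 0 ≤ κ) {σ : Fin n → ℕ} {i j : Fin n}
    (hi : Antitone (σ + Pi.single i 1)) (hj : Antitone (σ + Pi.single j 1)) (hij : i ≠ j) :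
    specR κ σ i ≠ specR κ σ j := by
  have key : ∀ i j : Fin n, Antitone (σ + Pi.single j 1) → i < j → specR κ σ j < specR κ σ i := by
    intro i j hj hij
    have h1 := hj hij.le
    simp only [Pi.add_apply, Pi.single_eq_same, Pi.single_eq_of_ne hij.ne, add_zero] at h1
    have h2 : (σ j : ℝ) + 1 ≤ σ i := by exact_mod_cast h1
    have h3 : (i : ℝ) ≤ j := by exact_mod_cast hij.le
    have h4 : κ * ((n : ℝ) - 1 - j) ≤ κ * ((n : ℝ) - 1 - i) :=
      mul_le_mul_of_nonneg_left (by linarith) hκ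
    rw [specR, specR]
    linarith
  rcases lt_or_gt_of_ne hij with h | h
  · exact (key i j hj h).ne'
  · exact (key j i hi h).ne

theorem specR_le {n : ℕ} {κ : ℝ} (hκ : 0 ≤ κ) (σ : Fin n → ℕ) (i : Fin n) :
    specR κ σ i ≤ σ i + κ * ((n : ℝ) - 1) := by
  have : κ * ((n : ℝ) - 1 - i) ≤ κ * ((n : ℝ) - 1) := by
    refine mul_le_mul_of_nonneg_left ?_ hκ
    have : (0 : ℝ) ≤ i := by positivity
    linarith
  rw [specR]
  linarith

/-- If no box can be added to `σ` in row `j`, then none can be added there to a smaller partition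
without staying inside `σ`. -/
theorem rowUp_mem_lowSpan {n : ℕ} {κ : ℝ} (hκ : 0 ≤ κ) {j : Fin n} {σ : Part n}
    (h : ¬ Antitone (σ.1 + Pi.single j 1)) {y : symSub n} (hy : y ∈ lowSpan hκ σ) :
    rowUp hκ j y ∈ lowSpan hκ σ := by
  have : lowSpan hκ σ ≤ (lowSpan hκ σ).comap (rowUp hκ j) := by
    conv_lhs => rw [lowSpan]
    rw [Submodule.span_le]
    rintro _ ⟨τ, hτ, rfl⟩
    rw [SetLike.mem_coe, Submodule.mem_comap]
    by_cases hA : Antitone (τ.1 + Pi.single j 1)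
    · rw [rowUp_of_antitone hκ (ν := ⟨_, hA⟩) rfl]
      refine Submodule.smul_mem _ _ (jackBasis_mem_lowSpan hκ ?_)
      have hlt : τ.1 j < σ.1 j := by
        refine lt_of_le_of_ne (hτ j) fun e => h fun k l hkl => ?_
        by_cases hlj : l = j
        · subst hlj
          by_cases hk : k = l
          · rw [hk]
          · have h1 := hA hkl
            have h2 := hτ k
            simp only [Pi.add_apply, Pi.single_eq_same, Pi.single_eq_of_ne hk] at h1 ⊢
            change τ.1 k ≤ σ.1 k at h2
            omega
        · have h1 := σ.2 hkl
          simp only [Pi.add_apply, Pi.single_eq_of_ne hlj]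
          omega
      intro k
      by_cases hk : k = j
      · subst hk; simpa using hlt
      · simpa [hk] using hτ k
    · rw [rowUp_of_not_antitone hκ hA]
      exact zero_mem _
  exact this hy

/-- Bessel polynomials of distinct partitions are orthogonal, even if they have the same eigenvalue.

The proof is by induction on the sum of the weights. If the eigenvalues of `lam` and `μ` agree and
`|μ| ≤ |lam|`, let `P_lam` occur in `p_1 P_σ`, with `lam = σ + e_i`. For the Bessel polynomials `w`,
`y`, `z` of `σ`, `lam`, `μ`, the product `⟨p_1 w, z⟩ = ⟨w, p_1 z⟩` is computed in two ways. Each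
component of `p_1 z` is nearly an eigenfunction, with an eigenvalue smaller than that of `w`, so the
value is zero. The components of `p_1 w` are nearly eigenfunctions with distinct eigenvalues, so
only the one in row `i` can have a nonzero product with `z`, and it is a nonzero multiple of `y` up
to terms that are orthogonal to `z` by induction. -/
theorem IsBesselForm.orthogonal {n m : ℕ} {κ a : ℝ} {hκ : 0 ≤ κ} {B : symSub n → symSub n → ℂ}
    (hB : IsBesselForm hκ a m B) (ha : a < -2 * ((m : ℝ) + κ * ((n : ℝ) - 1)) + 1) :
    ∀ {lam μ : Part n} {y z : symSub n}, weight lam.1 ≤ m → weight μ.1 ≤ m → lam ≠ μ →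
      IsBesselS hκ a lam y → IsBesselS hκ a μ z → B y z = 0 := by
  suffices H : ∀ (N : ℕ) (lam μ : Part n) (y z : symSub n), weight lam.1 + weight μ.1 = N →
      weight lam.1 ≤ m → weight μ.1 ≤ m → lam ≠ μ →
      IsBesselS hκ a lam y → IsBesselS hκ a μ z → B y z = 0 from
    fun {lam μ y z} h1 h2 h3 h4 h5 => H _ lam μ y z rfl h1 h2 h3 h4 h5
  intro N
  induction N using Nat.strong_induction_on with
  | _ N ih =>
  suffices H : ∀ (lam μ : Part n) (y z : symSub n), weight lam.1 + weight μ.1 = N →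
      weight lam.1 ≤ m → weight μ.1 ≤ m → lam ≠ μ → IsBesselS hκ a lam y → IsBesselS hκ a μ z →
      weight μ.1 ≤ weight lam.1 → B y z = 0 by
    intro lam μ y z hN hl hμ hne hy hz
    rcases le_total (weight μ.1) (weight lam.1) with h | h
    · exact H lam μ y z hN hl hμ hne hy hz h
    · rw [← hB.conj, H μ lam z y (by rw [add_comm, hN]) hμ hl hne.symm hz hy h, map_zero]
  intro lam μ y z hN hl hμ hne hy hz hle
  have hyd := lowSpan_le_degS hκ lam hy.mem_lowSpan
  have hzd := lowSpan_le_degS hκ μ hz.mem_lowSpan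
  by_cases hE : besselEig κ a lam.1 = besselEig κ a μ.1
  swap
  · refine hB.eq_zero_of_eigen (by omega) hyd hzd hE ?_ hz.2
    rw [hy.2, sub_self]
    exact (hB.perp (p := 0) (by omega) hzd).zero_mem.2
  -- A subspace spanned by the Jack polynomials of a lower set of partitions is orthogonal to a
  -- Bessel polynomial of a partition outside this set, by the induction hypothesis.
  have perp_of_lower : ∀ (s : Set (Part n)) (ρ : Part n) (w : symSub n) (d : ℕ), IsLowerSet s →
      ρ ∉ s → IsBesselS hκ a ρ w → weight ρ.1 ≤ m → (∀ τ ∈ s, weight τ.1 ≤ d) →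
      d ≤ m → d + weight ρ.1 ≤ N → (∀ τ ∈ s, weight τ.1 + weight ρ.1 < N) →
      ∀ x ∈ Submodule.span ℂ (jackBasis hκ '' s), B x w = 0 := by
    intro s ρ w d hs hρ hw hρm hd hdm hdN hsN x hx
    have hwd := lowSpan_le_degS hκ ρ hw.mem_lowSpan
    refine (span_jack_le_of_isBesselS (a := a) hκ (N := hB.perp (p := d) (by omega) hwd) hs
      (fun τ hτ => ?_) hx).2
    obtain ⟨v, hv⟩ := exists_isBesselS hκ ha ((hd τ hτ).trans hdm)
    refine ⟨v, ⟨degS_mono hκ (hd τ hτ) (lowSpan_le_degS hκ τ hv.mem_lowSpan), ?_⟩, hv⟩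
    exact ih _ (hsN τ hτ) τ ρ v w rfl ((hd τ hτ).trans hdm) hρm
      (fun e => hρ (e ▸ hτ)) hv hw
  -- Equal eigenvalues exclude inclusion, along which the eigenvalues strictly decrease.
  have hμl : ¬ μ ≤ lam := fun h =>
    (besselEig_lt hκ ha (lt_of_le_of_ne h hne.symm) hl).ne hE
  have hl0 : lam.1 ≠ 0 := by
    intro h0
    apply hμl
    have : weight μ.1 = 0 := by
      have : weight lam.1 = 0 := by rw [h0]; simp [weight]
      omega
    intro i
    have := le_weight μ.1 i
    change μ.1 i ≤ lam.1 i
    omega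
  obtain ⟨σ, hσ⟩ := exists_coord_p1S_ne_zero hκ hl0
  set ψ := (jackBasis hκ).coord lam (p1S (jackBasis hκ σ)) with hψ
  obtain ⟨i, hi⟩ := coord_p1S hκ hσ
  have hwσ : weight lam.1 = weight σ.1 + 1 := by rw [hi, weight_add_single]
  have hσl : σ ≤ lam := show σ.1 ≤ lam.1 from hi ▸ le_self_add
  have hiA : Antitone (σ.1 + Pi.single i 1) := hi ▸ lam.2
  have hEσ : besselEig κ a μ.1 = besselEig κ a σ.1 + 2 * specR κ σ.1 i + a := by
    rw [← hE, hi, besselEig_add_single]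
  obtain ⟨w, hw⟩ := exists_isBesselS hκ ha (lam := σ) (by omega)
  have hwd := lowSpan_le_degS hκ σ hw.mem_lowSpan
  have hσμ : ¬ σ ≤ μ := by
    intro h
    have h1 : weight σ.1 ≤ weight μ.1 := weight_mono h
    -- Otherwise `μ` arises from `σ` by adding a box as well, but with another content than `lam`.
    rcases h1.lt_or_eq with h2 | h2
    · obtain ⟨j, hj⟩ := eq_add_single_of_le h (by omega)
      have hij : i ≠ j := by
        rintro rfl
        exact hne (Subtype.ext (hi.trans hj.symm))
      refine specR_ne hκ hiA (hj ▸ μ.2) hij ?_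
      have h3 : besselEig κ a μ.1 = _ := congrArg _ hj
      rw [besselEig_add_single] at h3
      linarith
    · have : σ = μ := by
        by_contra e
        exact (weight_lt (lt_of_le_of_ne h e)).ne h2
      exact hμl (this ▸ hσl)
  -- The eigenvalues differ: with `E(lam) = E(μ)`, the difference `E(μ + e_j) - E(σ)` is
  -- `2 (c_j(μ) + c_i(σ) + a)` for the shifted contents `c`, which is negative by the bound on `a`.
  have h1 : ∀ j, B (rowUp hκ j z) w = 0 := by
    intro j
    refine hB.eq_zero_of_eigen (by omega) (rowUp_mem_degS hκ j hzd) hwd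
      (c := besselEig κ a μ.1 + 2 * specR κ μ.1 j + a) ?_ ?_ hw.2
    · have e1 := specR_le hκ μ.1 j
      have e2 := specR_le hκ σ.1 i
      have e3 : (μ.1 j : ℝ) ≤ m := by exact_mod_cast (le_weight μ.1 j).trans hμ
      have e4 : (σ.1 i : ℝ) + 1 ≤ m := by
        have := (le_weight lam.1 i).trans hl
        rw [hi] at this
        simp only [Pi.add_apply, Pi.single_eq_same] at this
        exact_mod_cast this
      refine ne_of_lt ?_
      linarith
    · exact perp_of_lower (Set.Iic μ) σ w (weight μ.1) (isLowerSet_Iic μ) hσμ hw (by omega)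
        (fun τ hτ => weight_mono hτ) hμ (by omega)
        (fun τ hτ => by have : weight τ.1 ≤ weight μ.1 := weight_mono hτ; omega) _
        (besselS_rowUp hκ a μ j hz.mem_lowSpan hz.2)
  have h2 : B (p1S w) z = 0 := by
    rw [hB.p1S_left, ← hB.conj, ← sum_rowUp hκ, hB.sum_left (p := weight μ.1 + 1)
      (q := weight σ.1) (by omega) _ (fun j => rowUp_mem_degS hκ j hzd) hwd,
      Finset.sum_eq_zero fun j _ => h1 j, map_zero]
  have hperpσ : ∀ x ∈ lowSpan hκ σ, B x z = 0 :=
    perp_of_lower (Set.Iic σ) μ z (weight σ.1) (isLowerSet_Iic σ) (fun h => hμl (le_trans h hσl))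
      hz hμ (fun τ hτ => weight_mono hτ) (by omega) (by omega)
      (fun τ hτ => by have : weight τ.1 ≤ weight σ.1 := weight_mono hτ; omega)
  -- The boxes that can be added to `σ` have distinct contents, so `E(σ + e_j)` differs from
  -- `E(σ + e_i) = E(lam) = E(μ)`.
  have h3 : ∀ j, j ≠ i → B (rowUp hκ j w) z = 0 := by
    intro j hji
    by_cases hA : Antitone (σ.1 + Pi.single j 1)
    · refine hB.eq_zero_of_eigen (by omega) (rowUp_mem_degS hκ j hwd) hzd
        (c := besselEig κ a σ.1 + 2 * specR κ σ.1 j + a) ?_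
        (hperpσ _ (besselS_rowUp hκ a σ j hw.mem_lowSpan hw.2)) hz.2
      have := specR_ne hκ hA hiA hji
      intro e
      apply this
      linarith
    · exact hperpσ _ (rowUp_mem_lowSpan hκ hA hw.mem_lowSpan)
  -- Here `rowUp i w` and `ψ y` have the same leading term `ψ P_lam`, and all other terms are below.
  have h4 : B (rowUp hκ i w - ψ • y) z = 0 := by
    have hlow : IsLowerSet {τ : Part n | τ < lam} := fun τ ρ hρ hτ =>
      lt_of_le_of_lt hρ (Set.mem_ofPred.1 hτ)
    refine perp_of_lower {τ | τ < lam} μ z (weight lam.1) hlow (fun h => hμl (le_of_lt h)) hz hμ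
      (fun τ hτ => (weight_lt hτ).le) hl hN.le
      (fun τ hτ => by have := weight_lt (Set.mem_ofPred.1 hτ); omega) _ ?_
    have e1 : Submodule.span ℂ (jackBasis hκ '' {τ | τ < σ}) ≤
        (Submodule.span ℂ (jackBasis hκ '' {τ | τ < lam})).comap (rowUp hκ i) := by
      rw [Submodule.span_le]
      rintro _ ⟨τ, hτ, rfl⟩
      refine (mem_span_jack_iff hκ).2 fun ν hν => ?_
      rw [coord_rowUp] at hν
      have e : ν.1 = τ.1 + Pi.single i 1 := by
        by_contra e
        exact hν (if_neg e)
      change ν.1 < lam.1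
      rw [e, hi]
      exact add_lt_add_left (show τ.1 < σ.1 from hτ) _
    have e2 := e1 hw.1
    rw [Submodule.mem_comap, map_sub, rowUp_of_antitone hκ hi, ← hψ] at e2
    have e3 := sub_mem e2 (Submodule.smul_mem _ ψ hy.1)
    convert e3 using 1
    module
  have h5 : B (rowUp hκ i w) z = ψ * B y z := by
    have hd := rowUp_mem_degS hκ i hwd
    rw [← hwσ] at hd
    have := hB.add_left (p := weight lam.1) (q := weight μ.1) (by omega)
      (sub_mem hd (Submodule.smul_mem _ ψ hyd)) (Submodule.smul_mem _ ψ hyd) hzd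
    rwa [sub_add_cancel, h4, zero_add, hB.smul_left] at this
  rw [← sum_rowUp hκ, hB.sum_left (p := weight σ.1 + 1) (q := weight μ.1) (by omega) _
    (fun j => rowUp_mem_degS hκ j hwd) hzd, Finset.sum_eq_single i (fun j _ hj => h3 j hj)
    (by simp), h5] at h2
  exact (mul_eq_zero.1 h2).resolve_left hσ

/-! ### The one-variable weight -/

open Filter Topology MeasureTheory in
theorem tendsto_rpow_mul_exp_neg_div (p : ℝ) :
    Tendsto (fun t : ℝ => t ^ p * Real.exp (-2 / t)) (𝓝[>] 0) (𝓝 0) := by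
  have h := (tendsto_rpow_mul_exp_neg_mul_atTop_nhds_zero (-p) 2 two_pos).comp
    tendsto_inv_nhdsGT_zero
  refine h.congr' ?_
  filter_upwards [self_mem_nhdsWithin] with t ht
  have ht' : (0 : ℝ) < t := ht
  simp only [Function.comp]
  rw [Real.inv_rpow ht'.le, Real.rpow_neg ht'.le, inv_inv, div_eq_mul_inv]

/-- The function `t ^ p * exp (-2 / t)` on `(0, ∞)`, extended by zero to the line. -/
def wt (p t : ℝ) : ℝ := if 0 < t then t ^ p * Real.exp (-2 / t) else 0

theorem wt_of_pos (p : ℝ) {t : ℝ} (ht : 0 < t) : wt p t = t ^ p * Real.exp (-2 / t) := if_pos ht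

theorem wt_of_nonpos (p : ℝ) {t : ℝ} (ht : t ≤ 0) : wt p t = 0 := if_neg (not_lt.2 ht)

theorem wt_nonneg (p t : ℝ) : 0 ≤ wt p t := by
  rw [wt]; split_ifs with h
  · positivity
  · exact le_rfl

theorem wt_add_one (p t : ℝ) : wt (p + 1) t = t * wt p t := by
  rcases lt_or_ge 0 t with h | h
  · rw [wt_of_pos _ h, wt_of_pos _ h, Real.rpow_add_one h.ne']; ring
  · rw [wt_of_nonpos _ h, wt_of_nonpos _ h, mul_zero]

open Filter Topology in
/-- The extended weight is differentiable everywhere, since `exp (-2 / t)` is flat at `0`. -/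
theorem hasDerivAt_wt (p t : ℝ) : HasDerivAt (wt p) (p * wt (p - 1) t + 2 * wt (p - 2) t) t := by
  rcases lt_trichotomy t 0 with h | h | h
  · rw [wt_of_nonpos _ h.le, wt_of_nonpos _ h.le, mul_zero, mul_zero, add_zero]
    refine (hasDerivAt_const t (0 : ℝ)).congr_of_eventuallyEq ?_
    filter_upwards [Iio_mem_nhds h] with s hs
    exact wt_of_nonpos _ (le_of_lt hs)
  · subst h
    rw [wt_of_nonpos _ le_rfl, wt_of_nonpos _ le_rfl, mul_zero, mul_zero, add_zero,
      hasDerivAt_iff_tendsto_slope, ← nhdsLT_sup_nhdsGT, tendsto_sup]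
    constructor
    · refine tendsto_const_nhds.congr' ?_
      filter_upwards [self_mem_nhdsWithin] with s hs
      rw [slope_def_field, wt_of_nonpos _ (le_of_lt hs), wt_of_nonpos _ le_rfl, sub_self, zero_div]
    · refine (tendsto_rpow_mul_exp_neg_div (p - 1)).congr' ?_
      filter_upwards [self_mem_nhdsWithin] with s hs
      have hs' : (0 : ℝ) < s := hs
      rw [slope_def_field, wt_of_nonpos _ le_rfl, wt_of_pos _ hs', sub_zero, sub_zero,
        Real.rpow_sub_one hs'.ne']
      ring
  · have h1 : HasDerivAt (fun s : ℝ => s ^ p * Real.exp (-2 / s))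
        (p * t ^ (p - 1) * Real.exp (-2 / t) + t ^ p * (Real.exp (-2 / t) * (2 / t ^ 2))) t := by
      refine (Real.hasDerivAt_rpow_const (Or.inl h.ne')).mul (HasDerivAt.exp ?_)
      have h0 : HasDerivAt (fun s : ℝ => -2 / s) ((0 * t - -2 * 1) / t ^ 2) t :=
        (hasDerivAt_const t (-2 : ℝ)).div (hasDerivAt_id t) h.ne'
      rwa [zero_mul, mul_one, zero_sub, neg_neg] at h0
    have h2 : p * wt (p - 1) t + 2 * wt (p - 2) t =
        p * t ^ (p - 1) * Real.exp (-2 / t) + t ^ p * (Real.exp (-2 / t) * (2 / t ^ 2)) := by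
      rw [wt_of_pos _ h, wt_of_pos _ h, Real.rpow_sub h p 2, Real.rpow_two]
      ring
    rw [h2]
    refine h1.congr_of_eventuallyEq ?_
    filter_upwards [Ioi_mem_nhds h] with s hs
    exact wt_of_pos _ hs

theorem continuous_wt (p : ℝ) : Continuous (wt p) :=
  continuous_iff_continuousAt.2 fun t => (hasDerivAt_wt p t).continuousAt

open MeasureTheory in
theorem integrable_wt {p : ℝ} (hp : p < -1) : Integrable (wt p) := by
  rw [← integrableOn_univ, ← Set.Iic_union_Ioi (a := (1 : ℝ)), integrableOn_union]
  constructor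
  · rw [← Set.Iic_union_Ioc_eq_Iic zero_le_one, integrableOn_union]
    constructor
    · exact (integrableOn_zero (s := Set.Iic 0)).congr_fun
        (fun t ht => (wt_of_nonpos p ht).symm) measurableSet_Iic
    · exact ((continuous_wt p).integrableOn_Icc (a := 0) (b := 1)).mono_set Set.Ioc_subset_Icc_self
  · refine Integrable.mono' (integrableOn_Ioi_rpow_of_lt hp zero_lt_one)
      (continuous_wt p).aestronglyMeasurable ?_
    filter_upwards [ae_restrict_mem measurableSet_Ioi] with t ht
    have ht0 : (0 : ℝ) < t := lt_trans zero_lt_one ht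
    rw [Real.norm_of_nonneg (wt_nonneg p t), wt_of_pos _ ht0]
    refine mul_le_of_le_one_right (by positivity) (Real.exp_le_one_iff.2 ?_)
    exact div_nonpos_of_nonpos_of_nonneg (by norm_num) ht0.le

open MeasureTheory in
/-- The weight is integrable against a growth of order `S`: there is no singularity at `0`, and at
infinity the weight behaves like `t ^ p`. -/
theorem integrable_wt_mul_rpow {p S : ℝ} (hS : 0 ≤ S) (hp : p + S < -1) :
    Integrable fun t => wt p t * (1 + |t|) ^ S := by
  refine Integrable.mono' (((integrable_wt (p := p) (by linarith)).add
    (integrable_wt hp)).const_mul (2 ^ S)) ?_ ?_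
  · refine Continuous.aestronglyMeasurable ((continuous_wt p).mul ?_)
    exact (continuous_const.add continuous_abs).rpow_const fun t => Or.inr hS
  · refine Filter.Eventually.of_forall fun t => ?_
    rw [Real.norm_of_nonneg (mul_nonneg (wt_nonneg p t) (by positivity)), Pi.add_apply]
    rcases lt_or_ge 0 t with h | h
    · have h1 : (1 + |t|) ^ S ≤ 2 ^ S * (1 + t ^ S) := by
        rw [abs_of_pos h]
        rcases le_total t 1 with h1 | h1
        · calc (1 + t) ^ S ≤ 2 ^ S := Real.rpow_le_rpow (by linarith) (by linarith) hS
            _ ≤ 2 ^ S * (1 + t ^ S) := le_mul_of_one_le_right (by positivity)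
                (by linarith [Real.rpow_nonneg h.le S])
        · calc (1 + t) ^ S ≤ (2 * t) ^ S := Real.rpow_le_rpow (by linarith) (by linarith) hS
            _ = 2 ^ S * t ^ S := Real.mul_rpow two_pos.le h.le
            _ ≤ 2 ^ S * (1 + t ^ S) := by gcongr; linarith
      have h2 : wt (p + S) t = wt p t * t ^ S := by
        rw [wt_of_pos _ h, wt_of_pos _ h, Real.rpow_add h]; ring
      rw [h2]
      calc wt p t * (1 + |t|) ^ S ≤ wt p t * (2 ^ S * (1 + t ^ S)) :=
            mul_le_mul_of_nonneg_left h1 (wt_nonneg p t)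
        _ = _ := by ring
    · rw [wt_of_nonpos _ h, wt_of_nonpos _ h]; simp

/-! ### Growth of polynomials against the weight -/

/-- The growth function `∏ (1 + |x_i|)`. -/
def grow {n : ℕ} (x : Fin n → ℝ) : ℝ := ∏ i, (1 + |x i|)

theorem one_le_grow {n : ℕ} (x : Fin n → ℝ) : 1 ≤ grow x := by
  have h := Finset.prod_le_prod (s := Finset.univ) (f := fun _ : Fin n => (1 : ℝ))
    (fun _ _ => zero_le_one) fun i _ => le_add_of_nonneg_right (abs_nonneg (x i))
  rwa [Finset.prod_const_one] at h

/-- A continuous function bounded by a multiple of `∏ (1 + |x_i|) ^ d`. -/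
def IsTempered {n : ℕ} (d : ℕ) (G : (Fin n → ℝ) → ℂ) : Prop :=
  Continuous G ∧ ∃ C, ∀ x, ‖G x‖ ≤ C * grow x ^ d

namespace IsTempered

variable {n d e : ℕ} {F G : (Fin n → ℝ) → ℂ}

theorem add (hF : IsTempered d F) (hG : IsTempered d G) : IsTempered d (fun x => F x + G x) := by
  obtain ⟨hFc, C, hC⟩ := hF
  obtain ⟨hGc, D, hD⟩ := hG
  refine ⟨hFc.add hGc, C + D, fun x => (norm_add_le _ _).trans ?_⟩
  rw [add_mul]
  exact add_le_add (hC x) (hD x)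

theorem const_mul (c : ℂ) (hF : IsTempered d F) : IsTempered d (fun x => c * F x) := by
  obtain ⟨hFc, C, hC⟩ := hF
  refine ⟨continuous_const.mul hFc, ‖c‖ * C, fun x => ?_⟩
  rw [norm_mul, mul_assoc]
  exact mul_le_mul_of_nonneg_left (hC x) (norm_nonneg c)

theorem sub (hF : IsTempered d F) (hG : IsTempered d G) : IsTempered d (fun x => F x - G x) := by
  have := hF.add (hG.const_mul (-1))
  simpa [sub_eq_add_neg] using this

theorem sum {ι : Type*} (s : Finset ι) {F : ι → (Fin n → ℝ) → ℂ}
    (h : ∀ i ∈ s, IsTempered d (F i)) : IsTempered d (fun x => ∑ i ∈ s, F i x) := by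
  classical
  induction s using Finset.induction_on with
  | empty => exact ⟨by simpa using continuous_const, 0, fun x => by simp⟩
  | insert i s hi ih =>
    simp only [Finset.sum_insert hi]
    exact (h i (Finset.mem_insert_self i s)).add
      (ih fun j hj => h j (Finset.mem_insert_of_mem hj))

theorem mul (hF : IsTempered d F) (hG : IsTempered e G) :
    IsTempered (d + e) (fun x => F x * G x) := by
  obtain ⟨hFc, C, hC⟩ := hF
  obtain ⟨hGc, D, hD⟩ := hG
  refine ⟨hFc.mul hGc, C * D, fun x => ?_⟩
  rw [norm_mul, pow_add, mul_mul_mul_comm]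
  exact mul_le_mul (hC x) (hD x) (norm_nonneg _) ((norm_nonneg _).trans (hC x))

theorem mono (hde : d ≤ e) (hF : IsTempered d F) : IsTempered e F := by
  obtain ⟨hFc, C, hC⟩ := hF
  refine ⟨hFc, |C|, fun x => (hC x).trans ?_⟩
  exact mul_le_mul (le_abs_self C) (pow_le_pow_right₀ (one_le_grow x) hde)
    (pow_nonneg (zero_le_one.trans (one_le_grow x)) d) (abs_nonneg C)

theorem conj (hF : IsTempered d F) : IsTempered d (fun x => starRingEnd ℂ (F x)) := by
  obtain ⟨hFc, C, hC⟩ := hF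
  exact ⟨Complex.continuous_conj.comp hFc, C, fun x => by rw [RCLike.norm_conj]; exact hC x⟩

end IsTempered

theorem isTempered_evalReal {n d : ℕ} {p : MvPolynomial (Fin n) ℂ} (hp : p.totalDegree ≤ d) :
    IsTempered d (evalReal p) := by
  refine ⟨(MvPolynomial.continuous_eval p).comp
    (continuous_pi fun i => Complex.continuous_ofReal.comp (continuous_apply i)),
    ∑ α ∈ p.support, ‖coeff α p‖, fun x => ?_⟩
  rw [evalReal, eval_eq', Finset.sum_mul]
  refine (norm_sum_le _ _).trans (Finset.sum_le_sum fun α hα => ?_)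
  rw [norm_mul, norm_prod, grow, ← Finset.prod_pow]
  refine mul_le_mul_of_nonneg_left (Finset.prod_le_prod (fun i _ => norm_nonneg _) fun i _ => ?_)
    (norm_nonneg _)
  rw [norm_pow, Complex.norm_real, Real.norm_eq_abs]
  have h1 : α i ≤ d :=
    ((le_degreeOf_of_mem_support i hα).trans (degreeOf_le_totalDegree p i)).trans hp
  exact (pow_le_pow_left₀ (abs_nonneg _) (by linarith) _).trans
    (pow_le_pow_right₀ (by linarith [abs_nonneg (x i)]) h1)

theorem isTempered_mul_conj {n d : ℕ} {p q : MvPolynomial (Fin n) ℂ}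
    (h : p.totalDegree + q.totalDegree ≤ d) :
    IsTempered d (fun x => evalReal p x * starRingEnd ℂ (evalReal q x)) :=
  ((isTempered_evalReal le_rfl).mul (isTempered_evalReal le_rfl).conj).mono h

/-- The weight `∏ x_i ^ (a - 2) exp (-2 / x_i)` on the orthant, extended by zero. -/
def wtN {n : ℕ} (a : ℝ) (x : Fin n → ℝ) : ℝ := ∏ i, wt (a - 2) (x i)

theorem wtN_nonneg {n : ℕ} (a : ℝ) (x : Fin n → ℝ) : 0 ≤ wtN a x :=
  Finset.prod_nonneg fun _ _ => wt_nonneg _ _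

theorem continuous_wtN {n : ℕ} (a : ℝ) : Continuous (wtN a : (Fin n → ℝ) → ℝ) :=
  continuous_finsetProd _ fun i _ => (continuous_wt _).comp (continuous_apply i)

theorem continuous_grow {n : ℕ} : Continuous (grow : (Fin n → ℝ) → ℝ) :=
  continuous_finsetProd _ fun i _ => continuous_const.add (continuous_apply i).abs

/-- The weight together with a bound for the factor `∏ |x_i - x_j| ^ (2 κ)`, in which each variable
occurs `n - 1` times. For `n = 0` the truncated exponent does not matter, as `grow x = 1`. -/
def wtDom {n : ℕ} (κ a : ℝ) (x : Fin n → ℝ) : ℝ := wtN a x * (grow x ^ (2 * κ)) ^ (n - 1)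

theorem wtDom_nonneg {n : ℕ} (κ a : ℝ) (x : Fin n → ℝ) : 0 ≤ wtDom κ a x :=
  mul_nonneg (wtN_nonneg a x)
    (pow_nonneg (Real.rpow_nonneg (zero_le_one.trans (one_le_grow x)) _) _)

theorem continuous_wtDom {n : ℕ} {κ : ℝ} (hκ : 0 ≤ κ) (a : ℝ) :
    Continuous (wtDom κ a : (Fin n → ℝ) → ℝ) :=
  (continuous_wtN a).mul
    ((continuous_grow.rpow_const fun _ => Or.inr (by positivity)).pow _)

open MeasureTheory in
/-- The bound on `a` says that `(a - 2) + 2 κ (n - 1) + 2 m < -1`, which is integrability at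
infinity in each variable. -/
theorem integrable_wtDom {n m : ℕ} {κ a : ℝ} (hκ : 0 ≤ κ)
    (ha : a < -2 * ((m : ℝ) + κ * ((n : ℝ) - 1)) + 1) {G : (Fin n → ℝ) → ℂ}
    (hG : IsTempered (2 * m) G) : Integrable fun x => wtDom κ a x * ‖G x‖ := by
  obtain ⟨hGc, C, hC⟩ := hG
  have h1 : ∀ i : Fin n, Integrable fun t : ℝ =>
      wt (a - 2) t * (1 + |t|) ^ (2 * κ * ((n : ℝ) - 1) + 2 * m) := by
    intro i
    have h2 : (0 : ℝ) ≤ (n : ℝ) - 1 := by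
      have : (1 : ℝ) ≤ n := by exact_mod_cast i.pos
      linarith
    refine integrable_wt_mul_rpow ?_ ?_
    · have := mul_nonneg hκ h2
      positivity
    · linarith
  have h2 := Integrable.fintype_prod (fun i => h1 i)
  refine Integrable.mono' (h2.const_mul C)
    ((continuous_wtDom hκ a).mul hGc.norm).aestronglyMeasurable ?_
  refine Filter.Eventually.of_forall fun x => ?_
  rw [Real.norm_of_nonneg (mul_nonneg (wtDom_nonneg κ a x) (norm_nonneg _))]
  have h3 : ∏ i, (wt (a - 2) (x i) * (1 + |x i|) ^ (2 * κ * ((n : ℝ) - 1) + 2 * m)) =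
      wtDom κ a x * grow x ^ (2 * m) := by
    rw [wtDom, wtN, grow, ← Real.finsetProd_rpow _ _ (fun i _ => by positivity),
      ← Finset.prod_pow, ← Finset.prod_pow, ← Finset.prod_mul_distrib, ← Finset.prod_mul_distrib]
    refine Finset.prod_congr rfl fun i _ => ?_
    have hpos : 0 < 1 + |x i| := by positivity
    have e1 : (1 + |x i|) ^ (2 * κ * ((n : ℝ) - 1)) = ((1 + |x i|) ^ (2 * κ)) ^ (n - 1) := by
      rw [← Real.rpow_natCast, ← Real.rpow_mul hpos.le, Nat.cast_sub i.pos, Nat.cast_one]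
    have e2 : (1 + |x i|) ^ (2 * (m : ℝ)) = (1 + |x i|) ^ (2 * m) := by
      rw [← Real.rpow_natCast]; push_cast; rfl
    rw [Real.rpow_add hpos, e1, e2, mul_assoc]
  rw [h3]
  calc wtDom κ a x * ‖G x‖ ≤ wtDom κ a x * (C * grow x ^ (2 * m)) :=
        mul_le_mul_of_nonneg_left (hC x) (wtDom_nonneg κ a x)
    _ = _ := by ring

/-! ### The measure -/

/-- Each index belongs to `n - 1` of the pairs `k < l`. -/
theorem prod_Ioi_mul {n : ℕ} (A : Fin n → ℝ) :
    ∏ k, ∏ l ∈ Finset.Ioi k, A k * A l = (∏ k, A k) ^ (n - 1) := by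
  simp only [Finset.prod_mul_distrib, Finset.prod_const, Fin.card_Ioi]
  rw [Finset.prod_comm' (t' := Finset.univ) (s' := fun l => Finset.Iio l) (by simp)]
  simp only [Finset.prod_const, Fin.card_Iio]
  rw [← Finset.prod_mul_distrib, ← Finset.prod_pow]
  refine Finset.prod_congr rfl fun k _ => ?_
  rw [← pow_add]
  congr 1
  have := k.2
  omega

/-- The regularized factor `∏ ((x_k - x_l)² + ε) ^ κ`, which is smooth for `ε > 0`. -/
def vand {n : ℕ} (κ ε : ℝ) (x : Fin n → ℝ) : ℝ :=
  ∏ k, ∏ l ∈ Finset.Ioi k, ((x k - x l) ^ 2 + ε) ^ κ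

theorem vand_nonneg {n : ℕ} (κ : ℝ) {ε : ℝ} (hε : 0 ≤ ε) (x : Fin n → ℝ) : 0 ≤ vand κ ε x :=
  Finset.prod_nonneg fun _ _ => Finset.prod_nonneg fun _ _ =>
    Real.rpow_nonneg (add_nonneg (sq_nonneg _) hε) _

theorem continuous_vand {n : ℕ} {κ : ℝ} (hκ : 0 ≤ κ) (ε : ℝ) :
    Continuous (vand κ ε : (Fin n → ℝ) → ℝ) := by
  refine continuous_finsetProd _ fun k _ => continuous_finsetProd _ fun l _ => ?_
  exact Continuous.rpow_const (by fun_prop) fun _ => Or.inr hκ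

theorem tendsto_vand {n : ℕ} {κ : ℝ} (hκ : 0 ≤ κ) (x : Fin n → ℝ) :
    Filter.Tendsto (fun ε => vand κ ε x) (nhds 0) (nhds (vand κ 0 x)) := by
  have : Continuous fun ε => vand κ ε x := by
    refine continuous_finsetProd _ fun k _ => continuous_finsetProd _ fun l _ => ?_
    exact Continuous.rpow_const (by fun_prop) fun _ => Or.inr hκ
  exact this.tendsto 0

theorem vand_zero {n : ℕ} (κ : ℝ) (x : Fin n → ℝ) :
    vand κ 0 x = ∏ i, ∏ j ∈ Finset.Ioi i, |x i - x j| ^ (2 * κ) := by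
  refine Finset.prod_congr rfl fun k _ => Finset.prod_congr rfl fun l _ => ?_
  rw [add_zero, ← sq_abs, ← Real.rpow_natCast, ← Real.rpow_mul (abs_nonneg _)]
  norm_num

theorem vand_le {n : ℕ} {κ ε : ℝ} (hκ : 0 ≤ κ) (hε : 0 ≤ ε) (hε1 : ε ≤ 1) (x : Fin n → ℝ) :
    vand κ ε x ≤ (grow x ^ (2 * κ)) ^ (n - 1) := by
  rw [grow, ← Real.finsetProd_rpow _ _ (fun i _ => by positivity), ← prod_Ioi_mul]
  refine Finset.prod_le_prod (fun k _ => Finset.prod_nonneg fun l _ =>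
    Real.rpow_nonneg (add_nonneg (sq_nonneg _) hε) _) fun k _ => ?_
  refine Finset.prod_le_prod (fun l _ => Real.rpow_nonneg (add_nonneg (sq_nonneg _) hε) _)
    fun l _ => ?_
  have hk : 0 ≤ |x k| := abs_nonneg _
  have hl : 0 ≤ |x l| := abs_nonneg _
  have h1 : (x k - x l) ^ 2 + ε ≤ ((1 + |x k|) * (1 + |x l|)) ^ 2 := by
    have h2 : |x k - x l| ≤ |x k| + |x l| := abs_sub _ _
    have h3 : (x k - x l) ^ 2 ≤ (|x k| + |x l|) ^ 2 := by
      rw [← sq_abs (x k - x l)]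
      exact pow_le_pow_left₀ (abs_nonneg _) h2 2
    nlinarith [mul_nonneg hk hl, mul_nonneg hk hk, mul_nonneg hl hl,
      mul_nonneg (mul_nonneg hk hl) (mul_nonneg hk hl), mul_nonneg (mul_nonneg hk hl) hk,
      mul_nonneg (mul_nonneg hk hl) hl]
  calc ((x k - x l) ^ 2 + ε) ^ κ ≤ (((1 + |x k|) * (1 + |x l|)) ^ 2) ^ κ :=
        Real.rpow_le_rpow (add_nonneg (sq_nonneg _) hε) h1 hκ
    _ = _ := by
        rw [← Real.rpow_natCast, ← Real.rpow_mul (by positivity),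
          Real.mul_rpow (by positivity) (by positivity)]
        norm_num

open MeasureTheory in
/-- The measure has a density on the whole space, since `wt` vanishes off the half-line. -/
theorem besselMeasure_eq {n : ℕ} (κ a : ℝ) : besselMeasure n κ a =
    volume.withDensity fun x => ENNReal.ofReal (wtN a x * vand κ 0 x) := by
  rw [besselMeasure, ← withDensity_indicator]
  · congr 1
    funext x
    by_cases hx : x ∈ {x : Fin n → ℝ | ∀ i, 0 < x i}
    · rw [Set.indicator_of_mem hx, besselWeight, vand_zero, wtN]
      congr 2
      exact Finset.prod_congr rfl fun i _ => (wt_of_pos _ (hx i)).symm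
    · rw [Set.indicator_of_notMem hx]
      obtain ⟨i, hi⟩ := not_forall.1 hx
      have : wtN a x = 0 := Finset.prod_eq_zero (Finset.mem_univ i) (wt_of_nonpos _ (not_lt.1 hi))
      rw [this, zero_mul, ENNReal.ofReal_zero]
  · simp only [Set.ofPred_forall]
    exact MeasurableSet.iInter fun i => measurableSet_lt measurable_const (measurable_pi_apply i)

theorem continuous_density {n : ℕ} {κ : ℝ} (hκ : 0 ≤ κ) (a ε : ℝ) :
    Continuous fun x : Fin n → ℝ => wtN a x * vand κ ε x :=
  (continuous_wtN a).mul (continuous_vand hκ ε)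

theorem density_nonneg {n : ℕ} (κ a : ℝ) {ε : ℝ} (hε : 0 ≤ ε) (x : Fin n → ℝ) :
    0 ≤ wtN a x * vand κ ε x := mul_nonneg (wtN_nonneg a x) (vand_nonneg κ hε x)

theorem density_le {n : ℕ} {κ ε : ℝ} (hκ : 0 ≤ κ) (a : ℝ) (hε : 0 ≤ ε) (hε1 : ε ≤ 1)
    (x : Fin n → ℝ) : wtN a x * vand κ ε x ≤ wtDom κ a x :=
  mul_le_mul_of_nonneg_left (vand_le hκ hε hε1 x) (wtN_nonneg a x)

open MeasureTheory in
theorem integral_besselMeasure {n : ℕ} {κ : ℝ} (hκ : 0 ≤ κ) (a : ℝ) (F : (Fin n → ℝ) → ℂ) :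
    ∫ x, F x ∂besselMeasure n κ a = ∫ x, (wtN a x * vand κ 0 x : ℝ) • F x := by
  rw [besselMeasure_eq, integral_withDensity_eq_integral_toReal_smul
    (continuous_density hκ a 0).measurable.ennreal_ofReal (by simp)]
  refine integral_congr_ae (Filter.Eventually.of_forall fun x => ?_)
  simp only
  rw [ENNReal.toReal_ofReal (density_nonneg κ a le_rfl x)]

open MeasureTheory in
theorem integrable_besselMeasure {n : ℕ} {κ : ℝ} (hκ : 0 ≤ κ) (a : ℝ) (F : (Fin n → ℝ) → ℂ) :
    Integrable F (besselMeasure n κ a) ↔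
      Integrable fun x => (wtN a x * vand κ 0 x : ℝ) • F x := by
  rw [besselMeasure_eq, integrable_withDensity_iff_integrable_smul'
    (continuous_density hκ a 0).measurable.ennreal_ofReal (by simp)]
  refine integrable_congr (Filter.Eventually.of_forall fun x => ?_)
  simp only
  rw [ENNReal.toReal_ofReal (density_nonneg κ a le_rfl x)]

open MeasureTheory in
theorem IsTempered.integrable {n m : ℕ} {κ a : ℝ} (hκ : 0 ≤ κ)
    (ha : a < -2 * ((m : ℝ) + κ * ((n : ℝ) - 1)) + 1) {G : (Fin n → ℝ) → ℂ}
    (hG : IsTempered (2 * m) G) : Integrable G (besselMeasure n κ a) := by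
  rw [integrable_besselMeasure hκ]
  refine Integrable.mono' (integrable_wtDom hκ ha hG)
    ((continuous_density hκ a 0).smul hG.1).aestronglyMeasurable ?_
  refine Filter.Eventually.of_forall fun x => ?_
  rw [norm_smul, Real.norm_of_nonneg (density_nonneg κ a le_rfl x)]
  exact mul_le_mul_of_nonneg_right (density_le hκ a le_rfl zero_le_one x) (norm_nonneg _)

/-! ### Polynomial identities for `D^B` -/

theorem sum_erase_eq_sum_Ioi {n : ℕ} {M : Type*} [AddCommMonoid M] (F : Fin n → Fin n → M) :
    ∑ i, ∑ j ∈ Finset.univ.erase i, F i j = ∑ k, ∑ l ∈ Finset.Ioi k, (F k l + F l k) := by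
  have h1 : ∀ i : Fin n, ∑ j ∈ Finset.univ.erase i, F i j =
      ∑ j ∈ Finset.Ioi i, F i j + ∑ j ∈ Finset.Iio i, F i j := by
    intro i
    rw [← Finset.sum_union (Finset.disjoint_left.2 fun j h1 h2 => by
      simp only [Finset.mem_Ioi, Finset.mem_Iio] at h1 h2
      exact absurd h1 (not_lt.2 h2.le))]
    congr 1
    ext j
    simp only [Finset.mem_erase, Finset.mem_univ, and_true, Finset.mem_union, Finset.mem_Ioi,
      Finset.mem_Iio]
    rw [or_comm, ← ne_iff_lt_or_gt]
  rw [Finset.sum_congr rfl fun i _ => h1 i, Finset.sum_add_distrib]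
  simp only [Finset.sum_add_distrib]
  congr 1
  exact Finset.sum_comm' (by simp)

/-- `D^B` on symmetric polynomials, with the singular terms written as divided differences. -/
theorem coe_besselS {n : ℕ} (κ a : ℝ) (f : symSub n) :
    (besselS κ a f : MvPolynomial (Fin n) ℂ) =
      ∑ i, (X i ^ 2 * pderiv i (pderiv i (f : MvPolynomial (Fin n) ℂ)) +
        (C (a : ℂ) * X i + 2) * pderiv i (f : MvPolynomial (Fin n) ℂ)) +
      C (2 * (κ : ℂ)) * ∑ k, ∑ l ∈ Finset.Ioi k,
        divDiff k l (X k ^ 2 * pderiv k (f : MvPolynomial (Fin n) ℂ)) := by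
  apply toRat_injective
  rw [← besselOp_eq, besselOp, sum_erase_eq_sum_Ioi, Finset.sum_add_distrib]
  simp only [toRat]
  rw [map_add (algebraMap _ _) (_ + _), map_add (algebraMap _ _) (∑ i, X i ^ 2 * _),
    map_mul (algebraMap _ _) (C _)]
  congr 2
  rw [map_sum]
  refine Finset.sum_congr rfl fun k _ => ?_
  rw [map_sum]
  refine Finset.sum_congr rfl fun l hl => ?_
  have hkl : k ≠ l := (Finset.mem_Ioi.1 hl).ne
  have h := congrArg toRat
    (sub_mul_divDiff hkl (X k ^ 2 * pderiv k (f : MvPolynomial (Fin n) ℂ)))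
  rw [map_mul (rename _), map_pow (rename _), rename_X, rename_pderiv_of_sym f.2,
    swap_apply_left] at h
  have hne := toRat_sub_ne_zero hkl
  have hne' := toRat_sub_ne_zero hkl.symm
  simp only [toRat, map_mul, map_sub, map_pow] at h hne hne' ⊢
  field_simp
  linear_combination (algebraMap (MvPolynomial (Fin n) ℂ) (RatFun n) (X k) -
    algebraMap (MvPolynomial (Fin n) ℂ) (RatFun n) (X l)) * h

/-- The Wronskian `(∂_i f) g - f (∂_i g)`. -/
def wronsk {n : ℕ} (i : Fin n) (f g : MvPolynomial (Fin n) ℂ) : MvPolynomial (Fin n) ℂ :=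
  pderiv i f * g - f * pderiv i g

/-- The antisymmetric combination of divided differences that appears in Green's identity. -/
def wronskDiff {n : ℕ} (k l : Fin n) (f g : MvPolynomial (Fin n) ℂ) : MvPolynomial (Fin n) ℂ :=
  divDiff k l (X k ^ 2 * pderiv k f) * g - f * divDiff k l (X k ^ 2 * pderiv k g)

/-- For symmetric polynomials the divided differences combine the Wronskians in two directions. -/
theorem sub_mul_wronskDiff {n : ℕ} {k l : Fin n} (hkl : k ≠ l) (f g : symSub n) :
    (X k - X l) * wronskDiff k l (f : MvPolynomial (Fin n) ℂ) g =
      X k ^ 2 * wronsk k (f : MvPolynomial (Fin n) ℂ) g -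
        X l ^ 2 * wronsk l (f : MvPolynomial (Fin n) ℂ) g := by
  have h1 := sub_mul_divDiff hkl (X k ^ 2 * pderiv k (f : MvPolynomial (Fin n) ℂ))
  have h2 := sub_mul_divDiff hkl (X k ^ 2 * pderiv k (g : MvPolynomial (Fin n) ℂ))
  rw [map_mul (rename _), map_pow (rename _), rename_X, rename_pderiv_of_sym f.2,
    swap_apply_left] at h1
  rw [map_mul (rename _), map_pow (rename _), rename_X, rename_pderiv_of_sym g.2,
    swap_apply_left] at h2
  rw [wronskDiff, wronsk, wronsk]
  linear_combination (g : MvPolynomial (Fin n) ℂ) * h1 - (f : MvPolynomial (Fin n) ℂ) * h2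

/-- The part of Green's identity that does not come from the factor `∏ |x_i - x_j| ^ (2κ)`. -/
def greenMain {n : ℕ} (a : ℝ) (i : Fin n) (f g : MvPolynomial (Fin n) ℂ) :
    MvPolynomial (Fin n) ℂ :=
  (C (a : ℂ) * X i + 2) * wronsk i f g + X i ^ 2 * pderiv i (wronsk i f g)

/-- Green's identity for `D^B`: times the weight, the right side is the divergence of the vector
field with components `x_i² (∂_i f · g - f · ∂_i g)` times the weight. -/
theorem green {n : ℕ} (κ a : ℝ) (f g : symSub n) :
    (besselS κ a f : MvPolynomial (Fin n) ℂ) * (g : MvPolynomial (Fin n) ℂ) -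
      (f : MvPolynomial (Fin n) ℂ) * (besselS κ a g : MvPolynomial (Fin n) ℂ) =
      ∑ i, greenMain a i (f : MvPolynomial (Fin n) ℂ) g +
        C (2 * (κ : ℂ)) * ∑ k, ∑ l ∈ Finset.Ioi k,
          wronskDiff k l (f : MvPolynomial (Fin n) ℂ) g := by
  rw [coe_besselS, coe_besselS]
  simp only [wronskDiff, Finset.sum_sub_distrib, ← Finset.sum_mul, ← Finset.mul_sum]
  have h : ∑ i, greenMain a i (f : MvPolynomial (Fin n) ℂ) g =
      (∑ i, (X i ^ 2 * pderiv i (pderiv i (f : MvPolynomial (Fin n) ℂ)) +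
        (C (a : ℂ) * X i + 2) * pderiv i (f : MvPolynomial (Fin n) ℂ))) *
          (g : MvPolynomial (Fin n) ℂ) -
      (f : MvPolynomial (Fin n) ℂ) * ∑ i,
        (X i ^ 2 * pderiv i (pderiv i (g : MvPolynomial (Fin n) ℂ)) +
        (C (a : ℂ) * X i + 2) * pderiv i (g : MvPolynomial (Fin n) ℂ)) := by
    rw [Finset.sum_mul, Finset.mul_sum, ← Finset.sum_sub_distrib]
    refine Finset.sum_congr rfl fun i _ => ?_
    rw [greenMain, wronsk, map_sub, Derivation.leibniz, Derivation.leibniz]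
    simp only [smul_eq_mul]
    ring
  rw [h]
  ring

/-! ### Degrees -/

theorem degree_induction {n d : ℕ} {P : MvPolynomial (Fin n) ℂ → Prop}
    {f : MvPolynomial (Fin n) ℂ} (hf : f.totalDegree ≤ d)
    (hadd : ∀ f g, P f → P g → P (f + g)) (h0 : P 0)
    (hmon : ∀ α : Fin n →₀ ℕ, α.degree ≤ d → ∀ c, P (monomial α c)) : P f := by
  rw [f.as_sum]
  have : ∀ s ⊆ f.support, P (∑ α ∈ s, monomial α (coeff α f)) := by
    intro s
    induction s using Finset.induction_on with
    | empty => intro _; simpa using h0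
    | insert α s hα ih =>
      intro hs
      rw [Finset.sum_insert hα]
      refine hadd _ _ (hmon α ?_ _) (ih fun β hβ => hs (Finset.mem_insert_of_mem hβ))
      exact (le_totalDegree (hs (Finset.mem_insert_self α s))).trans hf
  exact this _ subset_rfl

theorem totalDegree_pderiv_le_of_le {n d : ℕ} {f : MvPolynomial (Fin n) ℂ} (hf : f.totalDegree ≤ d)
    (i : Fin n) : (pderiv i f).totalDegree ≤ d := by
  refine degree_induction (P := fun f => (pderiv i f).totalDegree ≤ d) hf
    (fun f g hf hg => ?_) (by simp) fun α hα c => ?_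
  · rw [map_add]; exact (totalDegree_add _ _).trans (max_le hf hg)
  · rw [pderiv_monomial]
    refine (totalDegree_monomial_le _ _).trans (le_trans ?_ hα)
    exact Finsupp.degree_mono tsub_le_self

theorem totalDegree_X_mul_pderiv_le {n d : ℕ} {f : MvPolynomial (Fin n) ℂ}
    (hf : f.totalDegree ≤ d) (i : Fin n) : (X i * pderiv i f).totalDegree ≤ d := by
  refine degree_induction (P := fun f => (X i * pderiv i f).totalDegree ≤ d) hf
    (fun f g hf hg => ?_) (by simp) fun α hα c => ?_
  · rw [map_add, mul_add]; exact (totalDegree_add _ _).trans (max_le hf hg)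
  · rw [X_mul_pderiv_monomial]
    exact (totalDegree_smul_le _ _).trans ((totalDegree_monomial_le _ _).trans hα)

theorem totalDegree_divDiff_le {n d : ℕ} {k l : Fin n} (hkl : k ≠ l) {p : MvPolynomial (Fin n) ℂ}
    (hp : p.totalDegree ≤ d + 1) : (divDiff k l p).totalDegree ≤ d := by
  by_cases h0 : divDiff k l p = 0
  · simp [h0]
  have h1 := congrArg totalDegree (sub_mul_divDiff hkl p)
  rw [totalDegree_mul_of_isDomain (X_sub_X_ne_zero hkl) h0] at h1
  have h2 : (p - rename (swap k l) p).totalDegree ≤ d + 1 :=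
    (totalDegree_sub _ _).trans (max_le hp ((totalDegree_rename_le _ _).trans hp))
  have h3 : 1 ≤ (X k - X l : MvPolynomial (Fin n) ℂ).totalDegree := by
    have : Finsupp.single k 1 ∈ (X k - X l : MvPolynomial (Fin n) ℂ).support := by
      rw [mem_support_iff, coeff_sub, coeff_X, coeff_X, if_pos rfl, if_neg]
      · simp
      · intro e
        exact hkl ((Finsupp.single_left_inj one_ne_zero).1 e).symm
    simpa using le_totalDegree this
  omega

theorem totalDegree_X_sq_mul_pderiv_le {n d : ℕ} {f : MvPolynomial (Fin n) ℂ}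
    (hf : f.totalDegree ≤ d) (i : Fin n) : (X i ^ 2 * pderiv i f).totalDegree ≤ d + 1 := by
  have e : X i ^ 2 * pderiv i f = X i * (X i * pderiv i f) := by ring
  rw [e]
  refine (totalDegree_mul _ _).trans ?_
  rw [totalDegree_X, add_comm]
  exact Nat.add_le_add_right (totalDegree_X_mul_pderiv_le hf i) 1

theorem totalDegree_mul_le_of_le {n d e : ℕ} {f g : MvPolynomial (Fin n) ℂ}
    (hf : f.totalDegree ≤ d) (hg : g.totalDegree ≤ e) : (f * g).totalDegree ≤ d + e :=
  (totalDegree_mul _ _).trans (Nat.add_le_add hf hg)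

theorem totalDegree_sub_le_of_le {n d : ℕ} {f g : MvPolynomial (Fin n) ℂ}
    (hf : f.totalDegree ≤ d) (hg : g.totalDegree ≤ d) : (f - g).totalDegree ≤ d :=
  (totalDegree_sub _ _).trans (max_le hf hg)

theorem totalDegree_wronskDiff_le {n d e : ℕ} {k l : Fin n} (hkl : k ≠ l)
    {f g : MvPolynomial (Fin n) ℂ} (hf : f.totalDegree ≤ d) (hg : g.totalDegree ≤ e) :
    (wronskDiff k l f g).totalDegree ≤ d + e :=
  totalDegree_sub_le_of_le
    (totalDegree_mul_le_of_le
      (totalDegree_divDiff_le hkl (totalDegree_X_sq_mul_pderiv_le hf k)) hg)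
    (totalDegree_mul_le_of_le hf
      (totalDegree_divDiff_le hkl (totalDegree_X_sq_mul_pderiv_le hg k)))

theorem totalDegree_wronsk_le {n d e : ℕ} (i : Fin n) {f g : MvPolynomial (Fin n) ℂ}
    (hf : f.totalDegree ≤ d) (hg : g.totalDegree ≤ e) : (wronsk i f g).totalDegree ≤ d + e :=
  totalDegree_sub_le_of_le (totalDegree_mul_le_of_le (totalDegree_pderiv_le_of_le hf i) hg)
    (totalDegree_mul_le_of_le hf (totalDegree_pderiv_le_of_le hg i))

theorem totalDegree_X_mul_wronsk_le {n d e : ℕ} (i : Fin n) {f g : MvPolynomial (Fin n) ℂ}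
    (hf : f.totalDegree ≤ d) (hg : g.totalDegree ≤ e) :
    (X i * wronsk i f g).totalDegree ≤ d + e := by
  have h : X i * wronsk i f g = X i * pderiv i f * g - f * (X i * pderiv i g) := by
    rw [wronsk]; ring
  rw [h]
  exact totalDegree_sub_le_of_le
    (totalDegree_mul_le_of_le (totalDegree_X_mul_pderiv_le hf i) hg)
    (totalDegree_mul_le_of_le hf (totalDegree_X_mul_pderiv_le hg i))

/-- The term `x_i² ∂_i h` has degree one more than `h` in general; for a Wronskian `h`, also `x_i h`
has degree at most `d + e`, which makes up for it. -/
theorem totalDegree_greenMain_le {n d e : ℕ} (a : ℝ) (i : Fin n) {f g : MvPolynomial (Fin n) ℂ}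
    (hf : f.totalDegree ≤ d) (hg : g.totalDegree ≤ e) :
    (greenMain a i f g).totalDegree ≤ d + e := by
  have h1 := totalDegree_wronsk_le i hf hg
  have h2 := totalDegree_X_mul_wronsk_le i hf hg
  have h3 := totalDegree_X_mul_pderiv_le h2 i
  have h : greenMain a i f g = ((a : ℂ) • (X i * wronsk i f g) + (2 : ℂ) • wronsk i f g) +
      (X i * pderiv i (X i * wronsk i f g) - X i * wronsk i f g) := by
    rw [greenMain, Derivation.leibniz, pderiv_X_self, smul_eq_C_mul, two_smul]
    simp only [smul_eq_mul]
    ring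
  rw [h]
  refine (totalDegree_add _ _).trans (max_le ((totalDegree_add _ _).trans (max_le ?_ ?_))
    (totalDegree_sub_le_of_le h3 h2))
  · exact (totalDegree_smul_le _ _).trans h2
  · exact (totalDegree_smul_le _ _).trans h1

/-! ### Directional derivatives -/

section LineDeriv

variable {n : ℕ} {x v : Fin n → ℝ}

theorem hasLineDerivAt_coord (k : Fin n) :
    HasLineDerivAt ℝ (fun y : Fin n → ℝ => y k) (v k) x v := by
  have h : HasDerivAt (fun t : ℝ => x k + t * v k) (1 * v k) 0 :=
    ((hasDerivAt_id (0 : ℝ)).mul_const (v k)).const_add (x k)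
  simpa [HasLineDerivAt] using h

theorem hasLineDerivAt_mul {A : Type*} [NormedRing A] [NormedAlgebra ℝ A]
    {F G : (Fin n → ℝ) → A} {F' G' : A} (hF : HasLineDerivAt ℝ F F' x v)
    (hG : HasLineDerivAt ℝ G G' x v) :
    HasLineDerivAt ℝ (fun y => F y * G y) (F' * G x + F x * G') x v := by
  have := HasDerivAt.fun_mul hF hG
  simp only [zero_smul, add_zero] at this
  exact this

theorem hasLineDerivAt_add {A : Type*} [NormedAddCommGroup A] [NormedSpace ℝ A]
    {F G : (Fin n → ℝ) → A} {F' G' : A} (hF : HasLineDerivAt ℝ F F' x v)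
    (hG : HasLineDerivAt ℝ G G' x v) :
    HasLineDerivAt ℝ (fun y => F y + G y) (F' + G') x v :=
  HasDerivAt.fun_add hF hG

theorem hasLineDerivAt_sub {A : Type*} [NormedAddCommGroup A] [NormedSpace ℝ A]
    {F G : (Fin n → ℝ) → A} {F' G' : A} (hF : HasLineDerivAt ℝ F F' x v)
    (hG : HasLineDerivAt ℝ G G' x v) :
    HasLineDerivAt ℝ (fun y => F y - G y) (F' - G') x v :=
  HasDerivAt.fun_sub hF hG

theorem hasLineDerivAt_sum {A ι : Type*} [NormedAddCommGroup A] [NormedSpace ℝ A]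
    {s : Finset ι} {F : ι → (Fin n → ℝ) → A} {F' : ι → A}
    (hF : ∀ i ∈ s, HasLineDerivAt ℝ (F i) (F' i) x v) :
    HasLineDerivAt ℝ (fun y => ∑ i ∈ s, F i y) (∑ i ∈ s, F' i) x v :=
  HasDerivAt.fun_sum hF

theorem hasLineDerivAt_comp {g : ℝ → ℝ} {g' : ℝ} {F : (Fin n → ℝ) → ℝ} {F' : ℝ}
    (hg : HasDerivAt g g' (F x)) (hF : HasLineDerivAt ℝ F F' x v) :
    HasLineDerivAt ℝ (fun y => g (F y)) (g' * F') x v := by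
  have h0 : F x = (fun t : ℝ => F (x + t • v)) 0 := by simp
  rw [h0] at hg
  exact HasDerivAt.comp (0 : ℝ) hg hF

theorem hasLineDerivAt_const {A : Type*} [NormedAddCommGroup A] [NormedSpace ℝ A] (c : A) :
    HasLineDerivAt ℝ (fun _ : Fin n → ℝ => c) 0 x v :=
  hasDerivAt_const (0 : ℝ) c

theorem hasLineDerivAt_ofReal {F : (Fin n → ℝ) → ℝ} {F' : ℝ} (hF : HasLineDerivAt ℝ F F' x v) :
    HasLineDerivAt ℝ (fun y => (F y : ℂ)) (F' : ℂ) x v :=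
  HasDerivAt.ofReal_comp hF

theorem hasLineDerivAt_evalReal (p : MvPolynomial (Fin n) ℂ) (i : Fin n) :
    HasLineDerivAt ℝ (evalReal p) (evalReal (pderiv i p) x) x (Pi.single i 1) := by
  induction p using MvPolynomial.induction_on with
  | C c =>
    have h : evalReal (C c : MvPolynomial (Fin n) ℂ) = fun _ => c := by
      funext y; rw [evalReal, eval_C]
    rw [h, pderiv_C, evalReal, map_zero]
    exact hasLineDerivAt_const c
  | add p q hp hq =>
    have h : evalReal (p + q) = fun y => evalReal p y + evalReal q y := by
      funext y; simp only [evalReal, map_add]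
    have h2 : evalReal (pderiv i (p + q)) x =
        evalReal (pderiv i p) x + evalReal (pderiv i q) x := by
      simp only [evalReal, map_add]
    rw [h, h2]
    exact hasLineDerivAt_add hp hq
  | mul_X p k hp =>
    have h1 := hasLineDerivAt_mul hp
      (hasLineDerivAt_ofReal (hasLineDerivAt_coord (x := x) (v := Pi.single i 1) k))
    have h2 : evalReal (pderiv i (p * X k)) x = evalReal (pderiv i p) x * (x k : ℂ) +
        evalReal p x * (((Pi.single i 1 : Fin n → ℝ) k : ℝ) : ℂ) := by
      rw [Derivation.leibniz, pderiv_X]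
      simp only [evalReal, smul_eq_mul, map_add, map_mul, eval_X]
      by_cases hki : k = i
      · subst hki; simp; ring
      · simp [hki]; ring
    have h3 : evalReal (p * X k) = fun y => evalReal p y * (y k : ℂ) := by
      funext y; simp only [evalReal, map_mul, eval_X]
    rw [h2, h3]
    exact h1

end LineDeriv

open MeasureTheory in
/-- Integration by parts against the constant function `1`. -/
theorem integral_lineDeriv_eq_zero {n : ℕ} {u u' : (Fin n → ℝ) → ℂ} {v : Fin n → ℝ}
    (hu : Integrable u) (hu' : Integrable u') (h : ∀ x, HasLineDerivAt ℝ u (u' x) x v) :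
    ∫ x, u' x = 0 := by
  have := integral_bilinear_hasLineDerivAt_right_eq_neg_left_of_integrable (μ := volume)
    (f := fun _ : Fin n → ℝ => (1 : ℂ)) (f' := fun _ => 0) (g := u) (g' := u') (v := v)
    (B := ContinuousLinearMap.mul ℝ ℂ) (by simp) (by simpa using hu') (by simpa using hu)
    (fun x _ => hasLineDerivAt_const 1) (fun x _ => h x)
  simpa using this

/-! ### The regularized weight -/

/-- A factor that decreases at infinity and converges to `1` as `ε → 0`. -/
def cut {n : ℕ} (ε : ℝ) (x : Fin n → ℝ) : ℝ := ∏ j, (1 + ε * x j ^ 2)⁻¹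

/-- The regularized weight. For `ε > 0` it has no singularities on the diagonals, and it gains
enough decay to make the vector field of Green's identity integrable. -/
def dens {n : ℕ} (κ a ε : ℝ) (x : Fin n → ℝ) : ℝ := wtN a x * (vand κ ε x * cut ε x)

/-- The logarithmic derivative in the direction `i` of the regularizing factors. -/
def logDer {n : ℕ} (κ ε : ℝ) (i : Fin n) (x : Fin n → ℝ) : ℝ :=
  κ * (∑ k, ∑ l ∈ Finset.Ioi k, 2 * (x k - x l) / ((x k - x l) ^ 2 + ε) *
    ((Pi.single i 1 : Fin n → ℝ) k - (Pi.single i 1 : Fin n → ℝ) l)) -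
    2 * ε * x i / (1 + ε * x i ^ 2)

/-- Writing the regularizing factors as an exponential gives their logarithmic derivative. -/
theorem vand_mul_cut {n : ℕ} (κ : ℝ) {ε : ℝ} (hε : 0 < ε) (x : Fin n → ℝ) :
    vand κ ε x * cut ε x = Real.exp (κ * (∑ k, ∑ l ∈ Finset.Ioi k,
      Real.log ((x k - x l) ^ 2 + ε)) - ∑ j, Real.log (1 + ε * x j ^ 2)) := by
  rw [sub_eq_add_neg, Real.exp_add, Finset.mul_sum, Real.exp_sum, ← Finset.sum_neg_distrib,
    Real.exp_sum, vand, cut]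
  congr 1
  · refine Finset.prod_congr rfl fun k _ => ?_
    rw [Finset.mul_sum, Real.exp_sum]
    refine Finset.prod_congr rfl fun l _ => ?_
    rw [Real.rpow_def_of_pos (by positivity), mul_comm]
  · refine Finset.prod_congr rfl fun j _ => ?_
    rw [Real.exp_neg, Real.exp_log (by positivity)]

theorem hasLineDerivAt_vand_mul_cut {n : ℕ} (κ : ℝ) {ε : ℝ} (hε : 0 < ε) (i : Fin n)
    (x : Fin n → ℝ) : HasLineDerivAt ℝ (fun y => vand κ ε y * cut ε y)
      (vand κ ε x * cut ε x * logDer κ ε i x) x (Pi.single i 1) := by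
  have h1 : ∀ k l : Fin n, HasLineDerivAt ℝ (fun y : Fin n → ℝ => Real.log ((y k - y l) ^ 2 + ε))
      (2 * (x k - x l) / ((x k - x l) ^ 2 + ε) *
        ((Pi.single i 1 : Fin n → ℝ) k - (Pi.single i 1 : Fin n → ℝ) l)) x (Pi.single i 1) := by
    intro k l
    refine hasLineDerivAt_comp (g := fun t => Real.log (t ^ 2 + ε)) (F := fun y => y k - y l) ?_
      (hasLineDerivAt_sub (hasLineDerivAt_coord k) (hasLineDerivAt_coord l))
    refine HasDerivAt.log ?_ (by positivity)
    simpa using (hasDerivAt_pow 2 (x k - x l)).add_const ε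
  have h2 : ∀ j : Fin n, HasLineDerivAt ℝ (fun y : Fin n → ℝ => Real.log (1 + ε * y j ^ 2))
      (2 * ε * x j / (1 + ε * x j ^ 2) * (Pi.single i 1 : Fin n → ℝ) j) x (Pi.single i 1) := by
    intro j
    refine hasLineDerivAt_comp (g := fun t => Real.log (1 + ε * t ^ 2)) (F := fun y => y j) ?_
      (hasLineDerivAt_coord j)
    refine HasDerivAt.log ?_ (by positivity)
    have h0 : HasDerivAt (fun t : ℝ => 1 + ε * t ^ 2) (ε * ((2 : ℕ) * x j ^ (2 - 1))) (x j) :=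
      ((hasDerivAt_pow 2 (x j)).const_mul ε).const_add 1
    have e : ε * ((2 : ℕ) * x j ^ (2 - 1)) = 2 * ε * x j := by
      push_cast; ring
    rwa [e] at h0
  have h3 := hasLineDerivAt_sub (hasLineDerivAt_mul (hasLineDerivAt_const κ)
    (hasLineDerivAt_sum (s := Finset.univ) fun k _ =>
      hasLineDerivAt_sum (s := Finset.Ioi k) fun l _ => h1 k l))
    (hasLineDerivAt_sum (s := Finset.univ) fun j _ => h2 j)
  have h4 := hasLineDerivAt_comp (Real.hasDerivAt_exp _) h3
  simp only [vand_mul_cut κ hε]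
  convert h4 using 1
  rw [logDer, zero_mul, zero_add, Finset.sum_eq_single (f := fun j => 2 * ε * x j /
    (1 + ε * x j ^ 2) * (Pi.single i 1 : Fin n → ℝ) j) i]
  · simp
  · intro j _ hj; simp [hj]
  · simp

/-- The first-order coefficient of `D^B` is the logarithmic derivative of `x_i ^ a exp (-2 / x_i)`,
times `x_i²`. -/
theorem hasLineDerivAt_sq_mul_wtN {n : ℕ} (a : ℝ) (i : Fin n) (x : Fin n → ℝ) :
    HasLineDerivAt ℝ (fun y : Fin n → ℝ => y i ^ 2 * wtN a y) ((a * x i + 2) * wtN a x) x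
      (Pi.single i 1) := by
  have h1 : ∀ t : ℝ, t ^ 2 * wt (a - 2) t = wt a t := by
    intro t
    have e1 := wt_add_one (a - 2) t
    have e2 := wt_add_one (a - 2 + 1) t
    rw [e1, show a - 2 + 1 + 1 = a by ring] at e2
    rw [e2]; ring
  have h2 : ∀ y : Fin n → ℝ, y i ^ 2 * wtN a y =
      wt a (y i) * ∏ j ∈ Finset.univ.erase i, wt (a - 2) (y j) := by
    intro y
    rw [wtN, ← Finset.mul_prod_erase _ _ (Finset.mem_univ i), ← mul_assoc, h1]
  have h3 : HasDerivAt (fun t : ℝ => wt a (x i + t) *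
      ∏ j ∈ Finset.univ.erase i, wt (a - 2) (x j))
      ((a * wt (a - 1) (x i + 0) + 2 * wt (a - 2) (x i + 0)) *
        ∏ j ∈ Finset.univ.erase i, wt (a - 2) (x j)) 0 :=
    (HasDerivAt.comp_const_add (x i) 0 (hasDerivAt_wt a (x i + 0))).mul_const _
  have h4 : (a * wt (a - 1) (x i + 0) + 2 * wt (a - 2) (x i + 0)) *
      ∏ j ∈ Finset.univ.erase i, wt (a - 2) (x j) = (a * x i + 2) * wtN a x := by
    have e1 := wt_add_one (a - 2) (x i)
    rw [show a - 2 + 1 = a - 1 by ring] at e1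
    rw [add_zero, e1, wtN, ← Finset.mul_prod_erase _ _ (Finset.mem_univ i)]
    ring
  rw [h4] at h3
  refine h3.congr_of_eventuallyEq (Filter.Eventually.of_forall fun t => ?_)
  simp only [h2]
  congr 1
  · simp
  · refine Finset.prod_congr rfl fun j hj => ?_
    simp [Finset.ne_of_mem_erase hj]

theorem cut_nonneg {n : ℕ} {ε : ℝ} (hε : 0 ≤ ε) (x : Fin n → ℝ) : 0 ≤ cut ε x :=
  Finset.prod_nonneg fun _ _ => by positivity

theorem cut_le_one {n : ℕ} {ε : ℝ} (hε : 0 ≤ ε) (x : Fin n → ℝ) : cut ε x ≤ 1 :=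
  Finset.prod_le_one (fun _ _ => by positivity) fun j _ =>
    inv_le_one_of_one_le₀ (le_add_of_nonneg_right (by positivity))

theorem sq_mul_cut_le {n : ℕ} {ε : ℝ} (hε : 0 < ε) (i : Fin n) (x : Fin n → ℝ) :
    x i ^ 2 * cut ε x ≤ ε⁻¹ := by
  rw [cut, ← Finset.mul_prod_erase _ _ (Finset.mem_univ i), ← mul_assoc]
  have h1 : x i ^ 2 * (1 + ε * x i ^ 2)⁻¹ ≤ ε⁻¹ := by
    rw [← div_eq_mul_inv, div_le_iff₀ (by positivity), mul_add, mul_one,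
      inv_mul_cancel_left₀ hε.ne']
    exact le_add_of_nonneg_left (by positivity)
  have h2 : ∏ j ∈ Finset.univ.erase i, (1 + ε * x j ^ 2)⁻¹ ≤ 1 :=
    Finset.prod_le_one (fun _ _ => by positivity) fun j _ =>
      inv_le_one_of_one_le₀ (le_add_of_nonneg_right (by positivity))
  calc _ ≤ ε⁻¹ * 1 := mul_le_mul h1 h2 (Finset.prod_nonneg fun _ _ => by positivity)
        (by positivity)
    _ = ε⁻¹ := mul_one _

theorem dens_nonneg {n : ℕ} (κ a : ℝ) {ε : ℝ} (hε : 0 ≤ ε) (x : Fin n → ℝ) :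
    0 ≤ dens κ a ε x :=
  mul_nonneg (wtN_nonneg a x) (mul_nonneg (vand_nonneg κ hε x) (cut_nonneg hε x))

theorem dens_le {n : ℕ} {κ ε : ℝ} (hκ : 0 ≤ κ) (a : ℝ) (hε : 0 ≤ ε) (hε1 : ε ≤ 1)
    (x : Fin n → ℝ) : dens κ a ε x ≤ wtDom κ a x := by
  rw [dens, ← mul_assoc]
  exact (mul_le_of_le_one_right (density_nonneg κ a hε x) (cut_le_one hε x)).trans
    (density_le hκ a hε hε1 x)

theorem sq_mul_dens_le {n : ℕ} {κ ε : ℝ} (hκ : 0 ≤ κ) (a : ℝ) (hε : 0 < ε) (hε1 : ε ≤ 1)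
    (i : Fin n) (x : Fin n → ℝ) : x i ^ 2 * dens κ a ε x ≤ ε⁻¹ * wtDom κ a x := by
  have h : x i ^ 2 * dens κ a ε x = (x i ^ 2 * cut ε x) * (wtN a x * vand κ ε x) := by
    rw [dens]; ring
  rw [h]
  exact mul_le_mul (sq_mul_cut_le hε i x) (density_le hκ a hε.le hε1 x)
    (density_nonneg κ a hε.le x) (by positivity)

theorem continuous_cut {n : ℕ} {ε : ℝ} (hε : 0 ≤ ε) : Continuous (cut ε : (Fin n → ℝ) → ℝ) :=
  continuous_finsetProd _ fun j _ => Continuous.inv₀ (by fun_prop) fun x => by positivity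

theorem continuous_dens {n : ℕ} {κ ε : ℝ} (hκ : 0 ≤ κ) (a : ℝ) (hε : 0 ≤ ε) :
    Continuous (dens κ a ε : (Fin n → ℝ) → ℝ) :=
  (continuous_wtN a).mul ((continuous_vand hκ ε).mul (continuous_cut hε))

theorem continuous_logDer {n : ℕ} (κ : ℝ) {ε : ℝ} (hε : 0 < ε) (i : Fin n) :
    Continuous (logDer κ ε i : (Fin n → ℝ) → ℝ) := by
  refine Continuous.sub (continuous_const.mul (continuous_finsetSum _ fun k _ =>
    continuous_finsetSum _ fun l _ => Continuous.mul ?_ continuous_const)) ?_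
  · exact Continuous.div (by fun_prop) (by fun_prop) fun x => by positivity
  · exact Continuous.div (by fun_prop) (by fun_prop) fun x => by positivity

theorem exists_logDer_le {n : ℕ} {κ ε : ℝ} (hκ : 0 ≤ κ) (hε : 0 < ε) (hε1 : ε ≤ 1) (i : Fin n) :
    ∃ M, ∀ x : Fin n → ℝ, |logDer κ ε i x| ≤ M := by
  refine ⟨κ * (∑ k : Fin n, ∑ l ∈ Finset.Ioi k, ε⁻¹) + 1, fun x => ?_⟩
  refine (abs_sub _ _).trans (add_le_add ?_ ?_)
  · rw [abs_mul, abs_of_nonneg hκ]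
    refine mul_le_mul_of_nonneg_left ?_ hκ
    refine (Finset.abs_sum_le_sum_abs _ _).trans (Finset.sum_le_sum fun k _ => ?_)
    refine (Finset.abs_sum_le_sum_abs _ _).trans (Finset.sum_le_sum fun l _ => ?_)
    rw [abs_mul]
    have h1 : |(Pi.single i 1 : Fin n → ℝ) k - (Pi.single i 1 : Fin n → ℝ) l| ≤ 1 := by
      simp only [Pi.single_apply]
      split_ifs <;> norm_num
    have h2 : |2 * (x k - x l) / ((x k - x l) ^ 2 + ε)| ≤ ε⁻¹ := by
      set t := x k - x l
      rw [abs_div, abs_of_pos (show 0 < t ^ 2 + ε by positivity), div_le_iff₀ (by positivity),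
        mul_add, inv_mul_cancel₀ hε.ne', abs_mul, abs_two, ← sq_abs t]
      have h3 : 1 ≤ ε⁻¹ := (one_le_inv₀ hε).2 hε1
      nlinarith [sq_nonneg (|t| - 1), sq_nonneg |t|]
    calc _ ≤ ε⁻¹ * 1 := mul_le_mul h2 h1 (abs_nonneg _) (by positivity)
      _ = ε⁻¹ := mul_one _
  · rw [abs_div, abs_of_pos (show 0 < 1 + ε * x i ^ 2 by positivity), div_le_one (by positivity),
      abs_mul, abs_of_pos (show 0 < 2 * ε by positivity), ← sq_abs (x i)]
    nlinarith [mul_nonneg hε.le (sq_nonneg (|x i| - 1))]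

/-! ### Symmetry of `D^B` -/

/-- The divergence of the regularized vector field, divided by the regularized weight: the right
side of Green's identity, with factors that tend to `1` in the terms with divided differences, and
an additional term that tends to `0`. -/
def greenReg {n : ℕ} (κ a ε : ℝ) (f g : MvPolynomial (Fin n) ℂ) (x : Fin n → ℝ) : ℂ :=
  ∑ i, evalReal (greenMain a i f g) x +
    2 * ∑ k, ∑ l ∈ Finset.Ioi k, ((κ * ((x k - x l) ^ 2 / ((x k - x l) ^ 2 + ε)) : ℝ) : ℂ) *
      evalReal (wronskDiff k l f g) x -
    2 * ∑ i, ((ε * x i ^ 2 / (1 + ε * x i ^ 2) : ℝ) : ℂ) * evalReal (X i * wronsk i f g) x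

/-- The derivative of `x_i² w_ε h_i` in direction `i`, for `h_i` the Wronskian and `w_ε` the
regularized weight. -/
def fieldDer {n : ℕ} (κ a ε : ℝ) (f g : MvPolynomial (Fin n) ℂ) (i : Fin n) (x : Fin n → ℝ) : ℂ :=
  (dens κ a ε x : ℂ) * evalReal (greenMain a i f g) x +
    ((x i ^ 2 * dens κ a ε x * logDer κ ε i x : ℝ) : ℂ) * evalReal (wronsk i f g) x

theorem hasLineDerivAt_field {n : ℕ} (κ a : ℝ) {ε : ℝ} (hε : 0 < ε) (f g : MvPolynomial (Fin n) ℂ)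
    (i : Fin n) (x : Fin n → ℝ) :
    HasLineDerivAt ℝ (fun y => ((y i ^ 2 * dens κ a ε y : ℝ) : ℂ) * evalReal (wronsk i f g) y)
      (fieldDer κ a ε f g i x) x (Pi.single i 1) := by
  have h1 := hasLineDerivAt_mul (hasLineDerivAt_ofReal (hasLineDerivAt_mul
    (hasLineDerivAt_sq_mul_wtN a i x) (hasLineDerivAt_vand_mul_cut κ hε i x)))
    (hasLineDerivAt_evalReal (wronsk i f g) i)
  have h2 : ∀ y : Fin n → ℝ, y i ^ 2 * dens κ a ε y =
      y i ^ 2 * wtN a y * (vand κ ε y * cut ε y) := fun y => by rw [dens]; ring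
  simp only [h2]
  have h3 : fieldDer κ a ε f g i x =
      (((a * x i + 2) * wtN a x * (vand κ ε x * cut ε x) +
        x i ^ 2 * wtN a x * (vand κ ε x * cut ε x * logDer κ ε i x) : ℝ) : ℂ) *
          evalReal (wronsk i f g) x +
        ((x i ^ 2 * wtN a x * (vand κ ε x * cut ε x) : ℝ) : ℂ) *
          evalReal (pderiv i (wronsk i f g)) x := by
    rw [fieldDer, greenMain, dens]
    simp only [evalReal, map_add, map_mul, map_pow, eval_X, eval_C, map_ofNat]
    push_cast
    ring
  rw [h3]
  exact h1

open MeasureTheory in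
theorem integral_fieldDer {n m : ℕ} {κ a ε : ℝ} (hκ : 0 ≤ κ)
    (ha : a < -2 * ((m : ℝ) + κ * ((n : ℝ) - 1)) + 1) (hε : 0 < ε) (hε1 : ε ≤ 1)
    {f g : MvPolynomial (Fin n) ℂ} (hfg : f.totalDegree + g.totalDegree ≤ 2 * m) (i : Fin n) :
    Integrable (fieldDer κ a ε f g i) ∧ ∫ x, fieldDer κ a ε f g i x = 0 := by
  have hw : IsTempered (2 * m) (evalReal (wronsk i f g)) :=
    isTempered_evalReal ((totalDegree_wronsk_le i le_rfl le_rfl).trans hfg)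
  have hm : IsTempered (2 * m) (evalReal (greenMain a i f g)) :=
    isTempered_evalReal ((totalDegree_greenMain_le a i le_rfl le_rfl).trans hfg)
  have hd := continuous_dens (n := n) hκ a hε.le
  have hx : Continuous fun x : Fin n → ℝ => x i ^ 2 := (continuous_apply i).pow 2
  obtain ⟨M, hM⟩ := exists_logDer_le (n := n) hκ hε hε1 i
  have hu : Integrable fun x : Fin n → ℝ =>
      ((x i ^ 2 * dens κ a ε x : ℝ) : ℂ) * evalReal (wronsk i f g) x := by
    refine Integrable.mono' ((integrable_wtDom hκ ha hw).const_mul ε⁻¹)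
      ((Complex.continuous_ofReal.comp (hx.mul hd)).mul hw.1).aestronglyMeasurable ?_
    refine Filter.Eventually.of_forall fun x => ?_
    rw [norm_mul, Complex.norm_real, Real.norm_of_nonneg
      (mul_nonneg (sq_nonneg _) (dens_nonneg κ a hε.le x)), ← mul_assoc]
    exact mul_le_mul_of_nonneg_right (sq_mul_dens_le hκ a hε hε1 i x) (norm_nonneg _)
  have hu' : Integrable (fieldDer κ a ε f g i) := by
    refine Integrable.add ?_ ?_
    · refine Integrable.mono' (integrable_wtDom hκ ha hm)
        ((Complex.continuous_ofReal.comp hd).mul hm.1).aestronglyMeasurable ?_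
      refine Filter.Eventually.of_forall fun x => ?_
      rw [norm_mul, Complex.norm_real, Real.norm_of_nonneg (dens_nonneg κ a hε.le x)]
      exact mul_le_mul_of_nonneg_right (dens_le hκ a hε.le hε1 x) (norm_nonneg _)
    · refine Integrable.mono' ((integrable_wtDom hκ ha hw).const_mul (ε⁻¹ * M))
        ((Complex.continuous_ofReal.comp ((hx.mul hd).mul
          (continuous_logDer κ hε i))).mul hw.1).aestronglyMeasurable ?_
      refine Filter.Eventually.of_forall fun x => ?_
      have h0 := mul_nonneg (sq_nonneg (x i)) (dens_nonneg κ a hε.le x)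
      rw [norm_mul, Complex.norm_real, norm_mul, Real.norm_of_nonneg h0, Real.norm_eq_abs]
      have h1 := mul_le_mul (sq_mul_dens_le hκ a hε hε1 i x) (hM x) (abs_nonneg _)
        (mul_nonneg (by positivity) (wtDom_nonneg κ a x))
      calc _ ≤ ε⁻¹ * wtDom κ a x * M * ‖evalReal (wronsk i f g) x‖ :=
            mul_le_mul_of_nonneg_right h1 (norm_nonneg _)
        _ = _ := by ring
  exact ⟨hu', integral_lineDeriv_eq_zero hu hu' (hasLineDerivAt_field κ a hε f g i)⟩

/-- The divergence of the vector field with components `x_i² w_ε h_i`. -/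
theorem sum_fieldDer {n : ℕ} (κ a ε : ℝ) (f g : symSub n) (x : Fin n → ℝ) :
    ∑ i, fieldDer κ a ε (f : MvPolynomial (Fin n) ℂ) g i x =
      (dens κ a ε x : ℂ) * greenReg κ a ε (f : MvPolynomial (Fin n) ℂ) g x := by
  set h : Fin n → ℂ := fun i => evalReal (wronsk i (f : MvPolynomial (Fin n) ℂ) g) x with hh
  set r : Fin n → Fin n → ℂ := fun k l =>
    evalReal (wronskDiff k l (f : MvPolynomial (Fin n) ℂ) g) x with hr
  have h1 : ∀ k, ∀ l ∈ Finset.Ioi k, ((x k : ℂ) - x l) * r k l = x k ^ 2 * h k - x l ^ 2 * h l := by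
    intro k l hl
    have := congrArg (fun p => evalReal p x) (sub_mul_wronskDiff (Finset.mem_Ioi.1 hl).ne f g)
    simp only [hh, hr]
    simpa only [evalReal, map_mul, map_sub, map_pow, eval_X] using this
  have h2 : ∀ k l : Fin n, ∑ i, (x i : ℂ) ^ 2 * h i *
      (((Pi.single i 1 : Fin n → ℝ) k - (Pi.single i 1 : Fin n → ℝ) l : ℝ) : ℂ) =
      x k ^ 2 * h k - x l ^ 2 * h l := by
    intro k l
    have h3 : ∀ k : Fin n, ∑ i, (x i : ℂ) ^ 2 * h i * (((Pi.single i 1 : Fin n → ℝ) k : ℝ) : ℂ) =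
        x k ^ 2 * h k := by
      intro k
      rw [Finset.sum_eq_single k]
      · simp
      · intro j _ hj; simp [hj.symm]
      · simp
    simp only [Complex.ofReal_sub, mul_sub, Finset.sum_sub_distrib, h3]
  have h4 : ∑ i, (x i : ℂ) ^ 2 * h i * (logDer κ ε i x : ℂ) =
      2 * ∑ k, ∑ l ∈ Finset.Ioi k,
        ((κ * ((x k - x l) ^ 2 / ((x k - x l) ^ 2 + ε)) : ℝ) : ℂ) * r k l -
      2 * ∑ i, ((ε * x i ^ 2 / (1 + ε * x i ^ 2) : ℝ) : ℂ) * (x i * h i) := by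
    have h5 : ∀ i, (x i : ℂ) ^ 2 * h i * (logDer κ ε i x : ℂ) =
        ∑ k, ∑ l ∈ Finset.Ioi k, ((κ * (2 * (x k - x l) / ((x k - x l) ^ 2 + ε)) : ℝ) : ℂ) *
          ((x i : ℂ) ^ 2 * h i *
            (((Pi.single i 1 : Fin n → ℝ) k - (Pi.single i 1 : Fin n → ℝ) l : ℝ) : ℂ)) -
        2 * (((ε * x i ^ 2 / (1 + ε * x i ^ 2) : ℝ) : ℂ) * (x i * h i)) := by
      intro i
      rw [logDer, Complex.ofReal_sub, mul_sub, Complex.ofReal_mul, Complex.ofReal_sum,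
        Finset.mul_sum, Finset.mul_sum]
      congr 1
      · refine Finset.sum_congr rfl fun k _ => ?_
        rw [Complex.ofReal_sum, Finset.mul_sum, Finset.mul_sum]
        refine Finset.sum_congr rfl fun l _ => ?_
        push_cast
        ring
      · push_cast
        ring
    rw [Finset.sum_congr rfl fun i _ => h5 i, Finset.sum_sub_distrib, ← Finset.mul_sum]
    congr 1
    rw [Finset.sum_comm, Finset.mul_sum]
    refine Finset.sum_congr rfl fun k _ => ?_
    rw [Finset.sum_comm, Finset.mul_sum]
    refine Finset.sum_congr rfl fun l hl => ?_
    rw [← Finset.mul_sum, h2, ← h1 k l hl]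
    push_cast
    ring
  have h6 : ∀ i, fieldDer κ a ε (f : MvPolynomial (Fin n) ℂ) g i x = (dens κ a ε x : ℂ) *
      (evalReal (greenMain a i (f : MvPolynomial (Fin n) ℂ) g) x +
        (x i : ℂ) ^ 2 * h i * (logDer κ ε i x : ℂ)) := by
    intro i
    rw [fieldDer]
    push_cast
    ring
  rw [Finset.sum_congr rfl fun i _ => h6 i, ← Finset.mul_sum, Finset.sum_add_distrib, h4, greenReg]
  have h7 : ∀ i, evalReal (X i * wronsk i (f : MvPolynomial (Fin n) ℂ) g) x = x i * h i := by
    intro i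
    simp only [hh, evalReal, map_mul, eval_X]
  simp only [h7]
  rw [add_sub_assoc]

open Filter Topology in
theorem tendsto_dens {n : ℕ} {κ : ℝ} (hκ : 0 ≤ κ) (a : ℝ) (x : Fin n → ℝ) :
    Tendsto (fun ε => dens κ a ε x) (𝓝[>] 0) (𝓝 (wtN a x * vand κ 0 x)) := by
  have h1 : Tendsto (fun ε => cut ε x) (𝓝 0) (𝓝 1) := by
    have : Tendsto (fun ε : ℝ => ∏ j, (1 + ε * x j ^ 2)⁻¹) (𝓝 0)
        (𝓝 (∏ j, (1 + 0 * x j ^ 2)⁻¹)) := by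
      refine tendsto_finsetProd _ fun j _ => ?_
      exact Tendsto.inv₀ ((by fun_prop : Continuous fun ε : ℝ => 1 + ε * x j ^ 2).tendsto 0)
        (by simp)
    simp only [zero_mul, add_zero, inv_one, Finset.prod_const_one] at this
    exact this
  have h2 := (((tendsto_vand hκ x).mul h1).const_mul (wtN a x)).mono_left
    (nhdsWithin_le_nhds (s := Set.Ioi 0))
  simpa [dens] using h2

open Filter Topology in
/-- Where two coordinates agree, the limit weight vanishes unless `κ = 0`. -/
theorem tendsto_dens_mul_ratio {n : ℕ} {κ : ℝ} (hκ : 0 ≤ κ) (a : ℝ) (x : Fin n → ℝ)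
    {k l : Fin n} (hkl : l ∈ Finset.Ioi k) :
    Tendsto (fun ε => dens κ a ε x * (κ * ((x k - x l) ^ 2 / ((x k - x l) ^ 2 + ε)))) (𝓝[>] 0)
      (𝓝 (wtN a x * vand κ 0 x * κ)) := by
  by_cases h : x k = x l
  · have h0 : wtN a x * vand κ 0 x * κ = 0 := by
      by_cases hκ0 : κ = 0
      · rw [hκ0, mul_zero]
      · have : vand κ 0 x = 0 := by
          refine Finset.prod_eq_zero (Finset.mem_univ k) (Finset.prod_eq_zero hkl ?_)
          rw [h, sub_self, zero_pow two_ne_zero, zero_add, Real.zero_rpow hκ0]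
        rw [this, mul_zero, zero_mul]
    simp [h0, h]
  · have hne : (x k - x l) ^ 2 ≠ 0 := pow_ne_zero 2 (sub_ne_zero.2 h)
    have h1 : Tendsto (fun ε : ℝ => (x k - x l) ^ 2 / ((x k - x l) ^ 2 + ε)) (𝓝 0)
        (𝓝 ((x k - x l) ^ 2 / ((x k - x l) ^ 2 + 0))) :=
      Tendsto.div tendsto_const_nhds
        ((by fun_prop : Continuous fun ε : ℝ => (x k - x l) ^ 2 + ε).tendsto 0) (by simpa using hne)
    rw [add_zero, div_self hne] at h1
    have h2 := (tendsto_dens hκ a x).mul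
      ((h1.const_mul κ).mono_left (nhdsWithin_le_nhds (s := Set.Ioi 0)))
    rwa [mul_one] at h2

open Filter Topology in
/-- Pointwise convergence to Green's identity times the weight. -/
theorem tendsto_greenReg {n : ℕ} {κ : ℝ} (hκ : 0 ≤ κ) (a : ℝ) (f g : symSub n) (x : Fin n → ℝ) :
    Tendsto (fun ε => (dens κ a ε x : ℂ) * greenReg κ a ε (f : MvPolynomial (Fin n) ℂ) g x)
      (𝓝[>] 0) (𝓝 (((wtN a x * vand κ 0 x : ℝ) : ℂ) *
        evalReal ((besselS κ a f : MvPolynomial (Fin n) ℂ) * (g : MvPolynomial (Fin n) ℂ) -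
          (f : MvPolynomial (Fin n) ℂ) * (besselS κ a g : MvPolynomial (Fin n) ℂ)) x)) := by
  have h1 : ∀ ε : ℝ, (dens κ a ε x : ℂ) * greenReg κ a ε (f : MvPolynomial (Fin n) ℂ) g x =
      (dens κ a ε x : ℂ) * ∑ i, evalReal (greenMain a i (f : MvPolynomial (Fin n) ℂ) g) x +
      2 * ∑ k, ∑ l ∈ Finset.Ioi k,
        ((dens κ a ε x * (κ * ((x k - x l) ^ 2 / ((x k - x l) ^ 2 + ε))) : ℝ) : ℂ) *
          evalReal (wronskDiff k l (f : MvPolynomial (Fin n) ℂ) g) x -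
      2 * ∑ i, ((dens κ a ε x * (ε * x i ^ 2 / (1 + ε * x i ^ 2)) : ℝ) : ℂ) *
        evalReal (X i * wronsk i (f : MvPolynomial (Fin n) ℂ) g) x := by
    intro ε
    rw [greenReg, mul_sub, mul_add, mul_left_comm, mul_left_comm (dens κ a ε x : ℂ) 2]
    simp only [Finset.mul_sum, Complex.ofReal_mul, mul_assoc]
  have h2 : ((wtN a x * vand κ 0 x : ℝ) : ℂ) *
        evalReal ((besselS κ a f : MvPolynomial (Fin n) ℂ) * (g : MvPolynomial (Fin n) ℂ) -
          (f : MvPolynomial (Fin n) ℂ) * (besselS κ a g : MvPolynomial (Fin n) ℂ)) x =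
      ((wtN a x * vand κ 0 x : ℝ) : ℂ) *
        ∑ i, evalReal (greenMain a i (f : MvPolynomial (Fin n) ℂ) g) x +
      2 * ∑ k, ∑ l ∈ Finset.Ioi k, ((wtN a x * vand κ 0 x * κ : ℝ) : ℂ) *
          evalReal (wronskDiff k l (f : MvPolynomial (Fin n) ℂ) g) x -
      2 * ∑ i, ((0 : ℝ) : ℂ) *
        evalReal (X i * wronsk i (f : MvPolynomial (Fin n) ℂ) g) x := by
    rw [green]
    simp only [evalReal, map_add, map_mul, map_sum, eval_C, Complex.ofReal_zero, zero_mul,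
      Finset.sum_const_zero, mul_zero, sub_zero, mul_add, Complex.ofReal_mul, Finset.mul_sum]
    congr 1
    exact Finset.sum_congr rfl fun k _ => Finset.sum_congr rfl fun l _ => by ring
  simp only [h1, h2]
  have hofReal : ∀ {F : ℝ → ℝ} {c : ℝ}, Tendsto F (𝓝[>] 0) (𝓝 c) →
      Tendsto (fun ε => (F ε : ℂ)) (𝓝[>] 0) (𝓝 (c : ℂ)) := fun h =>
    (Complex.continuous_ofReal.tendsto _).comp h
  refine Tendsto.sub (Tendsto.add ?_ (Tendsto.const_mul 2 ?_)) (Tendsto.const_mul 2 ?_)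
  · exact (hofReal (tendsto_dens hκ a x)).mul_const _
  · refine tendsto_finsetSum _ fun k _ => tendsto_finsetSum _ fun l hl => ?_
    exact (hofReal (tendsto_dens_mul_ratio hκ a x hl)).mul_const _
  · refine tendsto_finsetSum _ fun i _ => ?_
    refine (hofReal ?_).mul_const _
    have h3 : Tendsto (fun ε : ℝ => ε * x i ^ 2 / (1 + ε * x i ^ 2)) (𝓝 0)
        (𝓝 (0 * x i ^ 2 / (1 + 0 * x i ^ 2))) :=
      Tendsto.div ((by fun_prop : Continuous fun ε : ℝ => ε * x i ^ 2).tendsto 0)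
        ((by fun_prop : Continuous fun ε : ℝ => 1 + ε * x i ^ 2).tendsto 0) (by simp)
    rw [zero_mul, zero_div] at h3
    have h4 := (tendsto_dens hκ a x).mul (h3.mono_left (nhdsWithin_le_nhds (s := Set.Ioi 0)))
    rwa [mul_zero] at h4

/-- A bound for the regularized divergence that does not depend on `ε`. -/
def greenBound {n : ℕ} (κ a : ℝ) (f g : MvPolynomial (Fin n) ℂ) (x : Fin n → ℝ) : ℝ :=
  ∑ i, ‖evalReal (greenMain a i f g) x‖ +
    2 * ∑ k, ∑ l ∈ Finset.Ioi k, κ * ‖evalReal (wronskDiff k l f g) x‖ +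
    2 * ∑ i, ‖evalReal (X i * wronsk i f g) x‖

theorem norm_greenReg_le {n : ℕ} {κ ε : ℝ} (hκ : 0 ≤ κ) (a : ℝ) (hε : 0 < ε)
    (f g : MvPolynomial (Fin n) ℂ) (x : Fin n → ℝ) :
    ‖greenReg κ a ε f g x‖ ≤ greenBound κ a f g x := by
  refine (norm_sub_le _ _).trans (add_le_add ((norm_add_le _ _).trans (add_le_add
    (norm_sum_le _ _) ?_)) ?_)
  · rw [norm_mul, RCLike.norm_ofNat]
    refine mul_le_mul_of_nonneg_left ?_ zero_le_two
    refine (norm_sum_le _ _).trans (Finset.sum_le_sum fun k _ => ?_)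
    refine (norm_sum_le _ _).trans (Finset.sum_le_sum fun l _ => ?_)
    rw [norm_mul, Complex.norm_real]
    refine mul_le_mul_of_nonneg_right ?_ (norm_nonneg _)
    rw [Real.norm_of_nonneg (by positivity)]
    refine mul_le_of_le_one_right hκ ?_
    exact div_le_one_of_le₀ (le_add_of_nonneg_right hε.le) (by positivity)
  · rw [norm_mul, RCLike.norm_ofNat]
    refine mul_le_mul_of_nonneg_left ?_ zero_le_two
    refine (norm_sum_le _ _).trans (Finset.sum_le_sum fun i _ => ?_)
    rw [norm_mul, Complex.norm_real]
    refine mul_le_of_le_one_left (norm_nonneg _) ?_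
    rw [Real.norm_of_nonneg (by positivity)]
    exact div_le_one_of_le₀ (le_add_of_nonneg_left zero_le_one) (by positivity)

open MeasureTheory in
theorem integrable_greenBound {n m : ℕ} {κ a : ℝ} (hκ : 0 ≤ κ)
    (ha : a < -2 * ((m : ℝ) + κ * ((n : ℝ) - 1)) + 1)
    {f g : MvPolynomial (Fin n) ℂ} (hfg : f.totalDegree + g.totalDegree ≤ 2 * m) :
    Integrable fun x => wtDom κ a x * greenBound κ a f g x := by
  have h : ∀ p : MvPolynomial (Fin n) ℂ, p.totalDegree ≤ f.totalDegree + g.totalDegree →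
      Integrable fun x => wtDom κ a x * ‖evalReal p x‖ := fun p hp =>
    integrable_wtDom hκ ha (isTempered_evalReal (hp.trans hfg))
  simp only [greenBound, mul_add, Finset.mul_sum]
  refine Integrable.add (Integrable.add ?_ ?_) ?_
  · exact integrable_finsetSum _ fun i _ => h _ (totalDegree_greenMain_le a i le_rfl le_rfl)
  · refine integrable_finsetSum _ fun k _ => integrable_finsetSum _ fun l hl => ?_
    have := (h _ (totalDegree_wronskDiff_le (Finset.mem_Ioi.1 hl).ne le_rfl le_rfl)).const_mul
      (2 * κ)
    refine this.congr (Filter.Eventually.of_forall fun x => ?_)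
    simp only
    ring
  · refine integrable_finsetSum _ fun i _ => ?_
    have := (h _ (totalDegree_X_mul_wronsk_le i le_rfl le_rfl)).const_mul 2
    refine this.congr (Filter.Eventually.of_forall fun x => ?_)
    simp only
    ring

open MeasureTheory Filter Topology in
/-- `D^B` is symmetric for the weight. The boundary terms and the singular set of `D^B` are
avoided by integrating the divergence of a regularized vector field, and letting `ε → 0`. -/
theorem integral_green {n m : ℕ} {κ a : ℝ} (hκ : 0 ≤ κ)
    (ha : a < -2 * ((m : ℝ) + κ * ((n : ℝ) - 1)) + 1) (f g : symSub n)
    (hfg : (f : MvPolynomial (Fin n) ℂ).totalDegree +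
      (g : MvPolynomial (Fin n) ℂ).totalDegree ≤ 2 * m) :
    ∫ x, evalReal ((besselS κ a f : MvPolynomial (Fin n) ℂ) * (g : MvPolynomial (Fin n) ℂ) -
      (f : MvPolynomial (Fin n) ℂ) * (besselS κ a g : MvPolynomial (Fin n) ℂ)) x
        ∂besselMeasure n κ a = 0 := by
  have h01 : ∀ᶠ ε : ℝ in 𝓝[>] 0, 0 < ε ∧ ε ≤ 1 := by
    filter_upwards [Ioc_mem_nhdsGT (zero_lt_one (α := ℝ))] with ε hε using hε
  have h0 : ∀ ε : ℝ, 0 < ε ∧ ε ≤ 1 →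
      Integrable (fun x => (dens κ a ε x : ℂ) *
        greenReg κ a ε (f : MvPolynomial (Fin n) ℂ) g x) ∧
      ∫ x, (dens κ a ε x : ℂ) * greenReg κ a ε (f : MvPolynomial (Fin n) ℂ) g x = 0 := by
    rintro ε ⟨hε, hε1⟩
    have h := fun i => integral_fieldDer (n := n) hκ ha hε hε1 hfg i
    simp only [← sum_fieldDer]
    refine ⟨integrable_finsetSum _ fun i _ => (h i).1, ?_⟩
    rw [integral_finsetSum _ fun i _ => (h i).1]
    exact Finset.sum_eq_zero fun i _ => (h i).2
  have hlim := tendsto_integral_filter_of_dominated_convergence (μ := volume) (l := 𝓝[>] (0 : ℝ))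
    (fun x => wtDom κ a x * greenBound κ a (f : MvPolynomial (Fin n) ℂ) g x)
    (h01.mono fun ε hε => (h0 ε hε).1.aestronglyMeasurable)
    (h01.mono fun ε hε => Eventually.of_forall fun x => by
      rw [norm_mul, Complex.norm_real, Real.norm_of_nonneg (dens_nonneg κ a hε.1.le x)]
      exact mul_le_mul (dens_le hκ a hε.1.le hε.2 x) (norm_greenReg_le hκ a hε.1 _ _ x)
        (norm_nonneg _) (wtDom_nonneg κ a x))
    (integrable_greenBound hκ ha hfg)
    (Eventually.of_forall fun x => tendsto_greenReg hκ a f g x)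
  have hzero : Tendsto (fun ε => ∫ x, (dens κ a ε x : ℂ) *
      greenReg κ a ε (f : MvPolynomial (Fin n) ℂ) g x) (𝓝[>] 0) (𝓝 0) :=
    tendsto_const_nhds.congr' (h01.mono fun ε hε => (h0 ε hε).2.symm)
  rw [integral_besselMeasure hκ]
  simp only [Complex.real_smul]
  exact tendsto_nhds_unique hlim hzero

/-! ### The inner product -/

/-- The polynomial with conjugated coefficients. -/
def conjS {n : ℕ} (g : symSub n) : symSub n :=
  ⟨map (starRingEnd ℂ) (g : MvPolynomial (Fin n) ℂ), by
    rw [mem_symSub]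
    intro w
    rw [← map_rename, mem_symSub.1 g.2]⟩

theorem coe_conjS {n : ℕ} (g : symSub n) :
    (conjS g : MvPolynomial (Fin n) ℂ) = map (starRingEnd ℂ) (g : MvPolynomial (Fin n) ℂ) := rfl

theorem evalReal_map_conj {n : ℕ} (p : MvPolynomial (Fin n) ℂ) (x : Fin n → ℝ) :
    evalReal (map (starRingEnd ℂ) p) x = starRingEnd ℂ (evalReal p x) := by
  induction p using MvPolynomial.induction_on with
  | C c => simp [evalReal]
  | add p q hp hq => simp only [evalReal, map_add] at *; rw [hp, hq]
  | mul_X p k hp =>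
    simp only [evalReal, map_mul, map_X, eval_X, Complex.conj_ofReal] at *
    rw [hp]

theorem totalDegree_conjS_le {n : ℕ} (g : symSub n) :
    (conjS g : MvPolynomial (Fin n) ℂ).totalDegree ≤ (g : MvPolynomial (Fin n) ℂ).totalDegree :=
  Finset.sup_mono (support_map_subset _ _)

theorem divDiff_map_conj {n : ℕ} {k l : Fin n} (hkl : k ≠ l) (p : MvPolynomial (Fin n) ℂ) :
    divDiff k l (map (starRingEnd ℂ) p) = map (starRingEnd ℂ) (divDiff k l p) := by
  apply divDiff_eq hkl
  have := congrArg (map (starRingEnd ℂ)) (sub_mul_divDiff hkl p)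
  simp only [map_mul, map_sub, map_X, map_rename] at this
  exact this

/-- `D^B` has real coefficients. -/
theorem besselS_conjS {n : ℕ} (κ a : ℝ) (g : symSub n) :
    besselS κ a (conjS g) = conjS (besselS κ a g) := by
  apply Subtype.ext
  rw [coe_conjS, coe_besselS, coe_besselS, coe_conjS]
  have h : ∀ k, ∀ l ∈ Finset.Ioi k, divDiff k l (X k ^ 2 * map (starRingEnd ℂ)
      (pderiv k (g : MvPolynomial (Fin n) ℂ))) = map (starRingEnd ℂ)
        (divDiff k l (X k ^ 2 * pderiv k (g : MvPolynomial (Fin n) ℂ))) := by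
    intro k l hl
    have e : map (starRingEnd ℂ) (X k ^ 2 * pderiv k (g : MvPolynomial (Fin n) ℂ)) =
        X k ^ 2 * map (starRingEnd ℂ) (pderiv k (g : MvPolynomial (Fin n) ℂ)) := by
      rw [map_mul, map_pow, map_X]
    rw [← e, divDiff_map_conj (Finset.mem_Ioi.1 hl).ne]
  simp only [pderiv_map]
  rw [Finset.sum_congr rfl fun k _ => Finset.sum_congr rfl fun l hl => h k l hl]
  simp only [map_add, map_mul, map_sum, map_pow, map_X, map_C, Complex.conj_ofReal, map_ofNat]

theorem totalDegree_le_of_mem_degS {n : ℕ} {κ : ℝ} {hκ : 0 ≤ κ} {d : ℕ} {f : symSub n}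
    (hf : f ∈ degS hκ d) : (f : MvPolynomial (Fin n) ℂ).totalDegree ≤ d := by
  have h : degS hκ d ≤ (restrictTotalDegree (Fin n) ℂ d).comap (symSub n).subtype := by
    rw [degS, Submodule.span_le]
    rintro _ ⟨σ, hσ, rfl⟩
    rw [SetLike.mem_coe, Submodule.mem_comap, mem_restrictTotalDegree, Submodule.subtype_apply,
      jackBasis_apply]
    refine Finset.sup_le fun α hα => ?_
    have := (mem_belowSub.1 (jack_mem_belowSub hκ σ) α (mem_support_iff.1 hα)).1
    refine le_trans (le_of_eq ?_) (Set.mem_ofPred.1 hσ)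
    rw [← this, Finsupp.sum_fintype _ _ fun _ => rfl]
  exact (mem_restrictTotalDegree _ _ _).1 (h hf)

theorem isTempered_of_mem_degS {n m p q : ℕ} {κ : ℝ} {hκ : 0 ≤ κ} (hpq : p + q ≤ 2 * m)
    {f g : symSub n} (hf : f ∈ degS hκ p) (hg : g ∈ degS hκ q) :
    IsTempered (2 * m) fun x => evalReal (f : MvPolynomial (Fin n) ℂ) x *
      starRingEnd ℂ (evalReal (g : MvPolynomial (Fin n) ℂ) x) :=
  isTempered_mul_conj ((Nat.add_le_add (totalDegree_le_of_mem_degS hf)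
    (totalDegree_le_of_mem_degS hg)).trans hpq)

open MeasureTheory in
/-- Orthogonality with respect to `innerB` reduces to the algebra of `IsBesselForm.orthogonal`. -/
theorem isBesselForm_innerB {n m : ℕ} {κ a : ℝ} (hκ : 0 ≤ κ)
    (ha : a < -2 * ((m : ℝ) + κ * ((n : ℝ) - 1)) + 1) :
    IsBesselForm hκ a m fun f g : symSub n =>
      innerB κ a (f : MvPolynomial (Fin n) ℂ) (g : MvPolynomial (Fin n) ℂ) where
  add_left {p q} hpq {f f' g} hf hf' hg := by
    rw [innerB, innerB, innerB, ← integral_add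
      ((isTempered_of_mem_degS hpq hf hg).integrable hκ ha)
      ((isTempered_of_mem_degS hpq hf' hg).integrable hκ ha)]
    refine integral_congr_ae (Filter.Eventually.of_forall fun x => ?_)
    simp only [evalReal, Submodule.coe_add, map_add, add_mul]
  smul_left c f g := by
    rw [innerB, innerB, ← integral_const_mul]
    refine integral_congr_ae (Filter.Eventually.of_forall fun x => ?_)
    simp only [evalReal, Submodule.coe_smul, smul_eval, mul_assoc]
  conj f g := by
    rw [innerB, innerB, ← integral_conj]
    refine integral_congr_ae (Filter.Eventually.of_forall fun x => ?_)
    simp only [map_mul, Complex.conj_conj]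
    rw [mul_comm]
  p1S_left f g := by
    rw [innerB, innerB]
    refine integral_congr_ae (Filter.Eventually.of_forall fun x => ?_)
    simp only [evalReal, coe_p1S, map_mul, map_sum, eval_X, Complex.conj_ofReal]
    ring
  besselS_left {p q} hpq {f g} hf hg := by
    rw [← sub_eq_zero, innerB, innerB, ← integral_sub
      ((isTempered_of_mem_degS hpq (besselS_mem_degS hκ a hf) hg).integrable hκ ha)
      ((isTempered_of_mem_degS hpq hf (besselS_mem_degS hκ a hg)).integrable hκ ha),
      ← integral_green hκ ha f (conjS g)]
    · refine integral_congr_ae (Filter.Eventually.of_forall fun x => ?_)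
      simp only [← evalReal_map_conj, besselS_conjS, coe_conjS]
      simp only [evalReal, map_sub, map_mul]
    · exact ((Nat.add_le_add (totalDegree_le_of_mem_degS hf) ((totalDegree_conjS_le g).trans
        (totalDegree_le_of_mem_degS hg))).trans hpq)

open MeasureTheory in
theorem memLp_evalReal {n m : ℕ} {κ a : ℝ} (hκ : 0 ≤ κ)
    (ha : a < -2 * ((m : ℝ) + κ * ((n : ℝ) - 1)) + 1) {f : symSub n} (hf : f ∈ degS hκ m) :
    MemLp (evalReal (f : MvPolynomial (Fin n) ℂ)) 2 (besselMeasure n κ a) := by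
  have h1 := isTempered_evalReal (le_refl (f : MvPolynomial (Fin n) ℂ).totalDegree)
  rw [memLp_two_iff_integrable_sq_norm h1.1.aestronglyMeasurable]
  refine ((isTempered_of_mem_degS (by omega) hf hf).integrable hκ ha).norm.congr
    (Filter.Eventually.of_forall fun x => ?_)
  simp only [norm_mul, RCLike.norm_conj]
  rw [pow_two]

end MultiBessel

theorem mainTheorem1 (n m : ℕ) (κ a : ℝ) (hκ : 0 ≤ κ)
    (ha : a < -2 * ((m : ℝ) + κ * ((n : ℝ) - 1)) + 1) :
    (∀ lam : Fin n → ℕ, Antitone lam → MultiBessel.weight lam ≤ m →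
      ∃! Y : MvPolynomial (Fin n) ℂ, MultiBessel.IsBessel κ a lam Y) ∧
    (∀ (lam : Fin n → ℕ) (Y : MvPolynomial (Fin n) ℂ),
      Antitone lam → MultiBessel.weight lam ≤ m → MultiBessel.IsBessel κ a lam Y →
        MeasureTheory.MemLp (MultiBessel.evalReal Y) 2 (MultiBessel.besselMeasure n κ a)) ∧
    (∀ (lam mu : Fin n → ℕ) (Y Z : MvPolynomial (Fin n) ℂ),
      Antitone lam → MultiBessel.weight lam ≤ m → MultiBessel.IsBessel κ a lam Y →
      Antitone mu → MultiBessel.weight mu ≤ m → MultiBessel.IsBessel κ a mu Z →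
      lam ≠ mu → MultiBessel.innerB κ a Y Z = 0) := by
  refine ⟨fun lam hl hw => ?_, fun lam Y hl hw hY => ?_,
    fun lam mu Y Z hl hlw hY hm hmw hZ hne => ?_⟩
  · obtain ⟨y, hy⟩ := MultiBessel.exists_isBesselS hκ ha (lam := ⟨lam, hl⟩) hw
    refine ⟨y, (MultiBessel.isBessel_iff hκ a ⟨lam, hl⟩ _).2 ⟨y, rfl, hy⟩, fun Z hZ => ?_⟩
    obtain ⟨z, rfl, hz⟩ := (MultiBessel.isBessel_iff hκ a ⟨lam, hl⟩ Z).1 hZ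
    rw [MultiBessel.isBesselS_unique hκ ha hw hz hy]
  · obtain ⟨y, rfl, hy⟩ := (MultiBessel.isBessel_iff hκ a ⟨lam, hl⟩ Y).1 hY
    have h1 := MultiBessel.lowSpan_le_degS hκ _ hy.mem_lowSpan
    have h2 := MultiBessel.degS_mono hκ hw h1
    exact MultiBessel.memLp_evalReal hκ ha h2
  · obtain ⟨y, rfl, hy⟩ := (MultiBessel.isBessel_iff hκ a ⟨lam, hl⟩ Y).1 hY
    obtain ⟨z, rfl, hz⟩ := (MultiBessel.isBessel_iff hκ a ⟨mu, hm⟩ Z).1 hZ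
    exact (MultiBessel.isBesselForm_innerB hκ ha).orthogonal ha hlw hmw
      (fun e => hne (congrArg Subtype.val e)) hy hz

end
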